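/- Let $A=(a_{ij})_{0\le i,j\le n}$ be an irreducible affine Cartan matrix, with nodes enumerated as in Kac's Table Aff, whose affine simple root $\alpha_0$ is short, i.e. $A$ is any irreducible affine Cartan matrix except $B_n^{(1)}$, $C_n^{(1)}$, $F_4^{(1)}$, $G_2^{(1)}$: $A$ is one of $A_n^{(1)}$ ($n\ge1$), $D_n^{(1)}$ ($n\ge 4$), $E_6^{(1)},E_7^{(1)},E_8^{(1)}$, $A_{2n-1}^{(2)}$ ($n\ge3$), $A_{2n}^{(2)}$ ($n\ge1$), $D_{n+1}^{(2)}=B_n^{(2)}$ ($n\ge2$), $E_6^{(2)}$, $D_4^{(3)}$. Let $a_0,\dots,a_n$ be the labels of its Dynkin diagram, $\delta=\sum_{j=0}^n a_j\alpha_j$, $\theta=\delta-a_0\alpha_0$, and $(\alpha_j,\alpha_i^\vee)=a_{ij}$. Two nodes $i\neq j$ are joined by $a_{ij}a_{ji}$ laces. For $i\ne j$, elements $x,y$ satisfy the braid relation for $(i,j)$ if $xyx\cdots=yxy\cdots$ with $m_{ij}$ factors on each side, where $m_{ij}=2,3,4,6$ for $0,1,2,3$ laces; for $4$ laces (which happens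 only for $A_1^{(1)}$ and $A_2^{(2)}$) there is no relation. Let $\mathring Q$ be the root lattice $\bigoplus_{j=1}^n\mathbb Z\alpha_j$ of the finite root system, except that for $A_{2n}^{(2)}$ it is the weight lattice of the finite root system. Let $s_\theta=s_{j_1}\cdots s_{j_m}$ be a reduced decomposition in the simple reflections $s_1,\dots,s_n$ (one exists), and in any group with elements $T_1,\dots,T_n$ put $T_{s_\theta}=T_{j_1}\cdots T_{j_m}$. The double affine Artin group $\mathcal A_{\tilde W}$ has generators $T_0,\dots,T_n$ and $X_\beta$, $\beta\in\mathring Q\oplus\mathbb Z a_0^{-1}\delta$, with relations: the braid relations for $T_i,T_j$ ($i\ne j$); $X_{\beta+\gamma}=X_\beta X_\gamma$; $X_{a_0^{-1}\delta}$ is central; $T_iX_\beta=X_\beta T_i$ if $(\beta,\alpha_i^\vee)=0$; and $T_iX_\beta T_i=X_{s_i(\beta)}$ if $(\beta,\alpha_i^\vee)=-1$ (for $A_{2n}^{(2)}$ the last relation is imposed only for $0\le i\le n-1$). Let $\alpha=\alpha_i$ with $i\neq 0$ be the simple root whose node is connected to the affine node; if there are two such nodes (type $A_n^{(1)}$, $n\ge2$),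 choose one of them. The triple group $\mathcal A$ has generators $\mathcal T_1,\dots,\mathcal T_n$ (one for each non-affine node) and $\mathcal T_{01},\mathcal T_{02},\mathcal T_{03}$ (all three belonging to the affine node), with relations: (a) the braid relations for each pair of generators belonging to distinct nodes; (b) if the affine node and $\alpha$ are joined by a single lace, with $\mathcal D=\mathcal T_{01}\mathcal T_{02}\mathcal T_{03}$, each $y$ among $\mathcal T_{01},\mathcal T_{02},\mathcal T_{03},\mathcal T_{01}\mathcal T_{02}\mathcal T_{01}^{-1},\mathcal T_{03}^{-1}\mathcal T_{02}\mathcal T_{03}$ satisfies $yxy=xyx$ with $x=\mathcal D^k\mathcal T_\alpha\mathcal D^{-k}$ for all $k\in\mathbb Z$; (c) if they are joined by a double lace, $\mathcal T_{0i}\mathcal T_\alpha^{-1}\mathcal T_{0j}\mathcal T_\alpha=\mathcal T_\alpha^{-1}\mathcal T_{0j}\mathcal T_\alpha\mathcal T_{0i}$ for $1\le i<j\le3$. Let $\tilde{\mathcal A}$ be the quotient of $\mathcal A$ by the relations that $\mathcal C=\mathcal T_{01}\mathcal T_{02}\mathcal T_{03}\mathcal T_{s_\theta}$ is central. Theorem.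 The groups $\tilde{\mathcal A}$ and $\mathcal A_{\tilde W}$ are isomorphic. More precisely, there are group morphisms $\phi:\tilde{\mathcal A}\to\mathcal A_{\tilde W}$ and $\psi:\mathcal A_{\tilde W}\to\tilde{\mathcal A}$, inverse to each other, with $$\phi(\mathcal T_i)=T_i\ (i\ne0),\quad \phi(\mathcal T_{01})=T_0,\quad \phi(\mathcal T_{02})=T_0^{-1}X_{\alpha_0},\quad \phi(\mathcal T_{03})=X_{a_0^{-1}\theta}T_{s_\theta}^{-1},$$ $$\psi(T_i)=\mathcal T_i\ (i\neq0),\quad \psi(T_0)=\mathcal T_{01},\quad \psi(X_{a_0^{-1}\theta})=\mathcal T_{03}\mathcal T_{s_\theta},\quad \psi(X_{a_0^{-1}\delta})=\mathcal C.$$ -/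

import Mathlib

/-- The irreducible affine Cartan matrices (in the tables of Kac) whose affine simple root `α₀` is
short, that is, all of them except `Bₙ⁽¹⁾` (`n ≥ 3`), `Cₙ⁽¹⁾` (`n ≥ 2`), `F₄⁽¹⁾`, `G₂⁽¹⁾`. -/
inductive AffineType where
  /-- `Aₙ⁽¹⁾`, `n ≥ 1` -/
  | untwistedA (n : ℕ) (hn : 1 ≤ n)
  /-- `Dₙ⁽¹⁾`, `n ≥ 4` -/
  | untwistedD (n : ℕ) (hn : 4 ≤ n)
  /-- `E₆⁽¹⁾` -/
  | untwistedESix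
  /-- `E₇⁽¹⁾` -/
  | untwistedESeven
  /-- `E₈⁽¹⁾` -/
  | untwistedEEight
  /-- `A₂ₙ₋₁⁽²⁾`, `n ≥ 3` -/
  | twistedAOdd (n : ℕ) (hn : 3 ≤ n)
  /-- `A₂ₙ⁽²⁾`, `n ≥ 1` -/
  | twistedAEven (n : ℕ) (hn : 1 ≤ n)
  /-- `Dₙ₊₁⁽²⁾`, `n ≥ 2`, also written `Bₙ⁽²⁾` -/
  | twistedD (n : ℕ) (hn : 2 ≤ n)
  /-- `E₆⁽²⁾` -/
  | twistedESix
  /-- `D₄⁽³⁾` -/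
  | twistedDFour

namespace AffineType

/-- The number `n` such that the nodes of the Dynkin diagram are `0, 1, …, n`. -/
def rank : AffineType → ℕ
  | untwistedA n _ => n
  | untwistedD n _ => n
  | untwistedESix => 6
  | untwistedESeven => 7
  | untwistedEEight => 8
  | twistedAOdd n _ => n
  | twistedAEven n _ => n
  | twistedD n _ => n
  | twistedESix => 4
  | twistedDFour => 2

/-- The nodes of the Dynkin diagram; the affine node is `0`. -/
abbrev Node (X : AffineType) : Type := Fin (X.rank + 1)

/-- Is the Cartan matrix of type `A₂ₙ⁽²⁾`? -/
def isAEven : AffineType → Bool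
  | twistedAEven _ _ => true
  | _ => false

/-- `i` and `j` are joined in the graph with the listed edges. -/
def joined (edges : List (ℕ × ℕ)) (i j : ℕ) : ℤ :=
  if (i, j) ∈ edges ∨ (j, i) ∈ edges then 1 else 0

/-- The numbers `-a_{ij}` for `i ≠ j`, in the enumeration of the nodes of Kac. -/
def offDiag : AffineType → ℕ → ℕ → ℤ
  | untwistedA n _, i, j =>
      if n = 1 then 2
      else if i + 1 = j ∨ j + 1 = i ∨ (i = 0 ∧ j = n) ∨ (i = n ∧ j = 0) then 1 else 0
  | untwistedD n _, i, j =>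
      if (i = 0 ∧ j = 2) ∨ (i = 2 ∧ j = 0) ∨
          (1 ≤ i ∧ i + 1 = j ∧ j < n) ∨ (1 ≤ j ∧ j + 1 = i ∧ i < n) ∨
          (i + 2 = n ∧ j = n) ∨ (j + 2 = n ∧ i = n) then 1 else 0
  | untwistedESix, i, j => joined [(1, 2), (2, 3), (3, 4), (4, 5), (3, 6), (6, 0)] i j
  | untwistedESeven, i, j =>
      joined [(0, 1), (1, 2), (2, 3), (3, 4), (4, 5), (5, 6), (3, 7)] i j
  | untwistedEEight, i, j =>
      joined [(0, 1), (1, 2), (2, 3), (3, 4), (4, 5), (5, 6), (6, 7), (5, 8)] i j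
  | twistedAOdd n _, i, j =>
      if (i = 0 ∧ j = 2) ∨ (i = 2 ∧ j = 0) ∨ (1 ≤ i ∧ i + 1 = j) ∨ (1 ≤ j ∧ j + 1 = i) then
        (if j = n then 2 else 1) else 0
  | twistedAEven n _, i, j =>
      if i + 1 = j ∨ j + 1 = i then
        (if i = 0 then 2 else 1) * (if j = n then 2 else 1) else 0
  | twistedD n _, i, j =>
      if i + 1 = j ∨ j + 1 = i then
        (if i = 0 then 2 else 1) * (if i = n then 2 else 1) else 0
  | twistedESix, i, j =>
      if i + 1 = j ∨ j + 1 = i then (if i = 2 ∧ j = 3 then 2 else 1) else 0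
  | twistedDFour, i, j =>
      if i + 1 = j ∨ j + 1 = i then (if i = 1 ∧ j = 2 then 3 else 1) else 0

/-- The Cartan matrix `A = (a_{ij})`, with `a_{ij} = (α_j, α_i^∨)`. -/
def cartan (X : AffineType) : Matrix X.Node X.Node ℤ :=
  fun i j => if i = j then 2 else -X.offDiag i j

/-- The labels `a_0, …, a_n` of the Dynkin diagram. -/
def label : AffineType → ℕ → ℕ
  | untwistedA _ _, _ => 1
  | untwistedD n _, i => if i ≤ 1 ∨ n ≤ i + 1 then 1 else 2
  | untwistedESix, i => [1, 1, 2, 3, 2, 1, 2].getD i 0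
  | untwistedESeven, i => [1, 2, 3, 4, 3, 2, 1, 2].getD i 0
  | untwistedEEight, i => [1, 2, 3, 4, 5, 6, 4, 2, 3].getD i 0
  | twistedAOdd n _, i => if i ≤ 1 ∨ i = n then 1 else 2
  | twistedAEven n _, i => if i = n then 1 else 2
  | twistedD _ _, _ => 1
  | twistedESix, i => [1, 2, 3, 2, 1].getD i 0
  | twistedDFour, i => [1, 2, 1].getD i 0

/-- The labels `a_0^∨, …, a_n^∨` of the dual Dynkin diagram. -/
def colabel : AffineType → ℕ → ℕ
  | twistedAOdd _ _, i => if i ≤ 1 then 1 else 2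
  | twistedAEven _ _, i => if i = 0 then 1 else 2
  | twistedD n _, i => if i = 0 ∨ i = n then 1 else 2
  | twistedESix, i => [1, 2, 3, 4, 2].getD i 0
  | twistedDFour, i => [1, 2, 3].getD i 0
  | X, i => X.label i

/-- The rational span of the simple roots `α_0, …, α_n`, in coordinates: `x = ∑ x_j α_j`. -/
abbrev Space (X : AffineType) : Type := X.Node → ℚ

/-- The simple root `α_i`. -/
def simpleRoot (X : AffineType) (i : X.Node) : X.Space := Pi.single i 1

/-- `δ = ∑ a_j α_j`. -/
def delta (X : AffineType) : X.Space := fun j => (X.label j : ℚ)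

/-- `θ = δ - a_0 α_0`. -/
def theta (X : AffineType) : X.Space := X.delta - (X.label 0 : ℚ) • X.simpleRoot 0

/-- `a_0⁻¹ δ`. -/
def deltaDiv (X : AffineType) : X.Space := (X.label 0 : ℚ)⁻¹ • X.delta

/-- `a_0⁻¹ θ`. -/
def thetaDiv (X : AffineType) : X.Space := (X.label 0 : ℚ)⁻¹ • X.theta

/-- The canonical bilinear form, `(α_j, α_k) = d_j⁻¹ a_{jk}` with `d_j = a_j / a_j^∨`. -/
def form (X : AffineType) (x y : X.Space) : ℚ :=
  ∑ j, ∑ k, x j * y k * (((X.label j : ℚ) / (X.colabel j : ℚ))⁻¹ * (X.cartan j k : ℚ))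

/-- The pairing `(β, α_i^∨)`, determined by `(α_k, α_i^∨) = a_{ik}`. -/
def pairing (X : AffineType) (β : X.Space) (i : X.Node) : ℚ :=
  ∑ k, (X.cartan i k : ℚ) * β k

/-- The simple reflection `s_i`. -/
def simpleRefl (X : AffineType) (i : X.Node) (x : X.Space) : X.Space :=
  x - X.pairing x i • X.simpleRoot i

/-- The reflection `s_θ`. -/
def thetaRefl (X : AffineType) (x : X.Space) : X.Space :=
  x - (2 * X.form x X.theta / X.form X.theta X.theta) • X.theta

/-- The action of `s_{j_1} s_{j_2} ⋯ s_{j_m}`. The letter `j : Fin n` of a word stands for the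
non-affine node `j.succ`. -/
def wordAct (X : AffineType) (w : List (Fin X.rank)) (x : X.Space) : X.Space :=
  w.foldr (fun j y => X.simpleRefl j.succ y) x

/-- `w` is a reduced decomposition of `s_θ` in the simple reflections `s_1, …, s_n`. -/
def IsReducedTheta (X : AffineType) (w : List (Fin X.rank)) : Prop :=
  X.wordAct w = X.thetaRefl ∧
    ∀ v : List (Fin X.rank), X.wordAct v = X.thetaRefl → w.length ≤ v.length

/-- The root lattice `⨁_{j ≠ 0} ℤ α_j` of the finite root system. -/
def finRootLattice (X : AffineType) : AddSubgroup X.Space where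
  carrier := {β | β 0 = 0 ∧ ∀ j, ∃ z : ℤ, β j = z}
  zero_mem' := ⟨rfl, fun _ => ⟨0, by simp⟩⟩
  add_mem' := by
    rintro a b ⟨ha, ha2⟩ ⟨hb, hb2⟩
    refine ⟨by simp [ha, hb], fun j => ?_⟩
    obtain ⟨z, hz⟩ := ha2 j
    obtain ⟨y, hy⟩ := hb2 j
    exact ⟨z + y, by simp [hz, hy]⟩
  neg_mem' := by
    rintro a ⟨ha, ha2⟩
    refine ⟨by simp [ha], fun j => ?_⟩
    obtain ⟨z, hz⟩ := ha2 j
    exact ⟨-z, by simp [hz]⟩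

theorem pairing_add (X : AffineType) (a b : X.Space) (i : X.Node) :
    X.pairing (a + b) i = X.pairing a i + X.pairing b i := by
  simp [pairing, mul_add, Finset.sum_add_distrib]

theorem pairing_neg (X : AffineType) (a : X.Space) (i : X.Node) :
    X.pairing (-a) i = -X.pairing a i := by
  simp [pairing]

/-- The weight lattice of the finite root system. -/
def finWeightLattice (X : AffineType) : AddSubgroup X.Space where
  carrier := {β | β 0 = 0 ∧ ∀ i, i ≠ 0 → ∃ z : ℤ, X.pairing β i = z}
  zero_mem' := ⟨rfl, fun _ _ => ⟨0, by simp [pairing]⟩⟩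
  add_mem' := by
    rintro a b ⟨ha, ha2⟩ ⟨hb, hb2⟩
    refine ⟨by simp [ha, hb], fun j hj => ?_⟩
    obtain ⟨z, hz⟩ := ha2 j hj
    obtain ⟨y, hy⟩ := hb2 j hj
    exact ⟨z + y, by simp [pairing_add, hz, hy]⟩
  neg_mem' := by
    rintro a ⟨ha, ha2⟩
    refine ⟨by simp [ha], fun j hj => ?_⟩
    obtain ⟨z, hz⟩ := ha2 j hj
    exact ⟨-z, by simp [pairing_neg, hz]⟩

/-- The finite lattice: the weight lattice for `A₂ₙ⁽²⁾`, the root lattice otherwise. -/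
def finLattice (X : AffineType) : AddSubgroup X.Space :=
  if X.isAEven = true then X.finWeightLattice else X.finRootLattice

/-- The lattice spanned by the finite lattice and `a_0⁻¹ δ` (the sum is direct). -/
def fullLattice (X : AffineType) : AddSubgroup X.Space :=
  X.finLattice ⊔ AddSubgroup.zmultiples X.deltaDiv

theorem sum_cartan_label_AEven (n : ℕ) (hn : 1 ≤ n) (i : ℕ) (hi : i < n + 1) :
    ∑ k ∈ Finset.range (n + 1), (if i = k then 2 else -(twistedAEven n hn).offDiag i k) *
      ((twistedAEven n hn).label k : ℤ) = 0 := by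
  have key : ∀ k ∈ Finset.range (n + 1),
      (if i = k then 2 else -(twistedAEven n hn).offDiag i k) *
        ((twistedAEven n hn).label k : ℤ) =
      (if k = i then (if i = n then 2 else 4) else 0) +
        (if k = i + 1 then (if i = 0 then -4 else -2) else 0) +
        (if k + 1 = i then -2 else 0) := by
    intro k hk
    have hk' : k < n + 1 := Finset.mem_range.1 hk
    simp only [offDiag, label]
    split_ifs <;> omega
  rw [Finset.sum_congr rfl key, Finset.sum_add_distrib, Finset.sum_add_distrib,
    Finset.sum_ite_eq', Finset.sum_ite_eq']
  rcases i with _ | i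
  · have : n ≠ 0 := by omega
    simp [this, this.symm, Nat.pos_iff_ne_zero]
  · simp only [Nat.add_right_cancel_iff, Finset.sum_ite_eq', Finset.mem_range]
    split_ifs <;> first | contradiction | omega

theorem pairing_delta_AEven (n : ℕ) (hn : 1 ≤ n) (i : (twistedAEven n hn).Node) :
    (twistedAEven n hn).pairing (twistedAEven n hn).delta i = 0 := by
  have h := sum_cartan_label_AEven n hn i i.2
  rw [← Fin.sum_univ_eq_sum_range (fun k : ℕ =>
    (if (i : ℕ) = k then 2 else -(twistedAEven n hn).offDiag i k) *
      ((twistedAEven n hn).label k : ℤ)) (n + 1)] at h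
  have h2 := congrArg (Int.cast : ℤ → ℚ) h
  rw [Int.cast_sum, Int.cast_zero] at h2
  refine Eq.trans ?_ h2
  refine Finset.sum_congr rfl fun k _ => ?_
  simp only [cartan, delta, Fin.ext_iff, Int.cast_mul, Int.cast_natCast]

theorem label_zero_ne (X : AffineType) : (X.label 0 : ℚ) ≠ 0 := by
  cases X <;> simp [label]
  split_ifs <;> simp

theorem label_zero_eq (X : AffineType) (h : X.isAEven = false) : X.label 0 = 1 := by
  cases X <;> simp_all [label, isAEven]

theorem thetaDiv_zero (X : AffineType) : X.thetaDiv 0 = 0 := by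
  simp [thetaDiv, theta, delta, simpleRoot]

theorem pairing_simpleRoot (X : AffineType) (i j : X.Node) :
    X.pairing (X.simpleRoot j) i = X.cartan i j := by
  simp [pairing, simpleRoot, Pi.single_apply]

theorem simpleRoot_zero_eq (X : AffineType) : X.simpleRoot 0 = X.deltaDiv - X.thetaDiv := by
  simp only [deltaDiv, thetaDiv, theta, smul_sub, smul_smul]
  rw [inv_mul_cancel₀ X.label_zero_ne]
  simp

theorem pairing_smul (X : AffineType) (c : ℚ) (a : X.Space) (i : X.Node) :
    X.pairing (c • a) i = c * X.pairing a i := by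
  simp only [pairing, Pi.smul_apply, smul_eq_mul, Finset.mul_sum]
  exact Finset.sum_congr rfl fun k _ => by ring

theorem thetaDiv_mem (X : AffineType) : X.thetaDiv ∈ X.finLattice := by
  by_cases h : X.isAEven = true
  · rw [finLattice, if_pos h]
    refine ⟨X.thetaDiv_zero, fun i _ => ⟨-X.cartan i 0, ?_⟩⟩
    have h1 : X.thetaDiv = X.deltaDiv + -X.simpleRoot 0 := by
      rw [simpleRoot_zero_eq]; abel
    have h2 : X.pairing X.delta i = 0 := by
      cases X with
      | twistedAEven n hn => exact pairing_delta_AEven n hn i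
      | _ => simp [isAEven] at h
    rw [h1, pairing_add, pairing_neg, pairing_simpleRoot, deltaDiv, pairing_smul, h2]
    simp
  · rw [finLattice, if_neg h]
    refine ⟨X.thetaDiv_zero, fun j => ?_⟩
    have h1 := X.label_zero_eq (by simpa using h)
    refine ⟨X.label j - if j = 0 then 1 else 0, ?_⟩
    simp [thetaDiv, theta, delta, simpleRoot, h1, Pi.single_apply]

theorem simpleRoot_mem (X : AffineType) (i : X.Node) : X.simpleRoot i ∈ X.fullLattice := by
  by_cases hi : i = 0
  · subst hi
    rw [simpleRoot_zero_eq]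
    exact sub_mem ((le_sup_right : _ ≤ X.fullLattice) (AddSubgroup.mem_zmultiples _))
      ((le_sup_left : _ ≤ X.fullLattice) X.thetaDiv_mem)
  · refine (le_sup_left : _ ≤ X.fullLattice) ?_
    have h0 : X.simpleRoot i 0 = 0 := by simp [simpleRoot, Ne.symm hi]
    unfold finLattice
    split_ifs
    · exact ⟨h0, fun j _ => ⟨X.cartan j i, X.pairing_simpleRoot j i⟩⟩
    · refine ⟨h0, fun j => ⟨if j = i then 1 else 0, ?_⟩⟩
      simp [simpleRoot, Pi.single_apply]

theorem deltaDiv_mem (X : AffineType) : X.deltaDiv ∈ X.fullLattice :=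
  (le_sup_right : _ ≤ X.fullLattice) (AddSubgroup.mem_zmultiples _)

theorem simpleRefl_mem (X : AffineType) (i : X.Node) (β : X.Space) (hβ : β ∈ X.fullLattice)
    (h : X.pairing β i = -1) : X.simpleRefl i β ∈ X.fullLattice := by
  have : X.simpleRefl i β = β + X.simpleRoot i := by simp [simpleRefl, h]
  rw [this]
  exact add_mem hβ (X.simpleRoot_mem i)

/-- The number `a_{ij} a_{ji}` of laces between two nodes. -/
def laces (X : AffineType) (i j : X.Node) : ℤ := X.cartan i j * X.cartan j i

/-- The order `m_{ij}` of `s_i s_j` for `i ≠ j`; the value `0` encodes `m_{ij} = ∞`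
(four laces). -/
def braidLength (X : AffineType) (i j : X.Node) : ℕ :=
  if X.laces i j = 0 then 2
  else if X.laces i j = 1 then 3
  else if X.laces i j = 2 then 4
  else if X.laces i j = 3 then 6
  else 0

end AffineType

/-- The alternating product `x y x ⋯` with `m` factors. -/
def altProd {M : Type*} [Monoid M] : ℕ → M → M → M
  | 0, _, _ => 1
  | m + 1, x, y => x * altProd m y x

/-- The group with generators `S` and the relations `u = v` for `R u v`. -/
abbrev GroupOf {S : Type} (R : FreeGroup S → FreeGroup S → Prop) : Type :=
  PresentedGroup {r : FreeGroup S | ∃ u v, R u v ∧ r = u * v⁻¹}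

namespace AffineType

/-- The generators of the triple group: `T j` belongs to the non-affine node `j.succ`. -/
inductive TripleGen (X : AffineType) : Type where
  | T (j : Fin X.rank)
  | T01
  | T02
  | T03

namespace TripleGen

/-- The node to which a generator belongs. -/
def node {X : AffineType} : X.TripleGen → X.Node
  | T j => j.succ
  | T01 => 0
  | T02 => 0
  | T03 => 0

end TripleGen

open TripleGen in
/-- The defining relations of the triple group. Here `α` (the node `α.succ`) is the chosen
neighbour of the affine node. -/
inductive TripleRel (X : AffineType) (α : Fin X.rank) :
    FreeGroup X.TripleGen → FreeGroup X.TripleGen → Prop where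
  /-- braid relations for generators that belong to distinct nodes -/
  | braid (g h : X.TripleGen) (hgh : g.node ≠ h.node) :
      TripleRel X α (altProd (X.braidLength g.node h.node) (FreeGroup.of g) (FreeGroup.of h))
        (altProd (X.braidLength g.node h.node) (FreeGroup.of h) (FreeGroup.of g))
  /-- a single lace between the affine node and `α` -/
  | single (hl : X.laces 0 α.succ = 1) (k : ℤ) (d x y : FreeGroup X.TripleGen)
      (hd : d = FreeGroup.of T01 * FreeGroup.of T02 * FreeGroup.of T03)
      (hx : x = d ^ k * FreeGroup.of (T α) * d ^ (-k))
      (hy : y = FreeGroup.of T01 ∨ y = FreeGroup.of T02 ∨ y = FreeGroup.of T03 ∨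
        y = FreeGroup.of T01 * FreeGroup.of T02 * (FreeGroup.of T01)⁻¹ ∨
        y = (FreeGroup.of T03)⁻¹ * FreeGroup.of T02 * FreeGroup.of T03) :
      TripleRel X α (y * x * y) (x * y * x)
  /-- double laces between the affine node and `α` -/
  | double (hl : X.laces 0 α.succ = 2) (g h : X.TripleGen)
      (hgh : (g = T01 ∧ h = T02) ∨ (g = T01 ∧ h = T03) ∨ (g = T02 ∧ h = T03)) :
      TripleRel X α
        (FreeGroup.of g * (FreeGroup.of (T α))⁻¹ * FreeGroup.of h * FreeGroup.of (T α))
        ((FreeGroup.of (T α))⁻¹ * FreeGroup.of h * FreeGroup.of (T α) * FreeGroup.of g)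

/-- The triple group. -/
abbrev TripleGroup (X : AffineType) (α : Fin X.rank) : Type := GroupOf (X.TripleRel α)

/-- A generator of the triple group. -/
def tripleGen (X : AffineType) (α : Fin X.rank) (g : X.TripleGen) : X.TripleGroup α :=
  PresentedGroup.of g

/-- `T_{s_θ} = T_{j_1} ⋯ T_{j_m}` in the triple group, for the reduced decomposition `w`. -/
def tripleTheta (X : AffineType) (α : Fin X.rank) (w : List (Fin X.rank)) : X.TripleGroup α :=
  (w.map fun j => X.tripleGen α (TripleGen.T j)).prod

/-- `C = T01 T02 T03 T_{s_θ}`. -/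
def tripleC (X : AffineType) (α : Fin X.rank) (w : List (Fin X.rank)) : X.TripleGroup α :=
  X.tripleGen α TripleGen.T01 * X.tripleGen α TripleGen.T02 * X.tripleGen α TripleGen.T03 *
    X.tripleTheta α w

/-- The quotient of the triple group by the relations that `C` is central. -/
abbrev TripleQuotient (X : AffineType) (α : Fin X.rank) (w : List (Fin X.rank)) : Type :=
  X.TripleGroup α ⧸
    Subgroup.normalClosure
      (Set.range fun g : X.TripleGroup α => X.tripleC α w * g * (X.tripleC α w)⁻¹ * g⁻¹)

/-- The quotient map. -/
def toQuotient (X : AffineType) (α : Fin X.rank) (w : List (Fin X.rank)) :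
    X.TripleGroup α →* X.TripleQuotient α w :=
  QuotientGroup.mk' _

/-- The generators of the double affine Artin group. -/
inductive DoubleGen (X : AffineType) : Type where
  | T (i : X.Node)
  | X (β : X.fullLattice)

/-- The defining relations of the double affine Artin group. -/
inductive DoubleRel (X : AffineType) :
    FreeGroup X.DoubleGen → FreeGroup X.DoubleGen → Prop where
  /-- the braid relations of the affine Artin group -/
  | braid (i j : X.Node) (hij : i ≠ j) :
      DoubleRel X
        (altProd (X.braidLength i j) (FreeGroup.of (DoubleGen.T i)) (FreeGroup.of (DoubleGen.T j)))
        (altProd (X.braidLength i j) (FreeGroup.of (DoubleGen.T j)) (FreeGroup.of (DoubleGen.T i)))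
  /-- the `X_β` form a lattice -/
  | add (β γ : X.fullLattice) :
      DoubleRel X (FreeGroup.of (DoubleGen.X (β + γ)))
        (FreeGroup.of (DoubleGen.X β) * FreeGroup.of (DoubleGen.X γ))
  /-- `X_{δ / a_0}` is central -/
  | central (g : X.DoubleGen) :
      DoubleRel X (FreeGroup.of (DoubleGen.X ⟨X.deltaDiv, X.deltaDiv_mem⟩) * FreeGroup.of g)
        (FreeGroup.of g * FreeGroup.of (DoubleGen.X ⟨X.deltaDiv, X.deltaDiv_mem⟩))
  /-- `T_i X_β = X_β T_i` if `(β, α_i^∨) = 0` -/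
  | commute (i : X.Node) (β : X.fullLattice) (h : X.pairing β i = 0) :
      DoubleRel X (FreeGroup.of (DoubleGen.T i) * FreeGroup.of (DoubleGen.X β))
        (FreeGroup.of (DoubleGen.X β) * FreeGroup.of (DoubleGen.T i))
  /-- `T_i X_β T_i = X_{s_i β}` if `(β, α_i^∨) = -1`. For `A₂ₙ⁽²⁾` and `i = n` the relation is not
  imposed: there `α_n / 2` lies in the lattice and takes the role of `α_n`, and
  `(β, (α_n / 2)^∨) = 2 (β, α_n^∨)` never equals `-1`. -/
  | reflect (i : X.Node) (hi : ¬(X.isAEven = true ∧ i = Fin.last X.rank))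
      (β : X.fullLattice) (h : X.pairing β i = -1) :
      DoubleRel X
        (FreeGroup.of (DoubleGen.T i) * FreeGroup.of (DoubleGen.X β) *
          FreeGroup.of (DoubleGen.T i))
        (FreeGroup.of (DoubleGen.X ⟨X.simpleRefl i β, X.simpleRefl_mem i β β.2 h⟩))

/-- The double affine Artin group. -/
abbrev DoubleArtin (X : AffineType) : Type := GroupOf X.DoubleRel

/-- The generator `T_i` of the double affine Artin group. -/
def dT (X : AffineType) (i : X.Node) : X.DoubleArtin := PresentedGroup.of (DoubleGen.T i)

/-- The element `X_β` of the double affine Artin group. -/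
def dX (X : AffineType) (β : X.Space) (hβ : β ∈ X.fullLattice) : X.DoubleArtin :=
  PresentedGroup.of (DoubleGen.X ⟨β, hβ⟩)

/-- `T_{s_θ}` in the double affine Artin group, for the reduced decomposition `w`. -/
def dTheta (X : AffineType) (w : List (Fin X.rank)) : X.DoubleArtin :=
  (w.map fun j => X.dT j.succ).prod

theorem thetaDiv_mem_full (X : AffineType) : X.thetaDiv ∈ X.fullLattice :=
  (le_sup_left : _ ≤ X.fullLattice) X.thetaDiv_mem

end AffineType

/-! The case list is replaced by one uniform object. Once `α_n` is replaced by `α_n / 2` in type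
`A₂ₙ⁽²⁾`, every matrix on the list has `α_0` of minimal length, coordinate `1` of `a_0⁻¹ δ` at the
affine node, and the full lattice `ℤ^(n+1)` as index set of the `X_β`. These features, together with
connectedness of the diagram by unit steps, are recorded in `AffineDatum`, and all arguments about
groups use nothing else.

Affine Artin groups are handled through canonical lifts. If elements `t_i` of a group satisfy the
affine braid relations, then a product along a length-increasing word depends only on the Weyl group
element `w` (`exchange`, which is Matsumoto's theorem). This defines `T_w`, which is multiplicative
whenever lengths add. Length is governed by the signs of the vectors `w α_i`: a vector with integral
coroot is positive or negative (`IsRoot.nonneg_or_nonpos`). The lifts of dominant translations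
commute, and their quotients form Bernstein's lattice `X_β`, with `X_δ = 1` and `X_θ = t_0 T_{s_θ}`
(`exists_bernstein`).

From the triple group to the double affine Artin group, the relations must be verified for the
proposed images. For a positive short root `β` of the finite system put `Z_β = X_β T_{s_β}⁻¹`.
Lowering `β` by a simple root conjugates `Z_β` by the corresponding `T_i`, so the braid relations of
the image `Z_θ` of `T03` follow by induction on the height (`Z_braid`). Those of `T_0⁻¹ X_{α_0}` are
a direct computation. The three images multiply to `X_δ T_{s_θ}⁻¹` with `X_δ` central, so
conjugation by powers of `D` is conjugation by powers of `T_{s_θ}`. This takes a neighbour of the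
affine node to a neighbour, up to conjugation by lifts fixing `θ` (`conj_zpow_T_sth`), which reduces
the infinite family (b) to ordinary braid relations. For (c), the only neighbour of the affine node
has coordinate `1` in `δ`, so `θ - α_i` is supported away from it.

In the other direction, `T03, T_1, …, T_n` satisfy the affine braid relations, so they carry
Bernstein elements with `X_δ = 1`. Multiplying `X_β` by `C ^ (β 0)` makes `X_δ` equal to the central
element `C` and forces `X_{α_0} = T01 T02`. The braid relations of `T01` and `T02`, with the
relation (c) between these two when the lace is double, then give all lattice relations at the
affine node for `T_0 = T01` (`LatRel.doubleLat`). The two composites are compared on generators, the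
lattice being exhausted from `δ` and `α_0` by unit steps. -/

/-- The numerical data of an irreducible affine Cartan matrix whose affine node is short. -/
structure AffineDatum (n : ℕ) where
  /-- the Cartan matrix, `a i j = (α_j, α_i^∨)` -/
  a : Fin (n + 1) → Fin (n + 1) → ℤ
  /-- half of the square lengths of the simple roots -/
  d : Fin (n + 1) → ℤ
  /-- the coordinates of the null root -/
  m : Fin (n + 1) → ℤ
  diag : ∀ i, a i i = 2
  off : ∀ i j, i ≠ j → a i j ≤ 0
  symm : ∀ i j, d i * a i j = d j * a j i
  null : ∀ i, ∑ k, a i k * m k = 0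
  d_zero : d 0 = 1
  d_pos : ∀ i, 1 ≤ d i
  d_le : ∀ i, d i ≤ 3
  m_zero : m 0 = 1
  m_pos : ∀ i, 1 ≤ m i
  lace : ∀ i j, i ≠ j → a i j * a j i ≤ 3 ∨ (a i j = -2 ∧ a j i = -2 ∧ (i = 0 ∨ j = 0))
  mode : (∀ j, j ≠ 0 → a 0 j = 0 ∨ a 0 j = -1) ∨ (∀ j, j ≠ 0 → a 0 j = 0 ∨ a 0 j = -2)
  -- Connectedness by steps from `i` to `j` with `a j i = -1`, for which `s_j α_i = α_i + α_j`. At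
  -- most one node `z` is missed, and its coordinate `1` in the null root allows `α_z` to be
  -- recovered from `δ`. The miss occurs for `Dₙ₊₁⁽²⁾`, `A₂ₙ⁽²⁾` (modified) and `A₁⁽¹⁾`.
  gen : ∀ S : Set (Fin (n + 1)), 0 ∈ S → (∀ i j, i ∈ S → a j i = -1 → j ∈ S) →
    (∀ j, j ∈ S) ∨ ∃ z, z ≠ 0 ∧ m z = 1 ∧ (∀ j, j ≠ z → j ∈ S) ∧
      ∀ j, j ≠ 0 → a 0 j = 0 ∨ a 0 j = -2

/-! ### The root lattice, its invariant form and its roots -/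

namespace AffineDatum

variable {n : ℕ} (D : AffineDatum n)

/-- The root lattice, in coordinates with respect to the simple roots. -/
abbrev Lat (n : ℕ) : Type := Fin (n + 1) → ℤ

/-- The simple root `α_i`. -/
def e (i : Fin (n + 1)) : Lat n := Pi.single i 1

/-- The pairing with the simple coroot `α_i^∨`. -/
def pr (i : Fin (n + 1)) : Lat n →ₗ[ℤ] ℤ := ∑ k, D.a i k • LinearMap.proj k

/-- The invariant form. -/
def B : Lat n →ₗ[ℤ] Lat n →ₗ[ℤ] ℤ :=
  ∑ i, D.d i • (LinearMap.proj i : Lat n →ₗ[ℤ] ℤ).smulRight (D.pr i)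

theorem pr_apply (i : Fin (n + 1)) (x : Lat n) : D.pr i x = ∑ k, D.a i k * x k := by
  simp [pr]

theorem B_apply (x y : Lat n) : D.B x y = ∑ i, D.d i * (x i * D.pr i y) := by
  simp [B]

theorem pr_e (i j : Fin (n + 1)) : D.pr i (e j) = D.a i j := by
  simp [pr_apply, e, Pi.single_apply]

theorem pr_m (i : Fin (n + 1)) : D.pr i D.m = 0 := by
  rw [pr_apply, D.null]

theorem B_symm (x y : Lat n) : D.B x y = D.B y x := by
  simp only [B_apply, pr_apply, Finset.mul_sum]
  rw [Finset.sum_comm]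
  refine Finset.sum_congr rfl fun j _ => Finset.sum_congr rfl fun i _ => ?_
  linear_combination (x i * y j) * D.symm i j

theorem B_e_left (i : Fin (n + 1)) (x : Lat n) : D.B (e i) x = D.d i * D.pr i x := by
  simp [B_apply, e, Pi.single_apply]

theorem B_e (i : Fin (n + 1)) (x : Lat n) : D.B x (e i) = D.d i * D.pr i x := by
  rw [B_symm, B_e_left]

theorem B_m (x : Lat n) : D.B x D.m = 0 := by
  simp [B_apply, pr_m]

theorem B_m_left (x : Lat n) : D.B D.m x = 0 := by
  rw [B_symm, B_m]

theorem B_sub_left (x y z : Lat n) : D.B (x - y) z = D.B x z - D.B y z := by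
  rw [map_sub, LinearMap.sub_apply]

theorem B_add_left (x y z : Lat n) : D.B (x + y) z = D.B x z + D.B y z := by
  rw [map_add, LinearMap.add_apply]

theorem B_smul_left (c : ℤ) (x y : Lat n) : D.B (c • x) y = c * D.B x y := by
  rw [map_smul, LinearMap.smul_apply, smul_eq_mul]

theorem B_smul (c : ℤ) (x y : Lat n) : D.B x (c • y) = c * D.B x y := by
  rw [map_smul, smul_eq_mul]

theorem B_sub (x y z : Lat n) : D.B x (y - z) = D.B x y - D.B x z := map_sub _ _ _

theorem B_add (x y z : Lat n) : D.B x (y + z) = D.B x y + D.B x z := map_add _ _ _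

theorem pr_sub (i : Fin (n + 1)) (x y : Lat n) : D.pr i (x - y) = D.pr i x - D.pr i y :=
  map_sub _ _ _

theorem pr_add (i : Fin (n + 1)) (x y : Lat n) : D.pr i (x + y) = D.pr i x + D.pr i y :=
  map_add _ _ _

theorem pr_smul (i : Fin (n + 1)) (c : ℤ) (x : Lat n) : D.pr i (c • x) = c * D.pr i x := by
  rw [map_smul, smul_eq_mul]

theorem d_ne (i : Fin (n + 1)) : D.d i ≠ 0 := by
  have := D.d_pos i
  omega

theorem m_ne (i : Fin (n + 1)) : D.m i ≠ 0 := by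
  have := D.m_pos i
  omega

theorem e_apply (i j : Fin (n + 1)) : (e i : Lat n) j = if j = i then 1 else 0 := by
  simp [e, Pi.single_apply]

theorem e_self (i : Fin (n + 1)) : (e i : Lat n) i = 1 := by simp [e]

theorem e_ne {i j : Fin (n + 1)} (h : j ≠ i) : (e i : Lat n) j = 0 := by simp [e, h]

theorem sum_e (x : Lat n) : x = ∑ i, x i • e i := by
  ext j
  simp [e, Finset.sum_apply, Pi.single_apply]

/-- The null vector `m` has positive coordinates, so in the variables `x_i / m_i` the form becomes a
combination of squares of differences; the pure square terms cancel because `∑ a_ij m_j = 0`. The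
coefficients are nonnegative, whence semidefiniteness and a description of the radical. -/
theorem two_B_self (x : Lat n) :
    2 * (D.B x x : ℚ) = ∑ i, ∑ j, -(D.d i * D.a i j * D.m i * D.m j : ℚ) *
      ((x i : ℚ) / D.m i - (x j : ℚ) / D.m j) ^ 2 := by
  have hm : ∀ i, (D.m i : ℚ) ≠ 0 := fun i => by exact_mod_cast D.m_ne i
  have h0 : ∀ i, ∑ j, (D.a i j : ℚ) * D.m j = 0 := fun i => by exact_mod_cast D.null i
  have hs : ∀ i j, (D.d i * D.a i j : ℚ) = D.d j * D.a j i := fun i j => by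
    exact_mod_cast D.symm i j
  have h1 : ∑ i, ∑ j, (D.d i * D.a i j * D.m i * D.m j : ℚ) * ((x i : ℚ) / D.m i) ^ 2 = 0 := by
    refine Finset.sum_eq_zero fun i _ => ?_
    have : ∀ j, (D.d i * D.a i j * D.m i * D.m j : ℚ) * ((x i : ℚ) / D.m i) ^ 2 =
      (D.d i * D.m i * ((x i : ℚ) / D.m i) ^ 2) * (D.a i j * D.m j) := fun j => by ring
    simp_rw [this, ← Finset.mul_sum, h0, mul_zero]
  have h2 : ∑ i, ∑ j, (D.d i * D.a i j * D.m i * D.m j : ℚ) * ((x j : ℚ) / D.m j) ^ 2 = 0 := by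
    rw [Finset.sum_comm, ← h1]
    refine Finset.sum_congr rfl fun i _ => Finset.sum_congr rfl fun j _ => ?_
    rw [hs j i]; ring
  have h3 : (D.B x x : ℚ) = ∑ i, ∑ j, (D.d i * D.a i j * D.m i * D.m j : ℚ) *
      (((x i : ℚ) / D.m i) * ((x j : ℚ) / D.m j)) := by
    rw [B_apply]
    push_cast [pr_apply, Finset.mul_sum]
    refine Finset.sum_congr rfl fun i _ => Finset.sum_congr rfl fun j _ => ?_
    have := hm i
    have := hm j
    field_simp
  have h4 : ∀ i j, -(D.d i * D.a i j * D.m i * D.m j : ℚ) *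
      ((x i : ℚ) / D.m i - (x j : ℚ) / D.m j) ^ 2 =
      2 * ((D.d i * D.a i j * D.m i * D.m j : ℚ) * (((x i : ℚ) / D.m i) * ((x j : ℚ) / D.m j)))
      - (D.d i * D.a i j * D.m i * D.m j : ℚ) * ((x i : ℚ) / D.m i) ^ 2
      - (D.d i * D.a i j * D.m i * D.m j : ℚ) * ((x j : ℚ) / D.m j) ^ 2 := fun i j => by ring
  simp_rw [h4, Finset.sum_sub_distrib, ← Finset.mul_sum]
  rw [h1, h2, h3]
  ring

theorem two_B_term_nonneg (x : Lat n) (i j : Fin (n + 1)) :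
    0 ≤ -(D.d i * D.a i j * D.m i * D.m j : ℚ) *
      ((x i : ℚ) / D.m i - (x j : ℚ) / D.m j) ^ 2 := by
  by_cases h : i = j
  · subst h; simp
  · refine mul_nonneg ?_ (sq_nonneg _)
    have h1 : (D.a i j : ℚ) ≤ 0 := by exact_mod_cast D.off i j h
    have h2 : (0 : ℚ) < D.d i := by exact_mod_cast D.d_pos i
    have h3 : (0 : ℚ) < D.m i := by exact_mod_cast D.m_pos i
    have h4 : (0 : ℚ) < D.m j := by exact_mod_cast D.m_pos j
    have : -(D.d i * D.a i j * D.m i * D.m j : ℚ) = D.d i * (-D.a i j) * D.m i * D.m j := by ring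
    rw [this]
    have : (0 : ℚ) ≤ -D.a i j := by linarith
    positivity

theorem B_nonneg (x : Lat n) : 0 ≤ D.B x x := by
  have h := D.two_B_self x
  have h2 : (0 : ℚ) ≤ 2 * (D.B x x : ℚ) := by
    rw [h]
    exact Finset.sum_nonneg fun i _ => Finset.sum_nonneg fun j _ => D.two_B_term_nonneg x i j
  have : (0 : ℚ) ≤ (D.B x x : ℚ) := by linarith
  exact_mod_cast this

/-- When the sum of squares vanishes, `x_i / m_i` is constant along edges, hence constant on the
nodes reached by `gen`. If a node `z` is missed, `x - x 0 • m` is a multiple of `α_z` of norm zero,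
hence zero. -/
theorem eq_smul_of_B_eq_zero (x : Lat n) (hx : D.B x x = 0) : x = x 0 • D.m := by
  have h := D.two_B_self x
  rw [hx, Int.cast_zero, mul_zero, eq_comm, Finset.sum_eq_zero_iff_of_nonneg
    (fun i _ => Finset.sum_nonneg fun j _ => D.two_B_term_nonneg x i j)] at h
  have h1 : ∀ i j, D.a i j ≠ 0 → x i * D.m j = x j * D.m i := by
    intro i j hij
    have h2 := (Finset.sum_eq_zero_iff_of_nonneg (fun j _ => D.two_B_term_nonneg x i j)).1
      (h i (Finset.mem_univ i)) j (Finset.mem_univ j)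
    have hi : (D.m i : ℚ) ≠ 0 := by exact_mod_cast D.m_ne i
    have hj : (D.m j : ℚ) ≠ 0 := by exact_mod_cast D.m_ne j
    have hd : (D.d i : ℚ) ≠ 0 := by exact_mod_cast D.d_ne i
    have ha : (D.a i j : ℚ) ≠ 0 := by exact_mod_cast hij
    rcases mul_eq_zero.1 h2 with h3 | h3
    · exact absurd h3 (neg_ne_zero.2 (by positivity))
    · have h4 := pow_eq_zero_iff (two_ne_zero) |>.1 h3
      field_simp at h4
      have h5 : (x i : ℚ) * D.m j = x j * D.m i := by linarith
      exact_mod_cast h5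
  have hgen := D.gen {j | x j = x 0 * D.m j} (by simp [D.m_zero]) (by
    intro i j hi hji
    have h2 := h1 j i (by omega)
    simp only [Set.mem_ofPred_eq] at hi ⊢
    have : x j * D.m i = x 0 * D.m j * D.m i := by rw [h2, hi]; ring
    exact mul_right_cancel₀ (D.m_ne i) this)
  rcases hgen with hg | ⟨z, -, -, hz, -⟩
  · ext j; simpa using hg j
  · set y := x - x 0 • D.m with hy
    have hyz : y = y z • e z := by
      ext j
      by_cases hj : j = z
      · subst hj; simp [e]
      · have := hz j hj
        simp only [Set.mem_ofPred_eq] at this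
        simp [hy, e, hj, this]
    have hB : D.B y y = 0 := by
      simp only [hy, B_sub_left, B_sub, B_smul, B_smul_left, hx, B_m, B_m_left]; ring
    rw [hyz] at hB
    simp only [map_smul, LinearMap.smul_apply, B_e_left, pr_e, D.diag, smul_eq_mul] at hB
    have : y z = 0 := by
      have := D.d_ne z
      by_contra h0
      have : D.d z * 2 ≠ 0 := by omega
      exact mul_ne_zero h0 (mul_ne_zero h0 this) hB
    rw [this, zero_smul] at hyz
    rw [hy, sub_eq_zero] at hyz
    exact hyz

theorem B_pos (x : Lat n) (hx : x ≠ 0) (i : Fin (n + 1)) (hi : x i = 0) : 0 < D.B x x := by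
  refine lt_of_le_of_ne (D.B_nonneg x) fun h => hx ?_
  have h1 := D.eq_smul_of_B_eq_zero x h.symm
  have h2 := congrFun h1 i
  simp only [hi, Pi.smul_apply, smul_eq_mul] at h2
  have : x 0 = 0 := (mul_eq_zero.1 h2.symm).resolve_right (D.m_ne i)
  rw [h1, this, zero_smul]

/-- A vector all of whose coroot coordinates `2 (α_j, α_j) x_j / (x, x)` are integers. -/
def IsRoot (x : Lat n) : Prop := 0 < D.B x x ∧ ∀ j, D.B x x ∣ 2 * (D.d j * x j)

/-- The form takes values in multiples of `2 N` on vectors with `N ∣ d_j x_j`. -/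
theorem dvd_B_self (N : ℤ) (x : Lat n) (h : ∀ j, N ∣ 2 * (D.d j * x j)) : N ∣ D.B x x := by
  have h1 : ∀ i j, N ∣ (2 * (D.d i * x i)) * (D.a i j * x j) := fun i j => (h i).mul_right _
  -- Adding a node to the support contributes a diagonal term `2 d_b x_b²` and twice the cross
  -- terms, by symmetry; both contain a factor `2 d_b x_b`.
  have key : ∀ s : Finset (Fin (n + 1)),
      N ∣ ∑ i ∈ s, ∑ j ∈ s, D.d i * (x i * (D.a i j * x j)) := by
    intro s
    induction s using Finset.induction_on with
    | empty => simp
    | insert b s hb ih =>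
      rw [Finset.sum_insert hb]
      simp_rw [Finset.sum_insert hb]
      rw [Finset.sum_add_distrib]
      have e1 : D.d b * (x b * (D.a b b * x b)) = 2 * (D.d b * x b) * x b := by
        rw [D.diag]; ring
      have e2 : ∑ i ∈ s, D.d i * (x i * (D.a i b * x b)) =
          ∑ j ∈ s, D.d b * (x b * (D.a b j * x j)) := by
        refine Finset.sum_congr rfl fun i _ => ?_
        linear_combination (x i * x b) * D.symm i b
      have e3 : N ∣ 2 * ∑ j ∈ s, D.d b * (x b * (D.a b j * x j)) := by
        rw [Finset.mul_sum]
        refine Finset.dvd_sum fun j _ => ?_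
        have := h1 b j
        exact this.trans (dvd_of_eq (by ring))
      rw [e1, e2]
      have e4 : N ∣ 2 * (D.d b * x b) * x b := (h b).mul_right _
      have := dvd_add (dvd_add e4 e3) ih
      exact this.trans (dvd_of_eq (by ring))
  have := key Finset.univ
  rw [B_apply]
  convert this using 1
  refine Finset.sum_congr rfl fun i _ => ?_
  rw [pr_apply, Finset.mul_sum, Finset.mul_sum]

theorem IsRoot.ne_zero {D : AffineDatum n} {x : Lat n} (hx : D.IsRoot x) : x ≠ 0 := by
  rintro rfl
  simpa using hx.1

/-- Split `x = p - q` into positive and negative parts. Both inherit the divisibility condition, so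
`B p p` and `B q q` are multiples of `B x x`. If neither part is zero, each vanishes at some node,
so both norms are positive; as `B p q ≤ 0`, this gives `B x x ≥ 2 B x x`, a contradiction. -/
theorem IsRoot.nonneg_or_nonpos {D : AffineDatum n} {x : Lat n} (hx : D.IsRoot x) :
    0 ≤ x ∨ x ≤ 0 := by
  by_contra hcon
  push Not at hcon
  obtain ⟨h1, h2⟩ := hcon
  set p : Lat n := fun j => max (x j) 0 with hp
  set q : Lat n := fun j => max (-x j) 0 with hq
  have hxpq : x = p - q := by
    ext j
    simp only [hp, hq, Pi.sub_apply]
    omega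
  obtain ⟨i, hi⟩ : ∃ i, x i < 0 := by
    by_contra h; push Not at h; exact h1 h
  obtain ⟨j, hj⟩ : ∃ i, 0 < x i := by
    by_contra h; push Not at h; exact h2 h
  have hp0 : 0 < D.B p p := by
    refine D.B_pos p (fun h => ?_) i (by simp only [hp]; omega)
    have := congrFun h j
    simp only [hp, Pi.zero_apply] at this
    omega
  have hq0 : 0 < D.B q q := by
    refine D.B_pos q (fun h => ?_) j (by simp only [hq]; omega)
    have := congrFun h i
    simp only [hq, Pi.zero_apply] at this
    omega
  have hdp : D.B x x ∣ D.B p p := D.dvd_B_self _ _ fun k => by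
    simp only [hp]
    rcases max_choice (x k) 0 with h | h <;> rw [h]
    · exact hx.2 k
    · simp
  have hdq : D.B x x ∣ D.B q q := D.dvd_B_self _ _ fun k => by
    simp only [hq]
    rcases max_choice (-x k) 0 with h | h <;> rw [h]
    · have := (dvd_neg (a := D.B x x)).2 (hx.2 k)
      exact this.trans (dvd_of_eq (by ring))
    · simp
  have hpq : D.B p q ≤ 0 := by
    rw [B_apply]
    refine Finset.sum_nonpos fun k _ => ?_
    rw [pr_apply, Finset.mul_sum, Finset.mul_sum]
    refine Finset.sum_nonpos fun l _ => ?_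
    have hd := D.d_pos k
    have hpk : 0 ≤ p k := le_max_right _ _
    have hql : 0 ≤ q l := le_max_right _ _
    by_cases hkl : k = l
    · subst hkl
      have : p k * q k = 0 := by
        simp only [hp, hq]
        rcases le_total (x k) 0 with h | h
        · rw [max_eq_right h, zero_mul]
        · rw [max_eq_right (by omega : -x k ≤ 0), mul_zero]
      rw [show D.d k * (p k * (D.a k k * q k)) = D.d k * D.a k k * (p k * q k) by ring, this,
        mul_zero]
    · have := D.off k l hkl
      have h3 : D.a k l * q l ≤ 0 := mul_nonpos_of_nonpos_of_nonneg this hql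
      have h4 : p k * (D.a k l * q l) ≤ 0 := mul_nonpos_of_nonneg_of_nonpos hpk h3
      exact mul_nonpos_of_nonneg_of_nonpos (by omega) h4
  have hexp : D.B x x = D.B p p + D.B q q - 2 * D.B p q := by
    conv_lhs => rw [hxpq]
    simp only [map_sub, LinearMap.sub_apply]
    rw [D.B_symm q p]; ring
  have h5 := Int.le_of_dvd hp0 hdp
  have h6 := Int.le_of_dvd hq0 hdq
  have h7 := hx.1
  omega

theorem isRoot_e (i : Fin (n + 1)) : D.IsRoot (e i) := by
  have hB : D.B (e i) (e i) = 2 * D.d i := by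
    rw [B_e, pr_e, D.diag]; ring
  have := D.d_pos i
  refine ⟨by omega, fun j => ?_⟩
  rw [hB]
  by_cases h : j = i
  · subst h; simp [e]
  · simp [e, h]

theorem IsRoot.neg {D : AffineDatum n} {x : Lat n} (hx : D.IsRoot x) : D.IsRoot (-x) := by
  have hB : D.B (-x) (-x) = D.B x x := by simp
  refine ⟨by rw [hB]; exact hx.1, fun j => ?_⟩
  rw [hB]
  have := (dvd_neg (a := D.B x x)).2 (hx.2 j)
  refine this.trans (dvd_of_eq ?_)
  simp only [Pi.neg_apply]; ring

/-- The simple reflection `s_i`. -/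
def s (i : Fin (n + 1)) : Lat n ≃ₗ[ℤ] Lat n :=
  Module.reflection (x := e i) (f := D.pr i) (by rw [pr_e, D.diag])

theorem s_apply (i : Fin (n + 1)) (x : Lat n) : D.s i x = x - D.pr i x • e i :=
  Module.reflection_apply _ _

theorem s_mul_s (i : Fin (n + 1)) : D.s i * D.s i = 1 := by
  ext1 x
  exact Module.involutive_reflection (x := e i) (f := D.pr i) (by rw [pr_e, D.diag]) x

theorem s_inv (i : Fin (n + 1)) : (D.s i)⁻¹ = D.s i := rfl

theorem s_s (i : Fin (n + 1)) (x : Lat n) : D.s i (D.s i x) = x := by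
  rw [← LinearEquiv.mul_apply, s_mul_s]; rfl

theorem s_e_self (i : Fin (n + 1)) : D.s i (e i) = -e i := by
  rw [s_apply, pr_e, D.diag, two_smul]; abel

theorem s_m (i : Fin (n + 1)) : D.s i D.m = D.m := by
  rw [s_apply, pr_m, zero_smul, sub_zero]

theorem B_s_s (i : Fin (n + 1)) (x y : Lat n) : D.B (D.s i x) (D.s i y) = D.B x y := by
  simp only [s_apply, B_sub_left, B_sub, B_smul, B_smul_left, B_e, B_e_left, pr_sub, pr_smul, pr_e,
    D.diag]
  ring

theorem s_apply_apply (i j : Fin (n + 1)) (x : Lat n) :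
    D.s i x j = x j - if j = i then D.pr i x else 0 := by
  rw [s_apply]
  simp only [Pi.sub_apply, Pi.smul_apply, e_apply, smul_eq_mul, mul_ite, mul_one, mul_zero]

theorem s_apply_ne {i j : Fin (n + 1)} (h : j ≠ i) (x : Lat n) : D.s i x j = x j := by
  rw [s_apply_apply, if_neg h, sub_zero]

theorem IsRoot.s {D : AffineDatum n} {x : Lat n} (hx : D.IsRoot x) (i : Fin (n + 1)) :
    D.IsRoot (D.s i x) := by
  refine ⟨by rw [B_s_s]; exact hx.1, fun j => ?_⟩
  rw [B_s_s, s_apply_apply]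
  split_ifs with h
  · subst h
    have h1 : D.B x x ∣ 2 * (D.d j * D.pr j x) := by
      rw [pr_apply, Finset.mul_sum, Finset.mul_sum]
      refine Finset.dvd_sum fun k _ => ?_
      have : 2 * (D.d j * (D.a j k * x k)) = 2 * (D.d k * x k) * D.a k j := by
        linear_combination 2 * x k * D.symm j k
      rw [this]
      exact (hx.2 k).mul_right _
    have := dvd_sub (hx.2 j) h1
    exact this.trans (dvd_of_eq (by ring))
  · simpa using hx.2 j

/-- The part of a root in the finite root lattice is a root. -/
theorem IsRoot.sub_m {D : AffineDatum n} {x : Lat n} (hx : D.IsRoot x) :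
    D.IsRoot (x - x 0 • D.m) := by
  have hB : D.B (x - x 0 • D.m) (x - x 0 • D.m) = D.B x x := by
    simp only [B_sub_left, B_sub, B_smul, B_smul_left, B_m, B_m_left]; ring
  refine ⟨by rw [hB]; exact hx.1, fun j => ?_⟩
  rw [hB]
  -- Shortness of `α_0` enters here: with `d 0 = 1` the norm divides `2 x_0` itself, so subtracting
  -- `x_0 δ` preserves integrality.
  have h0 := hx.2 0
  rw [D.d_zero, one_mul] at h0
  have := dvd_sub (hx.2 j) (h0.mul_right (D.d j * D.m j))
  refine this.trans (dvd_of_eq ?_)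
  simp only [Pi.sub_apply, Pi.smul_apply, smul_eq_mul]; ring

theorem IsRoot.eq_of_smul_e {D : AffineDatum n} {i : Fin (n + 1)} {c : ℤ}
    (hx : D.IsRoot (c • e i)) : c = 1 ∨ c = -1 := by
  have hB : D.B (c • e i) (c • e i) = 2 * D.d i * (c * c) := by
    simp only [B_smul, B_e, pr_smul, pr_e, D.diag]; ring
  have h1 := hx.2 i
  have h0 := hx.1
  rw [hB] at h1 h0
  simp only [Pi.smul_apply, e_self, smul_eq_mul, mul_one] at h1
  have hd := D.d_pos i
  have h2 : c * c ∣ c := by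
    have : (2 * D.d i) * (c * c) ∣ (2 * D.d i) * c := by
      rw [show (2 * D.d i) * c = 2 * (D.d i * c) by ring]; exact h1
    exact (mul_dvd_mul_iff_left (by omega)).1 this
  have hc : c ≠ 0 := by rintro rfl; simp at h0
  have h3 : c ∣ 1 := by
    have : c * c ∣ c * 1 := by simpa using h2
    exact (mul_dvd_mul_iff_left hc).1 this
  exact Int.isUnit_iff.1 (isUnit_of_dvd_one h3)

/-- A simple reflection permutes the positive roots other than the simple root. -/
theorem IsRoot.s_nonneg {D : AffineDatum n} {x : Lat n} (hx : D.IsRoot x) (h0 : 0 ≤ x)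
    {i : Fin (n + 1)} (hi : x ≠ e i) : 0 ≤ D.s i x := by
  rcases (hx.s i).nonneg_or_nonpos with h | h
  · exact h
  · exfalso
    -- A simple reflection changes one coordinate only, so every other coordinate is both
    -- nonnegative and nonpositive.
    have h1 : x = x i • e i := by
      ext j
      by_cases hj : j = i
      · subst hj; simp [e]
      · have h2 := h j
        rw [s_apply_ne D hj] at h2
        have h3 := h0 j
        simp only [Pi.zero_apply] at h2 h3
        simp [e, hj]; omega
    rw [h1] at hx
    rcases hx.eq_of_smul_e with h2 | h2
    · rw [h2, one_smul] at h1; exact hi h1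
    · have := h0 i
      simp only [Pi.zero_apply] at this
      omega

theorem IsRoot.not_both {D : AffineDatum n} {x : Lat n} (hx : D.IsRoot x) (h0 : 0 ≤ x)
    (h1 : x ≤ 0) : False := hx.ne_zero (le_antisymm h1 h0)

end AffineDatum

/-! ### The Weyl group and canonical lifts of its elements -/

namespace AffineDatum

variable {n : ℕ} (D : AffineDatum n)

/-- The group generated by the simple reflections with index in `I`. -/
def W (I : Set (Fin (n + 1))) : Subgroup (Lat n ≃ₗ[ℤ] Lat n) := Subgroup.closure (D.s '' I)

theorem s_mem_W {I : Set (Fin (n + 1))} {i : Fin (n + 1)} (hi : i ∈ I) : D.s i ∈ D.W I :=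
  Subgroup.subset_closure ⟨i, hi, rfl⟩

theorem W_mono {I J : Set (Fin (n + 1))} (h : I ⊆ J) : D.W I ≤ D.W J :=
  Subgroup.closure_mono (Set.image_mono h)

theorem W_induction {I : Set (Fin (n + 1))} {p : (Lat n ≃ₗ[ℤ] Lat n) → Prop} (one : p 1)
    (mul : ∀ w i, w ∈ D.W I → i ∈ I → p w → p (w * D.s i)) {w : Lat n ≃ₗ[ℤ] Lat n}
    (hw : w ∈ D.W I) : p w := by
  refine Subgroup.closure_induction_right (p := fun w _ => p w) one ?_ ?_ hw
  · rintro w hw _ ⟨i, hi, rfl⟩ h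
    exact mul w i hw hi h
  · rintro w hw _ ⟨i, hi, rfl⟩ h
    rw [s_inv]
    exact mul w i hw hi h

theorem W_induction_left {I : Set (Fin (n + 1))} {p : (Lat n ≃ₗ[ℤ] Lat n) → Prop} (one : p 1)
    (mul : ∀ w i, w ∈ D.W I → i ∈ I → p w → p (D.s i * w)) {w : Lat n ≃ₗ[ℤ] Lat n}
    (hw : w ∈ D.W I) : p w := by
  refine Subgroup.closure_induction_left (p := fun w _ => p w) one ?_ ?_ hw
  · rintro _ ⟨i, hi, rfl⟩ w hw h
    exact mul w i hw hi h
  · rintro _ ⟨i, hi, rfl⟩ w hw h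
    rw [s_inv]
    exact mul w i hw hi h

theorem B_W {I : Set (Fin (n + 1))} {w : Lat n ≃ₗ[ℤ] Lat n} (hw : w ∈ D.W I) (x y : Lat n) :
    D.B (w x) (w y) = D.B x y := by
  refine D.W_induction_left (p := fun w => D.B (w x) (w y) = D.B x y) rfl ?_ hw
  intro w i _ _ h
  rw [LinearEquiv.mul_apply, LinearEquiv.mul_apply, B_s_s, h]

theorem W_m {I : Set (Fin (n + 1))} {w : Lat n ≃ₗ[ℤ] Lat n} (hw : w ∈ D.W I) : w D.m = D.m := by
  refine D.W_induction_left (p := fun w => w D.m = D.m) rfl ?_ hw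
  intro w i _ _ h
  rw [LinearEquiv.mul_apply, h, s_m]

theorem IsRoot.W {D : AffineDatum n} {I : Set (Fin (n + 1))} {w : Lat n ≃ₗ[ℤ] Lat n}
    (hw : w ∈ D.W I) {x : Lat n} (hx : D.IsRoot x) : D.IsRoot (w x) := by
  refine D.W_induction_left (p := fun w => D.IsRoot (w x)) hx ?_ hw
  intro w i _ _ h
  exact h.s i

theorem mul_s_e (w : Lat n ≃ₗ[ℤ] Lat n) (i j : Fin (n + 1)) :
    (w * D.s j) (e i) = w (e i) - D.a j i • w (e j) := by
  rw [LinearEquiv.mul_apply, s_apply, pr_e, map_sub, map_smul]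

theorem mul_s_e_self (w : Lat n ≃ₗ[ℤ] Lat n) (i : Fin (n + 1)) :
    (w * D.s i) (e i) = -w (e i) := by
  rw [LinearEquiv.mul_apply, s_e_self, map_neg]

/-- The length of the braid relation between two distinct nodes, `0` if there is none. -/
def len (i j : Fin (n + 1)) : ℕ :=
  if D.a i j * D.a j i = 0 then 2
  else if D.a i j * D.a j i = 1 then 3
  else if D.a i j * D.a j i = 2 then 4
  else if D.a i j * D.a j i = 3 then 6
  else 0

theorem a_eq_zero_iff (i j : Fin (n + 1)) : D.a i j = 0 ↔ D.a j i = 0 := by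
  have h := D.symm i j
  constructor
  · intro h0
    rw [h0, mul_zero, eq_comm] at h
    exact (mul_eq_zero.1 h).resolve_left (D.d_ne j)
  · intro h0
    rw [h0, mul_zero] at h
    exact (mul_eq_zero.1 h).resolve_left (D.d_ne i)

theorem a_cases (i j : Fin (n + 1)) (hij : i ≠ j) :
    (D.a i j = 0 ∧ D.a j i = 0) ∨ (D.a i j = -1 ∧ D.a j i = -1) ∨
    (D.a i j = -1 ∧ D.a j i = -2) ∨ (D.a i j = -2 ∧ D.a j i = -1) ∨
    (D.a i j = -1 ∧ D.a j i = -3) ∨ (D.a i j = -3 ∧ D.a j i = -1) ∨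
    (D.a i j = -2 ∧ D.a j i = -2) := by
  rcases D.lace i j hij with h | h
  · have h1 := D.off i j hij
    have h2 := D.off j i hij.symm
    have h3 := D.a_eq_zero_iff i j
    generalize D.a i j = p at *
    generalize D.a j i = q at *
    by_cases hp : p = 0
    · left; exact ⟨hp, h3.1 hp⟩
    · have hq : q ≠ 0 := fun h => hp (h3.2 h)
      have hp3 : -3 ≤ p := by nlinarith [show q ≤ -1 by omega, show p ≤ -1 by omega]
      have hq3 : -3 ≤ q := by nlinarith [show q ≤ -1 by omega, show p ≤ -1 by omega]
      have hp' : p = -1 ∨ p = -2 ∨ p = -3 := by omega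
      have hq' : q = -1 ∨ q = -2 ∨ q = -3 := by omega
      rcases hp' with rfl | rfl | rfl <;> rcases hq' with rfl | rfl | rfl <;> simp_all
  · simp [h.1, h.2]

/-- The pairs `(w, T_w)`, built along words that increase the length. -/
inductive Lift {G : Type*} [Group G] (t : Fin (n + 1) → G) : ℕ → (Lat n ≃ₗ[ℤ] Lat n) → G → Prop
  | one : Lift t 0 1 1
  | step (k w g i) : Lift t k w g → 0 ≤ w (e i) → Lift t (k + 1) (w * D.s i) (g * t i)

/-- Every step of the word `L`, multiplied to `w` from the right, decreases the length. -/
def NegChain : (Lat n ≃ₗ[ℤ] Lat n) → List (Fin (n + 1)) → Prop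
  | _, [] => True
  | w, l :: L => w (e l) ≤ 0 ∧ NegChain (w * D.s l) L

section

variable {G : Type*} [Group G] (t : Fin (n + 1) → G)

theorem Lift.mem_W {D : AffineDatum n} {t : Fin (n + 1) → G} {k w g} (h : D.Lift t k w g) :
    w ∈ D.W Set.univ := by
  induction h with
  | one => exact one_mem _
  | step k w g i _ _ ih => exact mul_mem ih (D.s_mem_W (Set.mem_univ i))

/-- The exchange property for lifts of length `k`. -/
def Exch (k : ℕ) : Prop := ∀ w g i, D.Lift t k w g → w (e i) ≤ 0 →
  ∃ k' g', k = k' + 1 ∧ D.Lift t k' (w * D.s i) g' ∧ g = g' * t i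

theorem Lift.down {D : AffineDatum n} {t : Fin (n + 1) → G} (L : List (Fin (n + 1))) :
    ∀ {K w g}, (∀ k ≤ K, D.Exch t k) → D.Lift t K w g → D.NegChain w L →
    ∃ K' g', K = K' + L.length ∧ D.Lift t K' (w * (L.map D.s).prod) g' ∧
      g = g' * (L.reverse.map t).prod := by
  induction L with
  | nil => intro K w g _ h _; exact ⟨K, g, rfl, by simpa using h, by simp⟩
  | cons l L ih =>
    intro K w g hE h hn
    obtain ⟨k', g', hk, h', hg⟩ := hE K le_rfl w g l h hn.1
    obtain ⟨K', g'', hK, h'', hg'⟩ := ih (fun k hkk => hE k (by omega)) h' hn.2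
    refine ⟨K', g'', by simp; omega, by simpa [mul_assoc] using h'', ?_⟩
    rw [hg, hg']
    simp [mul_assoc]

theorem Lift.up {D : AffineDatum n} {t : Fin (n + 1) → G} (L : List (Fin (n + 1))) :
    ∀ {K w g}, D.Lift t K (w * (L.map D.s).prod) g → D.NegChain w L →
    D.Lift t (K + L.length) w (g * (L.reverse.map t).prod) := by
  induction L with
  | nil => intro K w g h _; simpa using h
  | cons l L ih =>
    intro K w g h hn
    have h1 := ih (w := w * D.s l) (by simpa [mul_assoc] using h) hn.2
    have h2 := Lift.step _ _ _ l h1 (by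
      rw [mul_s_e_self]
      intro k
      have := hn.1 k
      simp only [Pi.neg_apply, Pi.zero_apply] at this ⊢
      omega)
    rw [mul_assoc, s_mul_s, mul_one] at h2
    simpa [mul_assoc, add_assoc] using h2

/-- The two sides of a braid relation give two ways down from `u s_j` to the same element. A lift of
`u` is followed down along `L₁` to that element and up again along `L₂` to `u s_j s_i`; the relation
`ht` identifies the two products of generators. -/
theorem Lift.exchange_aux {D : AffineDatum n} {t : Fin (n + 1) → G} {k : ℕ}
    (hE : ∀ k' ≤ k, D.Exch t k') {u h i j} (hu : D.Lift t k u h) (L₁ L₂ : List (Fin (n + 1)))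
    (hlen : L₁.length = L₂.length) (hn₁ : D.NegChain (u * D.s j) (j :: L₁))
    (hn₂ : D.NegChain (u * D.s j) (i :: L₂))
    (hs : ((j :: L₁).map D.s).prod = ((i :: L₂).map D.s).prod)
    (ht : ((j :: L₁).reverse.map t).prod = ((i :: L₂).reverse.map t).prod) :
    ∃ k' g', k + 1 = k' + 1 ∧ D.Lift t k' (u * D.s j * D.s i) g' ∧ h * t j = g' * t i := by
  have e1 : u * D.s j * D.s j = u := by rw [mul_assoc, s_mul_s, mul_one]
  have hn₁' := hn₁.2
  rw [e1] at hn₁'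
  obtain ⟨K', g', hK, h', hg⟩ := Lift.down L₁ hE hu hn₁'
  have e2 : u * (L₁.map D.s).prod = u * D.s j * D.s i * (L₂.map D.s).prod := by
    simp only [List.map_cons, List.prod_cons] at hs
    rw [mul_assoc (u * D.s j), ← hs, ← mul_assoc, e1]
  rw [e2] at h'
  refine ⟨k, g' * (L₂.reverse.map t).prod, rfl, ?_, ?_⟩
  · rw [hK, hlen]
    exact Lift.up L₂ h' hn₂.2
  · rw [hg]
    simp only [List.reverse_cons, List.map_append, List.prod_append, List.map_cons, List.map_nil,
      List.prod_cons, List.prod_nil, mul_one] at ht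
    rw [mul_assoc, ht, mul_assoc]

/-- The alternating list `i, j, i, …`. -/
def altList : ℕ → Fin (n + 1) → Fin (n + 1) → List (Fin (n + 1))
  | 0, _, _ => []
  | k + 1, i, j => i :: altList k j i

theorem altList_length (k : ℕ) : ∀ i j : Fin (n + 1), (altList k i j).length = k := by
  induction k with
  | zero => intro i j; rfl
  | succ k ih => intro i j; simp [altList, ih]

theorem negChain_altList (k : ℕ) : ∀ (w : Lat n ≃ₗ[ℤ] Lat n) (i j : Fin (n + 1)),
    D.a i j = -2 → D.a j i = -2 → w (e i) ≤ 0 → w (e i) + w (e j) ≤ 0 →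
    D.NegChain w (altList k i j) := by
  induction k with
  | zero => intros; trivial
  | succ k ih =>
    intro w i j hij hji h1 h2
    refine ⟨h1, ih _ j i hji hij ?_ ?_⟩
    · rw [mul_s_e, hij]
      have := add_nonpos h2 h1
      refine le_trans (le_of_eq ?_) this
      module
    · rw [mul_s_e, hij, mul_s_e_self]
      refine le_trans (le_of_eq ?_) h2
      module

/-- The affine braid relations. -/
def Braids : Prop :=
  ∀ i j, i ≠ j → altProd (D.len i j) (t i) (t j) = altProd (D.len i j) (t j) (t i)

-- Let `w = u s_j` with `j` its last letter, and suppose that `i ≠ j` is also a descent. Then `w`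
-- makes both `α_i` and `α_j` negative, hence all their nonnegative combinations, so both
-- alternating words of length `m_ij` keep descending from `w`. By induction on the length,
-- `Lift.exchange_aux` exchanges the two endings. The cases are the possible pairs of Cartan
-- integers.
set_option maxHeartbeats 1000000 in
theorem exchange (hbr : D.Braids t) (k : ℕ) : D.Exch t k := by
  induction k using Nat.strong_induction_on with
  | _ k ih =>
  intro w g i hl hi
  cases hl with
  | one =>
    exfalso
    have := hi i
    simp [e] at this
  | step k u h j hu hj =>
    have hE : ∀ k' ≤ k, D.Exch t k' := fun k' hk' => ih k' (by omega)
    by_cases hij : i = j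
    · subst hij
      exact ⟨k, h, rfl, by rwa [mul_assoc, s_mul_s, mul_one], rfl⟩
    have hj' : (u * D.s j) (e j) ≤ 0 := by
      rw [mul_s_e_self]; exact neg_nonpos.2 hj
    have hb := hbr j i (Ne.symm hij)
    have hcases := D.a_cases i j hij
    generalize hw : u * D.s j = w at *
    simp only [len] at hb
    rcases hcases with ⟨h1, h2⟩ | ⟨h1, h2⟩ | ⟨h1, h2⟩ | ⟨h1, h2⟩ | ⟨h1, h2⟩ | ⟨h1, h2⟩ | ⟨h1, h2⟩
    all_goals simp [h1, h2, altProd] at hb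
    all_goals subst hw
    · refine Lift.exchange_aux hE hu [i] [j] rfl ?_ ?_ ?_
        (by simpa using hb.symm)
      · simp only [NegChain, mul_s_e, h2, D.diag] at hi hj' ⊢
        refine ⟨hj', ?_, trivial⟩
        all_goals
          intro k
          have h3 := hi k
          have h4 := hj' k
          simp only [Pi.sub_apply, Pi.smul_apply, Pi.zero_apply, smul_eq_mul] at h3 h4 ⊢
          omega
      · simp only [NegChain, mul_s_e, h1, h2, D.diag] at hi hj' ⊢
        refine ⟨hi, ?_, trivial⟩
        all_goals
          intro k
          have h3 := hi k
          have h4 := hj' k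
          simp only [Pi.sub_apply, Pi.smul_apply, Pi.zero_apply, smul_eq_mul] at h3 h4 ⊢
          omega
      · ext1 x
        simp only [List.map_cons, List.map_nil, List.prod_cons, List.prod_nil, mul_one,
          LinearEquiv.mul_apply, s_apply, pr_sub, pr_smul, pr_e, h1, h2]
        module
    · refine Lift.exchange_aux hE hu [i, j] [j, i] rfl ?_ ?_ ?_
        (by simpa [mul_assoc] using hb)
      · simp only [NegChain, mul_s_e, h1, h2, D.diag] at hi hj' ⊢
        refine ⟨hj', ?_, ?_, trivial⟩
        all_goals
          intro k
          have h3 := hi k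
          have h4 := hj' k
          simp only [Pi.sub_apply, Pi.smul_apply, Pi.zero_apply, smul_eq_mul] at h3 h4 ⊢
          omega
      · simp only [NegChain, mul_s_e, h1, h2, D.diag] at hi hj' ⊢
        refine ⟨hi, ?_, ?_, trivial⟩
        all_goals
          intro k
          have h3 := hi k
          have h4 := hj' k
          simp only [Pi.sub_apply, Pi.smul_apply, Pi.zero_apply, smul_eq_mul] at h3 h4 ⊢
          omega
      · ext1 x
        simp only [List.map_cons, List.map_nil, List.prod_cons, List.prod_nil, mul_one,
          LinearEquiv.mul_apply, s_apply, pr_sub, pr_smul, pr_e, D.diag, h1, h2]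
        module
    · refine Lift.exchange_aux hE hu [i, j, i] [j, i, j] rfl ?_ ?_ ?_
        (by simpa [mul_assoc] using hb.symm)
      · simp only [NegChain, mul_s_e, h1, h2, D.diag] at hi hj' ⊢
        refine ⟨hj', ?_, ?_, ?_, trivial⟩
        all_goals
          intro k
          have h3 := hi k
          have h4 := hj' k
          simp only [Pi.sub_apply, Pi.smul_apply, Pi.zero_apply, smul_eq_mul] at h3 h4 ⊢
          omega
      · simp only [NegChain, mul_s_e, h1, h2, D.diag] at hi hj' ⊢
        refine ⟨hi, ?_, ?_, ?_, trivial⟩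
        all_goals
          intro k
          have h3 := hi k
          have h4 := hj' k
          simp only [Pi.sub_apply, Pi.smul_apply, Pi.zero_apply, smul_eq_mul] at h3 h4 ⊢
          omega
      · ext1 x
        simp only [List.map_cons, List.map_nil, List.prod_cons, List.prod_nil, mul_one,
          LinearEquiv.mul_apply, s_apply, pr_sub, pr_smul, pr_e, D.diag, h1, h2]
        module
    · refine Lift.exchange_aux hE hu [i, j, i] [j, i, j] rfl ?_ ?_ ?_
        (by simpa [mul_assoc] using hb.symm)
      · simp only [NegChain, mul_s_e, h1, h2, D.diag] at hi hj' ⊢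
        refine ⟨hj', ?_, ?_, ?_, trivial⟩
        all_goals
          intro k
          have h3 := hi k
          have h4 := hj' k
          simp only [Pi.sub_apply, Pi.smul_apply, Pi.zero_apply, smul_eq_mul] at h3 h4 ⊢
          omega
      · simp only [NegChain, mul_s_e, h1, h2, D.diag] at hi hj' ⊢
        refine ⟨hi, ?_, ?_, ?_, trivial⟩
        all_goals
          intro k
          have h3 := hi k
          have h4 := hj' k
          simp only [Pi.sub_apply, Pi.smul_apply, Pi.zero_apply, smul_eq_mul] at h3 h4 ⊢
          omega
      · ext1 x
        simp only [List.map_cons, List.map_nil, List.prod_cons, List.prod_nil, mul_one,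
          LinearEquiv.mul_apply, s_apply, pr_sub, pr_smul, pr_e, D.diag, h1, h2]
        module
    · refine Lift.exchange_aux hE hu [i, j, i, j, i] [j, i, j, i, j] rfl ?_ ?_ ?_
        (by simpa [mul_assoc] using hb.symm)
      · simp only [NegChain, mul_s_e, h1, h2, D.diag] at hi hj' ⊢
        refine ⟨hj', ?_, ?_, ?_, ?_, ?_, trivial⟩
        all_goals
          intro k
          have h3 := hi k
          have h4 := hj' k
          simp only [Pi.sub_apply, Pi.smul_apply, Pi.zero_apply, smul_eq_mul] at h3 h4 ⊢
          omega
      · simp only [NegChain, mul_s_e, h1, h2, D.diag] at hi hj' ⊢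
        refine ⟨hi, ?_, ?_, ?_, ?_, ?_, trivial⟩
        all_goals
          intro k
          have h3 := hi k
          have h4 := hj' k
          simp only [Pi.sub_apply, Pi.smul_apply, Pi.zero_apply, smul_eq_mul] at h3 h4 ⊢
          omega
      · ext1 x
        simp only [List.map_cons, List.map_nil, List.prod_cons, List.prod_nil, mul_one,
          LinearEquiv.mul_apply, s_apply, pr_sub, pr_smul, pr_e, D.diag, h1, h2]
        module
    · refine Lift.exchange_aux hE hu [i, j, i, j, i] [j, i, j, i, j] rfl ?_ ?_ ?_
        (by simpa [mul_assoc] using hb.symm)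
      · simp only [NegChain, mul_s_e, h1, h2, D.diag] at hi hj' ⊢
        refine ⟨hj', ?_, ?_, ?_, ?_, ?_, trivial⟩
        all_goals
          intro k
          have h3 := hi k
          have h4 := hj' k
          simp only [Pi.sub_apply, Pi.smul_apply, Pi.zero_apply, smul_eq_mul] at h3 h4 ⊢
          omega
      · simp only [NegChain, mul_s_e, h1, h2, D.diag] at hi hj' ⊢
        refine ⟨hi, ?_, ?_, ?_, ?_, ?_, trivial⟩
        all_goals
          intro k
          have h3 := hi k
          have h4 := hj' k
          simp only [Pi.sub_apply, Pi.smul_apply, Pi.zero_apply, smul_eq_mul] at h3 h4 ⊢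
          omega
      · ext1 x
        simp only [List.map_cons, List.map_nil, List.prod_cons, List.prod_nil, mul_one,
          LinearEquiv.mul_apply, s_apply, pr_sub, pr_smul, pr_e, D.diag, h1, h2]
        module
    -- With four laces alternating words descend for ever, whereas the lift of `u` has length `k`
    -- and admits at most `k` descents; `k + 1` are produced.
    · exfalso
      have hn : D.NegChain u (altList (k + 1) i j) := by
        have h3 : D.NegChain (u * D.s j) (altList (k + 2) j i) :=
          D.negChain_altList _ _ _ _ h2 h1 hj' (add_nonpos hj' hi)
        have h4 := h3.2
        rwa [mul_assoc, s_mul_s, mul_one] at h4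
      obtain ⟨K', _, hK, -⟩ := Lift.down _ hE hu hn
      rw [altList_length] at hK
      omega

theorem pos_or_neg {w : Lat n ≃ₗ[ℤ] Lat n} {I} (hw : w ∈ D.W I) (i : Fin (n + 1)) :
    0 ≤ w (e i) ∨ w (e i) ≤ 0 := (IsRoot.W hw (D.isRoot_e i)).nonneg_or_nonpos

theorem exists_lift (hbr : D.Braids t) {w : Lat n ≃ₗ[ℤ] Lat n} (hw : w ∈ D.W Set.univ) :
    ∃ g k, D.Lift t k w g := by
  refine D.W_induction (p := fun w => ∃ g k, D.Lift t k w g) ⟨1, 0, .one⟩ ?_ hw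
  rintro w i hw - ⟨g, k, h⟩
  rcases D.pos_or_neg hw i with h1 | h1
  · exact ⟨_, _, h.step k w g i h1⟩
  · obtain ⟨k', g', -, h', -⟩ := D.exchange t hbr k w g i h h1
    exact ⟨_, _, h'⟩

/-- A second lift of the same element has the last letter of the first as a descent, and the
exchange property lets it end in that letter too. -/
theorem Lift.unique {D : AffineDatum n} {t : Fin (n + 1) → G} (hbr : D.Braids t) {k w g}
    (h : D.Lift t k w g) : ∀ {k' g'}, D.Lift t k' w g' → g' = g := by
  induction h with
  | one =>
    intro k' g' h'
    generalize hw : (1 : Lat n ≃ₗ[ℤ] Lat n) = w at h'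
    cases h' with
    | one => rfl
    | step k u g i h hi =>
      exfalso
      have h1 : (u * D.s i) (e i) = e i := by rw [← hw]; rfl
      rw [mul_s_e_self] at h1
      have := hi i
      have h2 := congrFun h1 i
      rw [e_self] at h2
      simp only [Pi.neg_apply, Pi.zero_apply] at *
      omega
  | step k u g i h hi ih =>
    intro k' g' h'
    obtain ⟨k'', g'', -, h'', rfl⟩ := D.exchange t hbr k' _ _ i h' (by
      rw [mul_s_e_self]; exact neg_nonpos.2 hi)
    rw [mul_assoc, s_mul_s, mul_one] at h''
    rw [ih h'']

open Classical in
/-- The canonical lift `T_w` of an element `w` of the Weyl group. -/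
noncomputable def T (w : Lat n ≃ₗ[ℤ] Lat n) : G :=
  if h : ∃ g k, D.Lift t k w g then h.choose else 1

variable {t}

theorem T_eq (hbr : D.Braids t) {k w g} (h : D.Lift t k w g) : D.T t w = g := by
  have h1 : ∃ g k, D.Lift t k w g := ⟨g, k, h⟩
  rw [T, dif_pos h1]
  obtain ⟨k', h2⟩ := h1.choose_spec
  exact h.unique hbr h2

theorem lift_T (hbr : D.Braids t) {w} (hw : w ∈ D.W Set.univ) : ∃ k, D.Lift t k w (D.T t w) := by
  obtain ⟨g, k, h⟩ := D.exists_lift t hbr hw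
  exact ⟨k, by rwa [D.T_eq hbr h]⟩

theorem T_one (hbr : D.Braids t) : D.T t 1 = 1 := D.T_eq hbr .one

theorem T_mul_s (hbr : D.Braids t) {w} (hw : w ∈ D.W Set.univ) {i : Fin (n + 1)}
    (hi : 0 ≤ w (e i)) : D.T t (w * D.s i) = D.T t w * t i := by
  obtain ⟨k, h⟩ := D.lift_T hbr hw
  exact D.T_eq hbr (h.step _ _ _ i hi)

theorem T_s (hbr : D.Braids t) (i : Fin (n + 1)) : D.T t (D.s i) = t i := by
  have h := D.T_mul_s hbr (one_mem _) (i := i) (w := 1) (by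
    intro j; change 0 ≤ (e i : Lat n) j; rw [e_apply]; split_ifs <;> simp)
  rwa [one_mul, T_one D hbr, one_mul] at h

theorem T_mul_s_neg (hbr : D.Braids t) {w} (hw : w ∈ D.W Set.univ) {i : Fin (n + 1)}
    (hi : w (e i) ≤ 0) : D.T t (w * D.s i) = D.T t w * (t i)⁻¹ := by
  have h := D.T_mul_s hbr (mul_mem hw (D.s_mem_W (Set.mem_univ i))) (i := i) (by
    rw [mul_s_e_self]; exact neg_nonneg.2 hi)
  rw [mul_assoc, s_mul_s, mul_one] at h
  rw [h, mul_inv_cancel_right]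

theorem e_nonneg (i : Fin (n + 1)) : 0 ≤ (e i : Lat n) := by
  intro j
  rw [e_apply]
  simp only [Pi.zero_apply]
  split_ifs <;> simp

/-- Lifts multiply if no positive root made negative by `v` becomes positive again. -/
theorem T_mul (hbr : D.Braids t) {u v} (hu : u ∈ D.W Set.univ) (hv : v ∈ D.W Set.univ)
    (h : ∀ x, D.IsRoot x → 0 ≤ x → v x ≤ 0 → u (v x) ≤ 0) :
    D.T t (u * v) = D.T t u * D.T t v := by
  obtain ⟨k, hl⟩ := D.lift_T hbr hv
  generalize D.T t v = g at *
  induction hl with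
  | one => rw [mul_one, mul_one]
  | step k v g i hl hi ih =>
    have hvW : v ∈ D.W Set.univ := hl.mem_W
    have h1 : 0 ≤ (u * v) (e i) := by
      have := h (e i) (D.isRoot_e i) (e_nonneg i) (by
        rw [mul_s_e_self]; exact neg_nonpos.2 hi)
      rw [mul_s_e_self, map_neg] at this
      exact neg_nonpos.1 this
    rw [← mul_assoc, D.T_mul_s hbr (mul_mem hu hvW) h1, ih hvW, mul_assoc]
    intro x hx hx0 hvx
    have hne : x ≠ e i := by
      rintro rfl
      exact (IsRoot.W hvW (D.isRoot_e i)).not_both hi hvx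
    -- Applying `s_i` turns positive roots made negative by `v` into positive roots made negative by
    -- `v s_i`; the exception `α_i` is not made negative by `v`.
    have := h (D.s i x) (hx.s i) (hx.s_nonneg hx0 hne) (by
      rw [LinearEquiv.mul_apply, s_s]; exact hvx)
    rwa [LinearEquiv.mul_apply, s_s] at this

theorem T_s_mul (hbr : D.Braids t) {w} (hw : w ∈ D.W Set.univ) {i : Fin (n + 1)}
    (hi : 0 ≤ w⁻¹ (e i)) : D.T t (D.s i * w) = t i * D.T t w := by
  rw [D.T_mul hbr (D.s_mem_W (Set.mem_univ i)) hw, T_s D hbr]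
  intro x hx hx0 hwx
  have h1 : D.IsRoot (-(w x)) := (IsRoot.W hw hx).neg
  by_cases h2 : -(w x) = e i
  · exfalso
    rw [← h2, map_neg, ← LinearEquiv.mul_apply, inv_mul_cancel] at hi
    exact hx.not_both hx0 (neg_nonneg.1 hi)
  · have := h1.s_nonneg (neg_nonneg.2 hwx) h2
    rw [map_neg] at this
    exact neg_nonneg.1 this

theorem T_mem_closure (hbr : D.Braids t) {I} {w} (hw : w ∈ D.W I) :
    D.T t w ∈ Subgroup.closure (t '' I) := by
  refine D.W_induction (p := fun w => D.T t w ∈ Subgroup.closure (t '' I)) ?_ ?_ hw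
  · rw [T_one D hbr]; exact one_mem _
  · intro w i hw hi h
    have hw' : w ∈ D.W Set.univ := D.W_mono (Set.subset_univ _) hw
    have hti : t i ∈ Subgroup.closure (t '' I) := Subgroup.subset_closure ⟨i, hi, rfl⟩
    rcases D.pos_or_neg hw i with h1 | h1
    · rw [D.T_mul_s hbr hw' h1]; exact mul_mem h hti
    · rw [D.T_mul_s_neg hbr hw' h1]; exact mul_mem h (inv_mem hti)

/-- Deletion: if a word maps a simple root to a negative root, a letter cancels against it. -/
theorem exists_deletion (L : List (Fin (n + 1))) (i : Fin (n + 1))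
    (h : (L.map D.s).prod (e i) ≤ 0) :
    ∃ L' : List (Fin (n + 1)), L'.length + 1 = L.length ∧ L'.Sublist L ∧
      (L.map D.s).prod * D.s i = (L'.map D.s).prod := by
  induction L with
  | nil =>
    exfalso
    have := h i
    simp [e] at this
  | cons l L ih =>
    have hmem : ∀ L : List (Fin (n + 1)), (L.map D.s).prod ∈ D.W Set.univ := by
      intro L
      refine Subgroup.list_prod_mem _ fun x hx => ?_
      obtain ⟨j, -, rfl⟩ := List.mem_map.1 hx
      exact D.s_mem_W (Set.mem_univ j)
    set v := (L.map D.s).prod with hv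
    rcases D.pos_or_neg (hmem L) i with h1 | h1
    -- The letter `l` turns the positive root `v α_i` negative, and `α_l` is the only positive root
    -- for which it can do so. Hence `s_l v = v s_i`, and the letter cancels.
    · have h2 : v (e i) = e l := by
        by_contra hne
        have h3 := (IsRoot.W (hmem L) (D.isRoot_e i)).s_nonneg h1 hne
        rw [List.map_cons, List.prod_cons, LinearEquiv.mul_apply] at h
        exact ((IsRoot.W (hmem L) (D.isRoot_e i)).s l).not_both h3 h
      refine ⟨L, rfl, List.sublist_cons_self _ _, ?_⟩
      rw [List.map_cons, List.prod_cons, ← hv]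
      have h4 : D.s l * v = v * D.s i := by
        ext1 x
        have h5 : D.d l = D.d i := by
          have := D.B_W (hmem L) (e i) (e i)
          rw [← hv, h2, B_e, B_e, pr_e, pr_e, D.diag, D.diag] at this
          omega
        have h6 : D.pr l (v x) = D.pr i x := by
          have := D.B_W (hmem L) x (e i)
          rw [← hv, h2, B_e, B_e, h5] at this
          exact mul_left_cancel₀ (D.d_ne i) this
        rw [LinearEquiv.mul_apply, LinearEquiv.mul_apply, s_apply, s_apply, map_sub, map_smul, h2,
          h6]
      rw [h4, mul_assoc, s_mul_s, mul_one]
    · obtain ⟨L', h2, h3, h4⟩ := ih h1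
      refine ⟨l :: L', by simp [h2], h3.cons_cons l, ?_⟩
      rw [List.map_cons, List.prod_cons, mul_assoc, h4, List.map_cons, List.prod_cons]

/-- The lift of an element is computed by any word that is shortest among the words with the same
set of letters. -/
theorem T_word (hbr : D.Braids t) {I : Set (Fin (n + 1))} (L : List (Fin (n + 1)))
    (hI : ∀ i ∈ L, i ∈ I)
    (hmin : ∀ L' : List (Fin (n + 1)), (∀ i ∈ L', i ∈ I) →
      (L'.map D.s).prod = (L.map D.s).prod → L.length ≤ L'.length) :
    D.T t (L.map D.s).prod = (L.map t).prod := by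
  induction L using List.reverseRecOn with
  | nil => simpa using T_one D hbr
  | append_singleton L i ih =>
    have hmem : (L.map D.s).prod ∈ D.W Set.univ := by
      refine Subgroup.list_prod_mem _ fun x hx => ?_
      obtain ⟨j, -, rfl⟩ := List.mem_map.1 hx
      exact D.s_mem_W (Set.mem_univ j)
    have hpos : 0 ≤ (L.map D.s).prod (e i) := by
      refine (D.pos_or_neg hmem i).resolve_right fun h => ?_
      obtain ⟨L', h1, h2, h3⟩ := D.exists_deletion L i h
      have := hmin L' (fun j hj => hI j (by simp [h2.subset hj])) (by simp [h3])
      simp at this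
      omega
    simp only [List.map_append, List.prod_append, List.map_cons, List.map_nil, List.prod_cons,
      List.prod_nil, mul_one]
    rw [D.T_mul_s hbr hmem hpos, ih (fun j hj => hI j (by simp [hj]))]
    intro L' hL' heq
    have := hmin (L' ++ [i]) (by
      intro j hj
      rcases List.mem_append.1 hj with hj | hj
      · exact hL' j hj
      · exact hI j (by simp at hj; simp [hj])) (by simp [heq])
    simpa using this

end

end AffineDatum

/-! ### Short roots, the reflection in `θ`, and translations -/

namespace AffineDatum

variable {n : ℕ} (D : AffineDatum n)

/-- `θ = δ - α_0`. -/
def th : Lat n := D.m - e 0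

theorem m_eq : D.m = D.th + e 0 := by rw [th, sub_add_cancel]

theorem e_zero_eq : e 0 = D.m - D.th := by rw [th, sub_sub_cancel]

theorem th_zero : D.th 0 = 0 := by
  rw [th, Pi.sub_apply, D.m_zero, e_self, sub_self]

theorem th_ne {i : Fin (n + 1)} (hi : i ≠ 0) : D.th i = D.m i := by
  rw [th, Pi.sub_apply, e_ne hi, sub_zero]

theorem th_nonneg : 0 ≤ D.th := by
  intro i
  by_cases hi : i = 0
  · subst hi; rw [th_zero]; rfl
  · rw [D.th_ne hi]
    have := D.m_pos i
    simp only [Pi.zero_apply]; omega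

theorem pr_th (i : Fin (n + 1)) : D.pr i D.th = -D.a i 0 := by
  rw [th, pr_sub, pr_m, pr_e, zero_sub]

theorem B_th (x : Lat n) : D.B D.th x = -D.pr 0 x := by
  rw [th, B_sub_left, B_m_left, B_e_left, D.d_zero]; ring

theorem B_th_th : D.B D.th D.th = 2 := by
  rw [B_th, pr_th, D.diag]; ring

/-- The reflection in a short root. -/
def refl (x : Lat n) (hx : D.B x x = 2) : Lat n ≃ₗ[ℤ] Lat n :=
  Module.reflection (x := x) (f := D.B x) hx

theorem refl_apply (x : Lat n) (hx : D.B x x = 2) (y : Lat n) :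
    D.refl x hx y = y - D.B x y • x := Module.reflection_apply _ _

theorem isRoot_of_B {D : AffineDatum n} {x : Lat n} (hx : D.B x x = 2) : D.IsRoot x :=
  ⟨by omega, fun j => by rw [hx]; exact dvd_mul_right _ _⟩

theorem refl_W {I} {w : Lat n ≃ₗ[ℤ] Lat n} (hw : w ∈ D.W I) (x : Lat n) (hx : D.B x x = 2) :
    D.refl (w x) (by rw [D.B_W hw, hx]) = w * D.refl x hx * w⁻¹ := by
  ext1 y
  rw [LinearEquiv.mul_apply, LinearEquiv.mul_apply, refl_apply, refl_apply, map_sub, map_smul]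
  have h : w (w⁻¹ y) = y := by rw [← LinearEquiv.mul_apply, mul_inv_cancel]; rfl
  rw [h]
  congr 2
  rw [← D.B_W hw x, h]

theorem refl_e {i : Fin (n + 1)} (hi : D.B (e i) (e i) = 2) : D.refl (e i) hi = D.s i := by
  have hd : D.d i = 1 := by rw [B_e, pr_e, D.diag] at hi; omega
  ext1 y
  rw [refl_apply, s_apply, B_e_left, hd, one_mul]

theorem B_e_self (i : Fin (n + 1)) : D.B (e i) (e i) = 2 * D.d i := by
  rw [B_e, pr_e, D.diag]; ring

/-- The positive short roots of the finite root system. -/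
structure Short (x : Lat n) : Prop where
  B_eq : D.B x x = 2
  zero : x 0 = 0
  nonneg : 0 ≤ x

theorem short_th : D.Short D.th := ⟨D.B_th_th, D.th_zero, D.th_nonneg⟩

theorem Short.isRoot {D : AffineDatum n} {x : Lat n} (hx : D.Short x) : D.IsRoot x :=
  isRoot_of_B hx.B_eq

theorem Short.exists_pos {D : AffineDatum n} {x : Lat n} (hx : D.Short x) :
    ∃ i, i ≠ 0 ∧ 0 < x i ∧ 0 < D.pr i x := by
  by_contra hcon
  push Not at hcon
  have : D.B x x ≤ 0 := by
    rw [B_apply]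
    refine Finset.sum_nonpos fun i _ => ?_
    by_cases hi : i = 0
    · rw [hi, hx.zero]; simp
    · have h0 := hx.nonneg i
      simp only [Pi.zero_apply] at h0
      have hd := D.d_pos i
      rcases h0.eq_or_lt with h1 | h1
      · rw [← h1]; simp
      · have h2 := hcon i hi h1
        have h3 : x i * D.pr i x ≤ 0 := mul_nonpos_of_nonneg_of_nonpos h0 h2
        exact mul_nonpos_of_nonneg_of_nonpos (by omega) h3
  have := hx.B_eq
  omega

/-- Expand `B (x - α_i) (x - α_i) ≥ 0`: a pairing of at least `2` forces norm zero, and then `x =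
α_i` because the affine coordinate of the difference is `0`. -/
theorem pr_le_one {x : Lat n} (hB : D.B x x = 2) (h0 : x 0 = 0) {i : Fin (n + 1)} (hi : i ≠ 0)
    (hne : x ≠ e i) : D.pr i x ≤ 1 := by
  have h1 : D.B (x - e i) (x - e i) = 2 + 2 * D.d i - 2 * (D.d i * D.pr i x) := by
    rw [B_sub_left, B_sub, B_sub, B_e_left, B_e, B_e_self, hB]; ring
  have h2 := D.B_nonneg (x - e i)
  have hd := D.d_pos i
  by_contra hcon
  push Not at hcon
  have h3 : D.d i * 2 ≤ D.d i * D.pr i x := mul_le_mul_of_nonneg_left (by omega) (by omega)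
  have h4 : D.B (x - e i) (x - e i) = 0 := by omega
  have h5 := D.eq_smul_of_B_eq_zero _ h4
  rw [Pi.sub_apply, h0, e_ne hi.symm, sub_zero, zero_smul, sub_eq_zero] at h5
  exact hne h5

theorem Short.sub_e {D : AffineDatum n} {x : Lat n} (hx : D.Short x) {i : Fin (n + 1)}
    (hi : i ≠ 0) (hne : x ≠ e i) (hpr : D.pr i x = 1) : D.Short (x - e i) := by
  have h : D.s i x = x - e i := by rw [s_apply, hpr, one_smul]
  refine ⟨?_, ?_, ?_⟩
  · rw [← h, B_s_s, hx.B_eq]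
  · rw [Pi.sub_apply, hx.zero, e_ne hi.symm, sub_zero]
  · rw [← h]; exact hx.isRoot.s_nonneg hx.nonneg hne

/-- This drives all inductions on the height: a positive short root of the finite system is either
simple or becomes a smaller one on subtracting a simple root from its support. Some simple coroot is
positive on it because `B x x = ∑ d_i x_i (x, α_i^∨)` is positive. -/
theorem Short.exists_descent {D : AffineDatum n} {x : Lat n} (hx : D.Short x) :
    ∃ i, i ≠ 0 ∧ 0 < x i ∧ (x = e i ∨ (D.pr i x = 1 ∧ x ≠ e i ∧ D.Short (x - e i))) := by
  obtain ⟨i, hi, h1, h2⟩ := hx.exists_pos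
  refine ⟨i, hi, h1, ?_⟩
  by_cases hne : x = e i
  · exact Or.inl hne
  · have h3 := D.pr_le_one hx.B_eq hx.zero hi hne
    have h4 : D.pr i x = 1 := by omega
    exact Or.inr ⟨h4, hne, hx.sub_e hi hne h4⟩

/-- The height of a vector. -/
def ht (x : Lat n) : ℕ := (∑ i, x i).toNat

theorem ht_sub_e {x : Lat n} (hx : 0 ≤ x - e i) : ht (x - e i) + 1 = ht x := by
  have h1 : ∑ j, (x - e i) j = ∑ j, x j - 1 := by
    simp [Finset.sum_sub_distrib, e, Pi.single_apply]
  have h2 : 0 ≤ ∑ j, (x - e i) j := Finset.sum_nonneg fun j _ => hx j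
  unfold ht
  omega

theorem Short.refl_sub {D : AffineDatum n} {x : Lat n} (hx : D.Short x) {i : Fin (n + 1)}
    (hpr : D.pr i x = 1) (hx' : D.Short (x - AffineDatum.e i)) :
    D.refl x hx.B_eq = D.s i * D.refl (x - AffineDatum.e i) hx'.B_eq * D.s i := by
  have h : D.s i (x - AffineDatum.e i) = x := by
    rw [s_apply, pr_sub, pr_e, D.diag, hpr]; module
  have h1 := D.refl_W (D.s_mem_W (Set.mem_univ i)) (x - AffineDatum.e i) hx'.B_eq
  rw [s_inv] at h1
  simp only [h] at h1
  exact h1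

/-- The reflection in a positive short root lies in the parabolic subgroup of its support. -/
theorem Short.refl_mem {D : AffineDatum n} {I : Set (Fin (n + 1))} {x : Lat n} (hx : D.Short x)
    (hI : ∀ i, x i ≠ 0 → i ∈ I) : D.refl x hx.B_eq ∈ D.W I := by
  suffices h : ∀ k x, ht x = k → ∀ hx : D.Short x, (∀ i, x i ≠ 0 → i ∈ I) →
      D.refl x hx.B_eq ∈ D.W I from h _ x rfl hx hI
  clear hx hI x
  intro k
  induction k with
  | zero =>
    intro x hk hx _
    exfalso
    obtain ⟨i, -, h1, -⟩ := hx.exists_pos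
    have : 0 < ∑ j, x j := Finset.sum_pos' (fun j _ => hx.nonneg j) ⟨i, Finset.mem_univ i, h1⟩
    unfold ht at hk
    omega
  | succ k ih =>
    intro x hk hx hI
    obtain ⟨i, hi, h0, rfl | ⟨h1, h2, h3⟩⟩ := hx.exists_descent
    · rw [refl_e]; exact D.s_mem_W (hI i h0.ne')
    · rw [hx.refl_sub h1 h3]
      have hi' := D.s_mem_W (hI i h0.ne')
      refine mul_mem (mul_mem hi' (ih _ ?_ h3 ?_)) hi'
      · have := ht_sub_e h3.nonneg
        omega
      · intro j hj
        by_cases hji : j = i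
        · rw [hji]; exact hI i h0.ne'
        · refine hI j ?_
          rwa [Pi.sub_apply, e_ne hji, sub_zero] at hj

/-- The reflection `s_θ`. -/
def sth : Lat n ≃ₗ[ℤ] Lat n := D.refl D.th D.B_th_th

theorem sth_apply (x : Lat n) : D.sth x = x - D.B D.th x • D.th := D.refl_apply _ _ _

theorem sth_mem_fin : D.sth ∈ D.W {0}ᶜ :=
  D.short_th.refl_mem fun i hi h0 => hi (by rw [h0, D.th_zero])

theorem sth_mem : D.sth ∈ D.W Set.univ := D.W_mono (Set.subset_univ _) D.sth_mem_fin

/-- The translation by `l`. -/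
def tr (l : Lat n) : Lat n ≃ₗ[ℤ] Lat n where
  toFun x := x - D.B l x • D.m
  invFun x := x + D.B l x • D.m
  map_add' x y := by rw [B_add]; module
  map_smul' c x := by rw [B_smul]; simp only [RingHom.id_apply]; module
  left_inv x := by
    simp only [B_sub, B_smul, B_m]
    module
  right_inv x := by
    simp only [B_add, B_smul, B_m]
    module

theorem tr_apply (l x : Lat n) : D.tr l x = x - D.B l x • D.m := rfl

theorem tr_add (l k : Lat n) : D.tr (l + k) = D.tr l * D.tr k := by
  ext1 x
  simp only [LinearEquiv.mul_apply, tr_apply, B_add_left, B_sub, B_smul, B_m]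
  module

theorem tr_m : D.tr D.m = 1 := by
  ext1 x
  rw [tr_apply, B_m_left, zero_smul, sub_zero]; rfl

theorem tr_zero : D.tr 0 = 1 := by
  ext1 x
  simp only [tr_apply, map_zero, LinearMap.zero_apply, zero_smul, sub_zero]; rfl

theorem tr_neg (l : Lat n) : D.tr (-l) = (D.tr l)⁻¹ := by
  rw [eq_inv_iff_mul_eq_one, ← tr_add, neg_add_cancel, tr_zero]

theorem W_tr {I} {w : Lat n ≃ₗ[ℤ] Lat n} (hw : w ∈ D.W I) (l : Lat n) :
    w * D.tr l = D.tr (w l) * w := by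
  ext1 x
  rw [LinearEquiv.mul_apply, LinearEquiv.mul_apply, tr_apply, tr_apply, map_sub, map_smul,
    D.W_m hw, D.B_W hw]

theorem s_tr (i : Fin (n + 1)) (l : Lat n) : D.s i * D.tr l = D.tr (D.s i l) * D.s i :=
  D.W_tr (D.s_mem_W (Set.mem_univ i)) l

/-- The reflections in `α_0 = δ - θ` and in `θ` differ by a translation. This puts the first
nontrivial translation into the Weyl group and later gives `X_θ = t_0 T_{s_θ}`. -/
theorem s_zero_mul_sth : D.s 0 * D.sth = D.tr D.th := by
  ext1 x
  rw [LinearEquiv.mul_apply, sth_apply, s_apply, tr_apply, pr_sub, pr_smul, pr_th, D.diag,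
    e_zero_eq, B_th]
  module

/-- A subgroup of the lattice that contains `δ` and `α_0`, and along with a simple root its
neighbours reached by a unit step, is everything. -/
theorem mem_of_gen (S : AddSubgroup (Lat n)) (hm : D.m ∈ S) (h0 : e 0 ∈ S)
    (hS : ∀ i j, j ≠ 0 → e i ∈ S → D.a j i = -1 → e j ∈ S) (x : Lat n) : x ∈ S := by
  have key : ∀ j, e j ∈ S := by
    have hg := D.gen {j | e j ∈ S} h0 (by
      intro i j hi hji
      by_cases hj : j = 0
      · subst hj; exact h0
      · exact hS i j hj hi hji)
    rcases hg with hg | ⟨z, -, hz, hg, -⟩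
    · exact hg
    · intro j
      -- The missed root is `δ` minus the contributions of the other simple roots, since its
      -- coordinate in `δ` is `1`.
      by_cases hj : j = z
      · subst hj
        have h1 : e j = D.m - ∑ i ∈ Finset.univ.erase j, D.m i • e i := by
          have h2 := sum_e D.m
          rw [← Finset.add_sum_erase _ _ (Finset.mem_univ j), hz, one_smul] at h2
          rw [eq_sub_iff_add_eq]
          exact h2.symm
        rw [h1]
        refine sub_mem hm (sum_mem fun i hi => zsmul_mem (hg i ?_) _)
        exact Finset.ne_of_mem_erase hi
      · exact hg j hj
  rw [sum_e x]
  exact sum_mem fun i _ => zsmul_mem (key i) _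

/-- The vectors whose translation is in the Weyl group form a subgroup stable under simple
reflections. It contains `δ`, which acts trivially, and `θ`, so `mem_of_gen` applies. -/
theorem tr_mem (l : Lat n) : D.tr l ∈ D.W Set.univ := by
  let S : AddSubgroup (Lat n) :=
    { carrier := {l | D.tr l ∈ D.W Set.univ}
      zero_mem' := by
        change D.tr 0 ∈ D.W Set.univ
        rw [tr_zero]; exact one_mem _
      add_mem' := fun {a b} ha hb => by
        change D.tr (a + b) ∈ D.W Set.univ
        rw [tr_add]; exact mul_mem ha hb
      neg_mem' := fun {a} ha => by
        change D.tr (-a) ∈ D.W Set.univ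
        rw [tr_neg]; exact inv_mem ha }
  have hth : D.th ∈ S := by
    change D.tr D.th ∈ D.W Set.univ
    rw [← s_zero_mul_sth]
    exact mul_mem (D.s_mem_W (Set.mem_univ 0)) D.sth_mem
  have hm : D.m ∈ S := by
    change D.tr D.m ∈ D.W Set.univ
    rw [tr_m]; exact one_mem _
  refine D.mem_of_gen S hm ?_ ?_ l
  · rw [e_zero_eq]; exact sub_mem hm hth
  · intro i j _ hi hji
    have h1 : D.s j (e i) ∈ S := by
      change D.tr (D.s j (e i)) ∈ D.W Set.univ
      have h2 := D.s_tr j (e i)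
      rw [← mul_inv_eq_iff_eq_mul] at h2
      rw [← h2, s_inv]
      exact mul_mem (mul_mem (D.s_mem_W (Set.mem_univ j)) hi) (D.s_mem_W (Set.mem_univ j))
    have h2 : e j = D.s j (e i) - e i := by
      rw [s_apply, pr_e, hji]; module
    rw [h2]
    exact sub_mem h1 hi

end AffineDatum

/-! ### Dominant translations and Bernstein's lattice -/

namespace AffineDatum

variable {n : ℕ} (D : AffineDatum n)

/-- Dominance for the finite root system. -/
def Dom (l : Lat n) : Prop := ∀ i, i ≠ 0 → 0 ≤ D.pr i l

theorem Dom.add {D : AffineDatum n} {l k : Lat n} (hl : D.Dom l) (hk : D.Dom k) :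
    D.Dom (l + k) := fun i hi => by
  rw [pr_add]; exact add_nonneg (hl i hi) (hk i hi)

theorem Dom.B_nonneg {D : AffineDatum n} {l : Lat n} (hl : D.Dom l) {x : Lat n} (h0 : x 0 = 0)
    (hx : 0 ≤ x) : 0 ≤ D.B l x := by
  rw [B_symm, B_apply]
  refine Finset.sum_nonneg fun i _ => ?_
  by_cases hi : i = 0
  · rw [hi, h0]; simp
  · have hd := D.d_pos i
    exact mul_nonneg (by omega) (mul_nonneg (hx i) (hl i hi))

theorem IsRoot.nonpos_of_neg {D : AffineDatum n} {x : Lat n} (hx : D.IsRoot x) (h : x 0 < 0) :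
    x ≤ 0 := hx.nonneg_or_nonpos.resolve_left fun h1 => by
  have := h1 0
  simp only [Pi.zero_apply] at this
  omega

theorem sub_m_zero (x : Lat n) : (x - x 0 • D.m) 0 = 0 := by
  simp [D.m_zero]

theorem tr_apply_zero (l x : Lat n) : D.tr l x 0 = x 0 - D.B l x := by
  simp [tr_apply, D.m_zero]

/-- This describes the inversions of a dominant translation: translation leaves the finite part `x -
x_0 δ` fixed and lowers the affine coordinate by `B l x`. Since `x_0 ≥ 0`, this drop must be
positive, and dominance makes the finite part positive. -/
theorem Dom.of_tr_nonpos {D : AffineDatum n} {l : Lat n} (hl : D.Dom l) {x : Lat n}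
    (hx : D.IsRoot x) (h0 : 0 ≤ x) (h1 : D.tr l x ≤ 0) :
    0 ≤ x - x 0 • D.m ∧ x 0 < D.B l x := by
  have h00 := h0 0
  have h10 := h1 0
  rw [tr_apply_zero] at h10
  simp only [Pi.zero_apply] at h00 h10
  have hB : D.B l (x - x 0 • D.m) = D.B l x := by
    rw [B_sub, B_smul, B_m, mul_zero, sub_zero]
  have hpos : 0 < D.B l x := by
    by_contra hcon
    have h2 : D.B l x = 0 := by omega
    rw [tr_apply, h2, zero_smul, sub_zero] at h1
    exact hx.not_both h0 h1
  have hr := hx.sub_m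
  have hnn : 0 ≤ x - x 0 • D.m := by
    refine hr.nonneg_or_nonpos.resolve_right fun h2 => ?_
    have h3 := hl.B_nonneg (x := -(x - x 0 • D.m)) (by rw [Pi.neg_apply, sub_m_zero, neg_zero])
      (neg_nonneg.2 h2)
    rw [map_neg, hB] at h3
    omega
  refine ⟨hnn, lt_of_le_of_ne (by omega) fun h2 => ?_⟩
  rw [tr_apply, ← h2] at h1
  exact hr.not_both hnn h1

section

variable {G : Type*} [Group G] {t : Fin (n + 1) → G}

/-- Lengths add in `s_0 s_θ`, because `s_θ α_0 = α_0 + 2 θ` is positive. -/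
theorem T_tr_th (hbr : D.Braids t) : D.T t (D.tr D.th) = t 0 * D.T t D.sth := by
  rw [← s_zero_mul_sth, D.T_s_mul hbr D.sth_mem]
  have h : D.sth⁻¹ = D.sth := rfl
  rw [h, sth_apply, B_th, pr_e, D.diag]
  intro i
  have h1 := D.th_nonneg i
  have h2 := e_nonneg (n := n) 0 i
  simp only [Pi.zero_apply, Pi.sub_apply, Pi.smul_apply, smul_eq_mul] at *
  omega

/-- A root made negative by one dominant translation has positive finite part, so a second dominant
translation lowers its affine coordinate further or leaves it unchanged. Hence lengths add. -/
theorem T_tr_add (hbr : D.Braids t) {l k : Lat n} (hl : D.Dom l) (hk : D.Dom k) :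
    D.T t (D.tr (l + k)) = D.T t (D.tr l) * D.T t (D.tr k) := by
  rw [tr_add, D.T_mul hbr (D.tr_mem _) (D.tr_mem _)]
  intro x hx h0 h1
  obtain ⟨h2, h3⟩ := hk.of_tr_nonpos hx h0 h1
  have h4 := hl.B_nonneg (D.sub_m_zero x) h2
  rw [B_sub, B_smul, B_m, mul_zero, sub_zero] at h4
  refine IsRoot.nonpos_of_neg (IsRoot.W (D.tr_mem l) (IsRoot.W (D.tr_mem k) hx)) ?_
  rw [tr_apply_zero, tr_apply_zero, tr_apply, B_sub, B_smul, B_m]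
  omega

theorem T_tr_comm (hbr : D.Braids t) {l k : Lat n} (hl : D.Dom l) (hk : D.Dom k) :
    D.T t (D.tr l) * D.T t (D.tr k) = D.T t (D.tr k) * D.T t (D.tr l) := by
  rw [← D.T_tr_add hbr hl hk, ← D.T_tr_add hbr hk hl, add_comm]

theorem T_s_mul_tr (hbr : D.Braids t) {l : Lat n} {i : Fin (n + 1)} (h : D.pr i l = 0) :
    D.T t (D.s i * D.tr l) = t i * D.T t (D.tr l) := by
  rw [D.T_s_mul hbr (D.tr_mem l)]
  rw [← tr_neg, tr_apply, B_e, map_neg, h]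
  simpa using e_nonneg i

theorem comm_T_tr (hbr : D.Braids t) {l : Lat n} {i : Fin (n + 1)} (h : D.pr i l = 0) :
    t i * D.T t (D.tr l) = D.T t (D.tr l) * t i := by
  rw [← D.T_s_mul_tr hbr h, s_tr, D.T_mul_s hbr (D.tr_mem _), s_apply, h, zero_smul, sub_zero]
  rw [tr_apply, B_e, s_apply, h]
  simpa [h] using e_nonneg i

/-- The core of Bernstein's relation. Both sides are the canonical lift of `t_l s_i t_l = s_i t_{2l
- α_i}`, where `t_l` is the translation. On the left, `t_l α_i` is negative, so the step to `t_l
s_i` inverts `t i`, and the last factor adds lengths; on the right, `2l - α_i` pairs to zero with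
`α_i^∨`. -/
theorem T_tr_reflect (hbr : D.Braids t) {l : Lat n} (hl : D.Dom l) {i : Fin (n + 1)} (hi : i ≠ 0)
    (h : D.pr i l = 1) :
    D.T t (D.tr l) * (t i)⁻¹ * D.T t (D.tr l) = t i * D.T t (D.tr (2 • l - e i)) := by
  have hpr : D.pr i (2 • l - e i) = 0 := by
    rw [pr_sub, map_nsmul, h, pr_e, D.diag]; rfl
  have hd := D.d_pos i
  have hsl : D.s i l = l - e i := by rw [s_apply, h, one_smul]
  have h1 : D.tr l (e i) ≤ 0 := by
    refine IsRoot.nonpos_of_neg (IsRoot.W (D.tr_mem l) (D.isRoot_e i)) ?_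
    rw [tr_apply_zero, B_e, h, e_ne hi.symm]
    omega
  rw [← D.T_mul_s_neg hbr (D.tr_mem l) h1, ← D.T_s_mul_tr hbr hpr,
    ← D.T_mul hbr (mul_mem (D.tr_mem l) (D.s_mem_W (Set.mem_univ i))) (D.tr_mem l)]
  · rw [s_tr, mul_assoc, s_tr, ← mul_assoc, ← tr_add, hsl]
    congr 3
    rw [s_apply, hpr]; module
  · intro x hx h0 hx1
    obtain ⟨h2, h3⟩ := hl.of_tr_nonpos hx h0 hx1
    set y := x - x 0 • D.m with hy
    have hyr : D.IsRoot y := hx.sub_m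
    have hy0 : y 0 = 0 := D.sub_m_zero x
    have hxy : x = y + x 0 • D.m := by rw [hy]; abel
    clear_value y
    have hBl : D.B l x = D.B l y := by
      rw [hxy, B_add, B_smul, B_m]; ring
    have hr : D.IsRoot ((D.tr l * D.s i) (D.tr l x)) :=
      IsRoot.W (mul_mem (D.tr_mem l) (D.s_mem_W (Set.mem_univ i))) (IsRoot.W (D.tr_mem l) hx)
    have hval : (D.tr l * D.s i) (D.tr l x) =
        D.s i y + (x 0 - D.B l y - D.B (D.s i l) y) • D.m := by
      have e1 : D.B l (D.s i y) = D.B (D.s i l) y := by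
        rw [← D.B_s_s i l, s_s]
      rw [LinearEquiv.mul_apply, tr_apply, tr_apply, map_sub, map_smul, s_m, hBl]
      have e2 : D.s i x = D.s i y + x 0 • D.m := by
        conv_lhs => rw [hxy]
        rw [map_add, map_smul, s_m]
      rw [e2]
      simp only [B_sub, B_add, B_smul, B_m, e1]
      module
    -- The only delicate finite part is `α_i`. Integrality gives `d_i ∣ x_0` while `0 ≤ x_0 < d_i`,
    -- so `x_0 = 0` and the root is sent to `-α_i`. For any other finite part `s_i y` is still
    -- positive, and the affine coordinate ends up negative.
    by_cases hyi : y = e i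
    · have hx0 : x 0 = 0 := by
        have h5 := hx.2 0
        have h6 : D.B x x = 2 * D.d i := by
          rw [← D.B_e_self i, ← hyi, hxy]
          simp only [B_add, B_add_left, B_smul, B_smul_left, B_m, B_m_left]
          simp
        rw [h6, D.d_zero, one_mul] at h5
        have h7 := Int.dvd_of_mul_dvd_mul_left (by norm_num) h5
        rw [hBl, hyi, B_e, h, mul_one] at h3
        exact Int.eq_zero_of_dvd_of_nonneg_of_lt (h0 0) h3 h7
      rw [hval, hyi, hx0, s_e_self, B_e, B_e, hsl, pr_sub, pr_e, D.diag, h]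
      have : (0 : ℤ) - D.d i * 1 - D.d i * (1 - 2) = 0 := by ring
      rw [this, zero_smul, add_zero]
      exact neg_nonpos.2 (e_nonneg i)
    · refine hr.nonpos_of_neg ?_
      have h5 := hyr.s_nonneg h2 hyi
      have h6 := hl.B_nonneg (x := D.s i y) (by rw [s_apply_ne D hi.symm, hy0]) h5
      have e1 : D.B l (D.s i y) = D.B (D.s i l) y := by
        rw [← D.B_s_s i l, s_s]
      rw [e1] at h6
      rw [hval, Pi.add_apply, s_apply_ne D hi.symm, hy0, Pi.smul_apply, D.m_zero]
      simp only [smul_eq_mul]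
      omega

/-- Multiples of the fundamental weights lie in the lattice. -/
theorem exists_weights : ∃ (N : ℤ) (om : Fin (n + 1) → Lat n), 0 < N ∧
    ∀ i j, i ≠ 0 → j ≠ 0 → D.pr j (om i) = if j = i then N else 0 := by
  set C : Matrix (Fin n) (Fin n) ℤ := fun i j => D.a i.succ j.succ with hC
  have hpr : ∀ (v : Fin n → ℤ) (j : Fin n),
      D.pr j.succ (Fin.cons 0 v : Lat n) = C.mulVec v j := by
    intro v j
    rw [pr_apply, Fin.sum_univ_succ]
    simp [Matrix.mulVec, dotProduct, hC]
  -- A kernel vector of the finite Cartan matrix, extended by zero at the affine node, has norm zero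
  -- and hence vanishes.
  have hdet : C.det ≠ 0 := by
    intro h0
    obtain ⟨v, hv, hv0⟩ := Matrix.exists_mulVec_eq_zero_iff.2 h0
    set x : Lat n := Fin.cons 0 v with hx
    have hB : D.B x x = 0 := by
      rw [B_apply, Fin.sum_univ_succ]
      simp [hx, hpr, hv0]
    have h1 := D.eq_smul_of_B_eq_zero x hB
    refine hv (funext fun j => ?_)
    have h2 := congrFun h1 j.succ
    simpa [hx] using h2
  -- The adjugate gives the weights scaled by the determinant; the extra factor makes the scale `N`
  -- positive whatever its sign.
  refine ⟨C.det * C.det, fun i => Fin.cons 0 (fun k => C.det *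
    (if h : i = 0 then 0 else C.adjugate k (i.pred h))), mul_self_pos.2 hdet, ?_⟩
  intro i j hi hj
  obtain ⟨i, rfl⟩ := Fin.exists_succ_eq.2 hi
  obtain ⟨j, rfl⟩ := Fin.exists_succ_eq.2 hj
  rw [hpr]
  simp only [Fin.succ_ne_zero, dite_false, Fin.pred_succ, Matrix.mulVec, dotProduct]
  have h := congrFun (congrFun (Matrix.mul_adjugate C) j) i
  rw [Matrix.mul_apply] at h
  have h2 : ∑ x, C j x * (C.det * C.adjugate x i) = C.det * ∑ x, C j x * C.adjugate x i := by
    rw [Finset.mul_sum]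
    exact Finset.sum_congr rfl fun _ _ => by ring
  rw [h2, h]
  simp [Matrix.smul_apply, Matrix.one_apply, Fin.succ_inj]

/-- Add a large multiple of the sum of the scaled fundamental weights other than the `i`-th. For `i
= 0` nothing is left out and `x + l` becomes dominant; for `i ≠ 0` the pairing with `α_i^∨` is
unchanged. -/
theorem exists_dom (x : Lat n) (i : Fin (n + 1)) : ∃ l, D.Dom l ∧ (i ≠ 0 → D.pr i l = 0) ∧
    ∀ j, j ≠ 0 → j ≠ i → 0 ≤ D.pr j (x + l) := by
  obtain ⟨N, om, hN, hom⟩ := D.exists_weights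
  set K : ℤ := ∑ j, |D.pr j x| with hK
  have hKx : ∀ j, |D.pr j x| ≤ K := fun j =>
    Finset.single_le_sum (f := fun j => |D.pr j x|) (fun j _ => abs_nonneg _) (Finset.mem_univ j)
  have hK0 : 0 ≤ K := Finset.sum_nonneg fun j _ => abs_nonneg _
  set l : Lat n := K • ∑ k ∈ Finset.univ.filter (fun k => k ≠ 0 ∧ k ≠ i), om k with hl
  have hpr : ∀ j, j ≠ 0 → D.pr j l = if j = i then 0 else K * N := by
    intro j hj
    rw [hl, pr_smul, map_sum]
    have : ∀ k ∈ Finset.univ.filter (fun k => k ≠ 0 ∧ k ≠ i), D.pr j (om k) =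
        if k = j then N else 0 := by
      intro k hk
      rw [hom k j (Finset.mem_filter.1 hk).2.1 hj]
      simp only [eq_comm]
    rw [Finset.sum_congr rfl this, Finset.sum_ite_eq']
    by_cases hji : j = i <;> simp [hji, hj]
  refine ⟨l, fun j hj => ?_, fun hi => ?_, fun j hj hji => ?_⟩
  · rw [hpr j hj]; split_ifs
    · exact le_rfl
    · positivity
  · rw [hpr i hi, if_pos rfl]
  · rw [pr_add, hpr j hj, if_neg hji]
    have h1 := hKx j
    have h2 := neg_abs_le (D.pr j x)
    nlinarith

/-- Bernstein's presentation: the commuting elements `X_β` inside an affine Artin group. -/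
theorem exists_bernstein (hbr : D.Braids t) : ∃ X : Lat n → G, (∀ x y, X (x + y) = X x * X y) ∧
    X D.m = 1 ∧ X D.th = t 0 * D.T t D.sth ∧
    (∀ i x, i ≠ 0 → D.pr i x = 0 → t i * X x = X x * t i) ∧
    (∀ i x, i ≠ 0 → D.pr i x = -1 → t i * X x * t i = X (x + e i)) := by
  -- Every `x` is a difference of the dominant vectors `x + f x` and `f x`, and `X x` is the
  -- quotient of their lifts. By commutativity the quotient does not depend on the choice (`hXeq`).
  choose f hf1 _ hf3 using fun x => D.exists_dom x 0
  have hf4 : ∀ x, D.Dom (x + f x) := fun x i hi => hf3 x i hi hi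
  set Y : Lat n → G := fun l => D.T t (D.tr l) with hY
  set X : Lat n → G := fun x => Y (x + f x) * (Y (f x))⁻¹ with hX
  have hcomm : ∀ {l k}, D.Dom l → D.Dom k → Y l * Y k = Y k * Y l :=
    fun hl hk => D.T_tr_comm hbr hl hk
  have hadd : ∀ {l k}, D.Dom l → D.Dom k → Y (l + k) = Y l * Y k :=
    fun hl hk => D.T_tr_add hbr hl hk
  have hXeq : ∀ l k, D.Dom l → D.Dom k → X (l - k) = Y l * (Y k)⁻¹ := by
    intro l k hl hk
    have h1 := hadd (hf4 (l - k)) hk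
    have h2 := hadd hl (hf1 (l - k))
    have h3 : l - k + f (l - k) + k = l + f (l - k) := by abel
    rw [h3, h2] at h1
    simp only [hX]
    rw [mul_inv_eq_iff_eq_mul, mul_assoc, ← (show Y (f (l - k)) * (Y k)⁻¹ = (Y k)⁻¹ * Y (f (l - k))
      from ((show Commute (Y (f (l - k))) (Y k) from hcomm (hf1 _) hk).inv_right)), ← mul_assoc, h1,
      mul_inv_cancel_right]
  have hXY : ∀ l, D.Dom l → X l = Y l := by
    intro l hl
    have h0 : D.Dom 0 := fun i _ => by simp
    have h1 := hXeq l 0 hl h0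
    rw [sub_zero] at h1
    rw [h1]
    simp only [hY]
    rw [tr_zero, T_one D hbr, inv_one, mul_one]
  have hXadd : ∀ x y, X (x + y) = X x * X y := by
    intro x y
    have h1 := hXeq (x + f x + (y + f y)) (f x + f y) ((hf4 x).add (hf4 y)) ((hf1 x).add (hf1 y))
    have h2 : x + f x + (y + f y) - (f x + f y) = x + y := by abel
    rw [h2, hadd (hf4 x) (hf4 y), hadd (hf1 x) (hf1 y)] at h1
    rw [h1]
    have h3 : Commute (Y (y + f y)) (Y (f x))⁻¹ :=
      (show Commute (Y (y + f y)) (Y (f x)) from hcomm (hf4 y) (hf1 x)).inv_right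
    have h4 : Commute (Y (f x)) (Y (f y)) := hcomm (hf1 x) (hf1 y)
    simp only [hX]
    rw [h4.eq, mul_inv_rev, mul_assoc, ← mul_assoc (Y (y + f y)), h3.eq]
    simp only [mul_assoc]
  have hX0 : X 0 = 1 := by
    have := hXadd 0 0
    rw [add_zero] at this
    exact left_eq_mul.1 this
  have hXsub : ∀ x y, X (x - y) = X x * (X y)⁻¹ := by
    intro x y
    rw [eq_mul_inv_iff_mul_eq, ← hXadd, sub_add_cancel]
  have hXcomm : ∀ x y, X x * X y = X y * X x := by
    intro x y
    rw [← hXadd, ← hXadd, add_comm]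
  refine ⟨X, hXadd, ?_, ?_, ?_, ?_⟩
  · rw [hXY _ (fun i _ => by rw [pr_m])]
    simp only [hY]
    rw [tr_m, T_one D hbr]
  · rw [hXY _ (fun i hi => by rw [pr_th]; have := D.off i 0 hi; omega)]
    exact D.T_tr_th hbr
  · intro i x hi hx
    obtain ⟨l, hl1, hl2, hl3⟩ := D.exists_dom x i
    have hxl : D.Dom (x + l) := by
      intro j hj
      by_cases hji : j = i
      · rw [hji, pr_add, hx, hl2 hi, add_zero]
      · exact hl3 j hj hji
    have h1 : Commute (t i) (Y (x + l)) :=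
      D.comm_T_tr hbr (by rw [pr_add, hx, hl2 hi, add_zero])
    have h2 : Commute (t i) (Y l) := D.comm_T_tr hbr (hl2 hi)
    have h3 : X x = Y (x + l) * (Y l)⁻¹ := by
      rw [← hXeq _ _ hxl hl1, add_sub_cancel_right]
    rw [h3]
    exact h1.mul_right h2.inv_right
  · intro i x hi hx
    -- The reflection relation is first obtained for the negative of a dominant `l` with pairing
    -- `1`, from `T_tr_reflect`. A general `x` of pairing `-1` differs from such a vector by a
    -- dominant one of pairing `0`, whose lift commutes with `t i`.
    have key : ∀ l, D.Dom l → D.pr i l = 1 → t i * (X l)⁻¹ * t i = X (e i - l) := by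
      intro l hl hpl
      have h1 := D.T_tr_reflect hbr hl hi hpl
      have h2 : D.Dom (2 • l - e i) := by
        intro j hj
        rw [pr_sub, map_nsmul, pr_e]
        by_cases hji : j = i
        · rw [hji, hpl, D.diag]; rfl
        · have h3 := hl j hj
          have h4 := D.off j i hji
          simp only [nsmul_eq_mul, Nat.cast_ofNat]
          omega
      have h3 : X l * (t i)⁻¹ * X l = t i * X (2 • l - e i) := by
        rw [hXY _ h2, hXY _ hl]; exact h1
      have h5 : X (2 • l - e i) = X (l - e i) * X l := by
        rw [← hXadd]; congr 1; module
      rw [h5] at h3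
      replace h3 : X l * (t i)⁻¹ * X l = t i * X (l - e i) * X l :=
        h3.trans (mul_assoc _ _ _).symm
      replace h3 := mul_right_cancel h3
      have h6 : X (e i - l) = (X (l - e i))⁻¹ := by
        rw [eq_inv_iff_mul_eq_one, ← hXadd]
        rw [show e i - l + (l - e i) = 0 by abel, hX0]
      have h7 : X (l - e i) = (t i)⁻¹ * X l * (t i)⁻¹ := by
        rw [mul_assoc, h3, inv_mul_cancel_left]
      rw [h6, h7]
      group
    obtain ⟨l, hl1, hl2, hl3⟩ := D.exists_dom (-x) i
    have hxl : D.Dom (-x + l) := by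
      intro j hj
      by_cases hji : j = i
      · rw [hji, pr_add, map_neg, hx, hl2 hi]; norm_num
      · exact hl3 j hj hji
    have h1 := key (-x + l) hxl (by rw [pr_add, map_neg, hx, hl2 hi]; norm_num)
    have h2 : Commute (t i) (X l) := by
      rw [hXY l hl1]
      exact D.comm_T_tr hbr (hl2 hi)
    have h3 : X x = X l * (X (-x + l))⁻¹ := by
      rw [← hXsub]; congr 1; abel
    have h4 : X (x + e i) = X l * X (e i - (-x + l)) := by
      rw [← hXadd]; congr 1; abel
    rw [h4, ← h1, h3, ← mul_assoc, h2.eq]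
    simp only [mul_assoc]

end

end AffineDatum

/-! ### Braid identities in an arbitrary group -/

section BraidRelations

variable {G : Type*} [Group G] {a b c g k i x y z p q : G}

/-- The braid relation of length three. -/
def Braid3 (a b : G) : Prop := a * b * a = b * a * b

/-- The braid relation of length four. -/
def Braid4 (a b : G) : Prop := a * b * a * b = b * a * b * a

theorem Braid3.symm (h : Braid3 a b) : Braid3 b a := Eq.symm h

theorem Braid3.conj (h : Braid3 a b) (g : G) : Braid3 (g * a * g⁻¹) (g * b * g⁻¹) := by
  have := congrArg (fun x => g * x * g⁻¹) h
  simpa [Braid3, mul_assoc] using this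

theorem Braid4.conj (h : Braid4 a b) (g : G) : Braid4 (g * a * g⁻¹) (g * b * g⁻¹) := by
  have := congrArg (fun x => g * x * g⁻¹) h
  simpa [Braid4, mul_assoc] using this

theorem Commute.conj_left_eq (h : Commute g a) : g * a * g⁻¹ = a := by
  rw [h.eq, mul_inv_cancel_right]

theorem Commute.inv_conj_left_eq (h : Commute g a) : g⁻¹ * a * g⁻¹⁻¹ = a :=
  h.inv_left.conj_left_eq

theorem Braid3.conj_eq (h : Braid3 a b) : b * a * b⁻¹ = a⁻¹ * b * a := by
  rw [mul_inv_eq_iff_eq_mul, mul_assoc, mul_assoc, ← mul_assoc b, eq_inv_mul_iff_mul_eq,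
    ← mul_assoc]
  exact h

theorem Braid3.conj_eq' (h : Braid3 a b) : b⁻¹ * a * b = a * b * a⁻¹ := h.symm.conj_eq.symm

/-- Transport along `b a b⁻¹` and `c` when `a` and `c` commute. -/
theorem Braid3.transport (hab : Braid3 a b) (hac : Commute a c) (hbc : Braid3 b c) :
    Braid3 (b * a * b⁻¹) c := by
  have h1 := (hab.conj c).conj b
  rw [hac.symm.conj_left_eq, hbc.conj_eq] at h1
  convert h1 using 1
  group

theorem Braid4.transport (hab : Braid4 a b) (hac : Commute a c) (hbc : Braid3 b c) :
    Braid4 (b * a * b⁻¹) c := by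
  have h1 := (hab.conj c).conj b
  rw [hac.symm.conj_left_eq, hbc.conj_eq] at h1
  convert h1 using 1
  group

theorem Braid4.transport' (hab : Braid3 a b) (hac : Commute a c) (hbc : Braid4 b c) :
    Braid4 (b * a * b⁻¹) c := by
  have h1 := hbc.conj a⁻¹
  rw [hac.inv_conj_left_eq, inv_inv, ← hab.conj_eq] at h1
  exact h1

theorem Braid4.conj_eq (h : Braid4 b c) : b * c * b * c⁻¹ * b⁻¹ = c⁻¹ * b * c := by
  have h1 : b * c * b = c⁻¹ * b * c * b * c := by
    simp only [Braid4, mul_assoc] at h ⊢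
    rw [eq_inv_mul_iff_mul_eq]
    exact h.symm
  rw [h1]
  group

/-- This treats a root lowered twice across a double lace, first at `c` and then at `b`. Conjugating
the relation of `a` and `b` successively by `c⁻¹`, `b⁻¹`, `a⁻¹` brings one entry back to `b` and the
other to the required conjugate. -/
theorem Braid3.transport_four (hab : Braid3 a b) (hac : Commute a c) (hbc : Braid4 b c) :
    Braid3 (c * (b * a * b⁻¹) * c⁻¹) b := by
  have h1 := ((((hab.symm.conj c⁻¹).conj b⁻¹).conj a⁻¹))
  rw [hac.symm.inv_conj_left_eq, inv_inv] at h1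
  have h2 : b⁻¹ * (c⁻¹ * b * c) * b⁻¹⁻¹ = c * b * c⁻¹ := by
    rw [← hbc.conj_eq]; group
  have h3 : a⁻¹ * (b⁻¹ * a * b⁻¹⁻¹) * a⁻¹⁻¹ = b := by
    rw [inv_inv, inv_inv, hab.conj_eq']; group
  rw [h2, h3] at h1
  convert h1 using 1
  rw [hab.conj_eq, inv_inv]
  have h4 : c * a⁻¹ = a⁻¹ * c := (hac.symm.inv_right).eq
  have h5 : a * c⁻¹ = c⁻¹ * a := (hac.inv_right).eq
  calc c * (a⁻¹ * b * a) * c⁻¹ = (c * a⁻¹) * b * (a * c⁻¹) := by group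
    _ = (a⁻¹ * c) * b * (c⁻¹ * a) := by rw [h4, h5]
    _ = a⁻¹ * (c * b * c⁻¹) * a := by group

/-- Two short simple roots: `x = X_k`, `y = X_i`, `z = X_{k + i}`. -/
theorem braid3_of_lattice (hki : Braid3 k i) (hxy : z = x * y) (h1 : i * x * i = z)
    (h2 : k * y * k = z) : Braid3 (x * k⁻¹) i := by
  have e1 : i * x = z * i⁻¹ := by rw [← h1]; group
  have e2 : k⁻¹ * z = y * k := by rw [← h2]; group
  have e3 : k * i⁻¹ * k⁻¹ = i⁻¹ * k⁻¹ * i := by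
    calc k * i⁻¹ * k⁻¹ = (k * i * k⁻¹)⁻¹ := by group
      _ = i⁻¹ * k⁻¹ * i := by rw [hki.symm.conj_eq]; group
  calc x * k⁻¹ * i * (x * k⁻¹) = x * k⁻¹ * (i * x) * k⁻¹ := by group
    _ = x * (k⁻¹ * z) * i⁻¹ * k⁻¹ := by rw [e1]; group
    _ = x * y * (k * i⁻¹ * k⁻¹) := by rw [e2]; group
    _ = z * (i⁻¹ * k⁻¹ * i) := by rw [e3, hxy]
    _ = (i * x) * k⁻¹ * i := by rw [e1]; group
    _ = i * (x * k⁻¹) * i := by group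

/-- The mirror image of `braid3_of_lattice` in the opposite group. The form `k⁻¹ * x` is that of
`T_0⁻¹ X_{α_0}`. -/
theorem braid3_of_lattice' (hki : Braid3 k i) (hxy : z = y * x) (h1 : i * x * i = z)
    (h2 : k * y * k = z) : Braid3 (k⁻¹ * x) i := by
  have e1 : x * i = i⁻¹ * z := by rw [← h1]; group
  have e2 : z * k⁻¹ = k * y := by rw [← h2]; group
  have e3 : k⁻¹ * i⁻¹ * k = i * k⁻¹ * i⁻¹ := by
    calc k⁻¹ * i⁻¹ * k = (k⁻¹ * i * k)⁻¹ := by group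
      _ = i * k⁻¹ * i⁻¹ := by rw [hki.symm.conj_eq']; group
  calc k⁻¹ * x * i * (k⁻¹ * x) = k⁻¹ * (x * i) * k⁻¹ * x := by group
    _ = k⁻¹ * i⁻¹ * (z * k⁻¹) * x := by rw [e1]; group
    _ = (k⁻¹ * i⁻¹ * k) * (y * x) := by rw [e2]; group
    _ = i * k⁻¹ * i⁻¹ * z := by rw [e3, hxy]
    _ = i * k⁻¹ * (x * i) := by rw [e1]; group
    _ = i * (k⁻¹ * x) * i := by group

/-- A short root `k` and a long root `i`: `x = X_k`, `z = X_{k + i}`. -/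
theorem braid4_of_lattice (hki : Braid4 k i) (hxz : Commute x z) (h1 : i * x * i = z)
    (h2 : Commute k z) : Braid4 (x * k⁻¹) i := by
  have e1 : i * x = z * i⁻¹ := by rw [← h1]; group
  have e4 : i⁻¹ * z = x * i := by rw [← h1]; group
  have e2 : k⁻¹ * z = z * k⁻¹ := h2.inv_left.eq
  have e3 : k⁻¹ * i⁻¹ * k⁻¹ * i = i * k⁻¹ * i⁻¹ * k⁻¹ := by
    have h : k * i * k * i = i * k * i * k := hki
    calc k⁻¹ * i⁻¹ * k⁻¹ * i = i * (k * i * k * i)⁻¹ * i := by group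
      _ = i * k⁻¹ * i⁻¹ * k⁻¹ := by rw [h]; group
  calc x * k⁻¹ * i * (x * k⁻¹) * i = x * k⁻¹ * (i * x) * k⁻¹ * i := by group
    _ = x * (k⁻¹ * z) * i⁻¹ * k⁻¹ * i := by rw [e1]; group
    _ = (x * z) * (k⁻¹ * i⁻¹ * k⁻¹ * i) := by rw [e2]; group
    _ = (z * x) * (i * k⁻¹ * i⁻¹ * k⁻¹) := by rw [e3, hxz.eq]
    _ = z * (x * i) * k⁻¹ * i⁻¹ * k⁻¹ := by group
    _ = z * i⁻¹ * (z * k⁻¹) * i⁻¹ * k⁻¹ := by rw [← e4]; group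
    _ = (z * i⁻¹) * k⁻¹ * (z * i⁻¹) * k⁻¹ := by rw [← e2]; group
    _ = (i * x) * k⁻¹ * (i * x) * k⁻¹ := by rw [← e1]
    _ = i * (x * k⁻¹) * i * (x * k⁻¹) := by group

theorem braid4_of_lattice' (hki : Braid4 k i) (hxz : Commute x z) (h1 : i * x * i = z)
    (h2 : Commute k z) : Braid4 (k⁻¹ * x) i := by
  have e1 : x * i = i⁻¹ * z := by rw [← h1]; group
  have e4 : z * i⁻¹ = i * x := by rw [← h1]; group
  have e2 : z * k⁻¹ = k⁻¹ * z := h2.symm.inv_right.eq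
  have e3 : k⁻¹ * i⁻¹ * k⁻¹ * i = i * k⁻¹ * i⁻¹ * k⁻¹ := by
    have h : k * i * k * i = i * k * i * k := hki
    calc k⁻¹ * i⁻¹ * k⁻¹ * i = i * (k * i * k * i)⁻¹ * i := by group
      _ = i * k⁻¹ * i⁻¹ * k⁻¹ := by rw [h]; group
  calc k⁻¹ * x * i * (k⁻¹ * x) * i = k⁻¹ * (x * i) * k⁻¹ * (x * i) := by group
    _ = k⁻¹ * i⁻¹ * (z * k⁻¹) * i⁻¹ * z := by rw [e1]; group
    _ = k⁻¹ * i⁻¹ * k⁻¹ * (z * i⁻¹) * z := by rw [e2]; group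
    _ = (k⁻¹ * i⁻¹ * k⁻¹ * i) * (x * z) := by rw [e4]; group
    _ = (i * k⁻¹ * i⁻¹ * k⁻¹) * (z * x) := by rw [e3, hxz.eq]
    _ = i * k⁻¹ * i⁻¹ * (k⁻¹ * z) * x := by group
    _ = i * k⁻¹ * (i⁻¹ * z) * k⁻¹ * x := by rw [← e2]; group
    _ = i * (k⁻¹ * x) * i * (k⁻¹ * x) := by rw [← e1]; group

/-- The case of `G₂`: `x = X_α`, `y = X_{α + b}`, `z = X_{2 α + b}` with `p = T_α`, `q = T_b`. -/
theorem braid3_of_lattice_six (h6 : q * p * q * p * q * p = p * q * p * q * p * q)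
    (hz : z = y * x) (h1 : q * x * q = y) (h2 : p * y * p = z)
    (h3 : Commute q z) : Braid3 (y * (q * p * q)⁻¹) p := by
  have e1 : p * y = z * p⁻¹ := by rw [← h2]; group
  have e2 : p⁻¹ * z = y * p := by rw [← h2]; group
  have e3 : q⁻¹ * y = x * q := by rw [← h1]; group
  have e4 : q⁻¹ * z = z * q⁻¹ := h3.inv_left.eq
  have e5 : q * p * q⁻¹ * p⁻¹ * q⁻¹ * p⁻¹ * q⁻¹ = p⁻¹ * q⁻¹ * p⁻¹ * q⁻¹ * p := by
    calc q * p * q⁻¹ * p⁻¹ * q⁻¹ * p⁻¹ * q⁻¹ = q * p * (p * q * p * q * p * q)⁻¹ * p := by group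
      _ = p⁻¹ * q⁻¹ * p⁻¹ * q⁻¹ * p := by rw [← h6]; group
  calc y * (q * p * q)⁻¹ * p * (y * (q * p * q)⁻¹)
      = y * q⁻¹ * p⁻¹ * q⁻¹ * (p * y) * q⁻¹ * p⁻¹ * q⁻¹ := by group
    _ = y * q⁻¹ * p⁻¹ * (q⁻¹ * z) * p⁻¹ * q⁻¹ * p⁻¹ * q⁻¹ := by rw [e1]; group
    _ = y * q⁻¹ * (p⁻¹ * z) * q⁻¹ * p⁻¹ * q⁻¹ * p⁻¹ * q⁻¹ := by rw [e4]; group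
    _ = y * (q⁻¹ * y) * p * q⁻¹ * p⁻¹ * q⁻¹ * p⁻¹ * q⁻¹ := by rw [e2]; group
    _ = (y * x) * (q * p * q⁻¹ * p⁻¹ * q⁻¹ * p⁻¹ * q⁻¹) := by rw [e3]; group
    _ = (z * p⁻¹) * q⁻¹ * p⁻¹ * q⁻¹ * p := by rw [e5, hz]; group
    _ = p * (y * (q * p * q)⁻¹) * p := by rw [← e1]; group

end BraidRelations

/-! ### The elements `X_β T_{s_β}⁻¹` and their braid relations -/

namespace AffineDatum

variable {n : ℕ} (D : AffineDatum n)

theorem add_sub_e_cases {x : Lat n} {i : Fin (n + 1)} (h : D.pr i x = 1) :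
    D.pr i (x - e i) = -1 := by
  rw [pr_sub, pr_e, D.diag, h]; norm_num

section

variable {G : Type*} [Group G] {t : Fin (n + 1) → G}

theorem Braids.commute {D : AffineDatum n} (hbr : D.Braids t) {i j : Fin (n + 1)} (hij : i ≠ j)
    (h : D.a i j = 0) : Commute (t i) (t j) := by
  have := hbr i j hij
  change t i * t j = t j * t i
  simpa [len, h, altProd] using this

theorem Braids.three {D : AffineDatum n} (hbr : D.Braids t) {i j : Fin (n + 1)} (hij : i ≠ j)
    (h : D.a i j = -1) (h' : D.a j i = -1) : Braid3 (t i) (t j) := by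
  have := hbr i j hij
  simpa [len, h, h', altProd, Braid3, mul_assoc] using this

theorem Braids.four {D : AffineDatum n} (hbr : D.Braids t) {i j : Fin (n + 1)} (hij : i ≠ j)
    (h : D.a i j * D.a j i = 2) : Braid4 (t i) (t j) := by
  have := hbr i j hij
  simpa [len, h, altProd, Braid4, mul_assoc] using this

theorem Braids.six {D : AffineDatum n} (hbr : D.Braids t) {i j : Fin (n + 1)} (hij : i ≠ j)
    (h : D.a i j * D.a j i = 3) :
    t i * t j * t i * t j * t i * t j = t j * t i * t j * t i * t j * t i := by
  have := hbr i j hij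
  simpa [len, h, altProd, mul_assoc] using this

theorem Short.refl_mem_univ {D : AffineDatum n} {x : Lat n} (hx : D.Short x) :
    D.refl x hx.B_eq ∈ D.W Set.univ := hx.refl_mem fun _ _ => Set.mem_univ _

theorem Short.commute_T_refl {D : AffineDatum n} (hbr : D.Braids t) {x : Lat n} (hx : D.Short x)
    {i : Fin (n + 1)} (h : D.pr i x = 0) : Commute (t i) (D.T t (D.refl x hx.B_eq)) := by
  have h1 : D.refl x hx.B_eq (AffineDatum.e i) = AffineDatum.e i := by
    rw [refl_apply, B_e, h, mul_zero, zero_smul, sub_zero]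
  have h2 := D.T_mul_s hbr hx.refl_mem_univ (i := i) (by rw [h1]; exact e_nonneg i)
  have h3 := D.T_s_mul hbr hx.refl_mem_univ (i := i) (by
    change 0 ≤ D.refl x hx.B_eq (AffineDatum.e i)
    rw [h1]; exact e_nonneg i)
  have h4 : D.s i * D.refl x hx.B_eq = D.refl x hx.B_eq * D.s i := by
    have h5 := D.refl_W (D.s_mem_W (Set.mem_univ i)) x hx.B_eq
    have h6 : D.s i x = x := by rw [s_apply, h, zero_smul, sub_zero]
    simp only [h6] at h5
    rw [eq_mul_inv_iff_mul_eq] at h5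
    exact h5.symm
  change t i * _ = _ * t i
  rw [← h2, ← h3, h4]

/-- Lengths add in `s_β = s_i s_{β - α_i} s_i`: with `γ = β - α_i`, the image `s_γ α_i = α_i + d_i
γ` is positive and stays positive under `s_i`, where it becomes `(d_i - 1) α_i + d_i γ`. -/
theorem Short.T_refl_sub {D : AffineDatum n} (hbr : D.Braids t) {x : Lat n} (hx : D.Short x)
    {i : Fin (n + 1)} (h : D.pr i x = 1) (hx' : D.Short (x - AffineDatum.e i)) :
    D.T t (D.refl x hx.B_eq) = t i * D.T t (D.refl (x - AffineDatum.e i) hx'.B_eq) * t i := by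
  have hd := D.d_pos i
  have h1 : D.refl (x - AffineDatum.e i) hx'.B_eq (AffineDatum.e i) =
      AffineDatum.e i + D.d i • (x - AffineDatum.e i) := by
    rw [refl_apply, B_e, D.add_sub_e_cases h]; module
  have h2 : 0 ≤ D.refl (x - AffineDatum.e i) hx'.B_eq (AffineDatum.e i) := by
    rw [h1]
    exact add_nonneg (e_nonneg i) (smul_nonneg (by omega) hx'.nonneg)
  have h3 : 0 ≤ (D.s i * D.refl (x - AffineDatum.e i) hx'.B_eq) (AffineDatum.e i) := by
    rw [LinearEquiv.mul_apply, h1]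
    have : D.s i (AffineDatum.e i + D.d i • (x - AffineDatum.e i)) =
        (D.d i - 1) • AffineDatum.e i + D.d i • (x - AffineDatum.e i) := by
      rw [map_add, map_smul, s_e_self, s_apply, D.add_sub_e_cases h]; module
    rw [this]
    exact add_nonneg (smul_nonneg (by omega) (e_nonneg i)) (smul_nonneg (by omega) hx'.nonneg)
  rw [hx.refl_sub h hx', D.T_mul_s hbr (mul_mem (D.s_mem_W (Set.mem_univ i)) hx'.refl_mem_univ) h3,
    D.T_s_mul hbr hx'.refl_mem_univ h2]

/-- The relations between the `T_i`, `i ≠ 0`, and the lattice elements `X_β`. -/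
structure LatRel (t : Fin (n + 1) → G) (X : Lat n → G) : Prop where
  add : ∀ x y, X (x + y) = X x * X y
  comm : ∀ i x, i ≠ 0 → D.pr i x = 0 → t i * X x = X x * t i
  reflect : ∀ i x, i ≠ 0 → D.pr i x = -1 → t i * X x * t i = X (x + e i)

theorem LatRel.commute {D : AffineDatum n} {X : Lat n → G} (hX : D.LatRel t X) (x y : Lat n) :
    Commute (X x) (X y) := by
  change _ * _ = _ * _
  rw [← hX.add, ← hX.add, add_comm]

/-- The element `X_β T_{s_β}⁻¹` of a positive short root `β`. -/
noncomputable def Z (t : Fin (n + 1) → G) (X : Lat n → G) {x : Lat n} (hx : D.Short x) : G :=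
  X x * (D.T t (D.refl x hx.B_eq))⁻¹

variable {X : Lat n → G}

theorem Short.commute_Z {D : AffineDatum n} (hbr : D.Braids t) (hX : D.LatRel t X) {x : Lat n}
    (hx : D.Short x) {i : Fin (n + 1)} (hi : i ≠ 0) (h : D.pr i x = 0) :
    Commute (t i) (D.Z t X hx) :=
  (show Commute (t i) (X x) from hX.comm i x hi h).mul_right (hx.commute_T_refl hbr h).inv_right

/-- Both `X_β` and `T_{s_β}` arise from those of `β - α_i` by multiplying with `t i` on both sides;
in the quotient one factor cancels and a conjugation remains. -/
theorem Short.Z_sub {D : AffineDatum n} (hbr : D.Braids t) (hX : D.LatRel t X) {x : Lat n}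
    (hx : D.Short x) {i : Fin (n + 1)} (hi : i ≠ 0) (h : D.pr i x = 1)
    (hx' : D.Short (x - AffineDatum.e i)) :
    D.Z t X hx = t i * D.Z t X hx' * (t i)⁻¹ := by
  have h1 := hX.reflect i _ hi (D.add_sub_e_cases h)
  rw [sub_add_cancel] at h1
  rw [Z, Z, hx.T_refl_sub hbr h hx', ← h1]
  group

theorem Z_e (hbr : D.Braids t) {k : Fin (n + 1)} (hk : D.Short (e k)) :
    D.Z t X hk = X (e k) * (t k)⁻¹ := by
  rw [Z, refl_e, T_s D hbr]

theorem Short.d_eq_one {D : AffineDatum n} {k : Fin (n + 1)} (hk : D.Short (AffineDatum.e k)) :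
    D.d k = 1 := by
  have := hk.B_eq
  rw [B_e_self] at this
  omega

/-- Induction on the height, lowering `x` at a node `i`; the root `x - α_i` then has pairing `-1 - a
j i` with `α_j^∨`. If this is `-1`, induct; if `0`, `Z` commutes with `t j` and the braid relation
is transported through `t i`; if `1`, lower once more at `j`; if `2`, then `x - α_i = α_j` and the
claim is the identity in rank two. Simple `x` is settled by the lattice relations of two adjacent
nodes. -/
theorem Z_braid (hbr : D.Braids t) (hX : D.LatRel t X) : ∀ (N : ℕ) (x : Lat n), ht x = N →
    ∀ (hx : D.Short x) (j : Fin (n + 1)), j ≠ 0 → D.pr j x = -1 →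
    (D.d j = 1 → Braid3 (D.Z t X hx) (t j)) ∧ (D.d j = 2 → Braid4 (D.Z t X hx) (t j)) := by
  intro N
  induction N using Nat.strong_induction_on with
  | _ N ih =>
  intro x hN hx j hj hpj
  obtain ⟨i, hi, -, rfl | ⟨hpi, hne, hx'⟩⟩ := hx.exists_descent
  · have hdi := hx.d_eq_one
    rw [pr_e] at hpj
    have hsymm := D.symm j i
    rw [hpj, hdi] at hsymm
    have hij : i ≠ j := by
      rintro rfl
      rw [D.diag] at hpj
      norm_num at hpj
    rw [D.Z_e hbr hx]
    have h1 := hX.reflect j (e i) hj (by rw [pr_e, hpj])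
    constructor
    · intro hdj
      have haij : D.a i j = -1 := by omega
      refine braid3_of_lattice (hbr.three hij haij hpj) (hX.add _ _) h1 ?_
      have h2 := hX.reflect i (e j) hi (by rw [pr_e, haij])
      rw [h2, add_comm]
    · intro hdj
      have haij : D.a i j = -2 := by omega
      refine braid4_of_lattice (hbr.four hij (by rw [haij, hpj]; norm_num)) (hX.commute _ _) h1 ?_
      exact hX.comm i _ hi (by rw [pr_add, pr_e, pr_e, D.diag, haij]; norm_num)
  · have hij : i ≠ j := by
      rintro rfl
      omega
    have hht := ht_sub_e hx'.nonneg
    have hZ := hx.Z_sub hbr hX hi hpi hx'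
    have hpj' : D.pr j (x - e i) = -1 - D.a j i := by rw [pr_sub, pr_e, hpj]
    have hpi' := D.add_sub_e_cases hpi
    have hsymm := D.symm j i
    have hdi := D.d_pos i
    have hdj := D.d_pos j
    have hdi3 := D.d_le i
    have ihi := ih (ht (x - e i)) (by omega) _ rfl hx' i hi hpi'
    rw [hZ]
    rcases D.a_cases j i hij.symm with
      ⟨h1, h2⟩ | ⟨h1, h2⟩ | ⟨h1, h2⟩ | ⟨h1, h2⟩ | ⟨h1, h2⟩ | ⟨h1, h2⟩ | ⟨h1, h2⟩
    · have ihj := ih (ht (x - e i)) (by omega) _ rfl hx' j hj (by rw [hpj', h1]; norm_num)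
      have hc : t i * t j * (t i)⁻¹ = t j := (hbr.commute hij h2).conj_left_eq
      constructor
      · intro hd
        have := (ihj.1 hd).conj (t i)
        rwa [hc] at this
      · intro hd
        have := (ihj.2 hd).conj (t i)
        rwa [hc] at this
    · have hc := (hx'.commute_Z hbr hX hj (by rw [hpj', h1]; norm_num)).symm
      rw [h1, h2] at hsymm
      constructor
      · intro hd
        exact (ihi.1 (by omega)).transport hc (hbr.three hij h2 h1)
      · intro hd
        exact (ihi.2 (by omega)).transport hc (hbr.three hij h2 h1)
    · have hc := (hx'.commute_Z hbr hX hj (by rw [hpj', h1]; norm_num)).symm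
      rw [h1, h2] at hsymm
      constructor
      · intro hd
        omega
      · intro hd
        exact Braid4.transport' (ihi.1 (by omega)) hc (hbr.four hij (by rw [h1, h2]; norm_num))
    · rw [h1, h2] at hsymm
      have hpj1 : D.pr j (x - e i) = 1 := by rw [hpj', h1]; norm_num
      have hnej : x - e i ≠ e j := by
        intro h
        rw [h, pr_e, D.diag] at hpj1
        norm_num at hpj1
      have hx'' := hx'.sub_e hj hnej hpj1
      have hht' := ht_sub_e hx''.nonneg
      have ihj := ih (ht (x - e i - e j)) (by omega) _ rfl hx'' j hj (D.add_sub_e_cases hpj1)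
      have hc := (hx''.commute_Z hbr hX hi (by rw [pr_sub, hpi', pr_e, h2]; norm_num)).symm
      rw [hx'.Z_sub hbr hX hj hpj1 hx'']
      constructor
      · intro hd
        exact (ihj.1 hd).transport_four hc (hbr.four hij.symm (by rw [h1, h2]; norm_num))
      · intro hd
        omega
    -- Here symmetry of the form gives `d j = 3 d i`, so `d j` is neither `1` nor `2`.
    · have hc := (hx'.commute_Z hbr hX hj (by rw [hpj', h1]; norm_num)).symm
      rw [h1, h2] at hsymm
      constructor <;> intro hd <;> omega
    · rw [h1, h2] at hsymm
      have hxj : x - e i = e j := by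
        by_contra hnej
        have := D.pr_le_one hx'.B_eq hx'.zero hj hnej
        omega
      have hx : x = e j + e i := by rw [← hxj]; abel
      subst hx
      have hsj : D.Short (e j) := by rw [← hxj]; exact hx'
      have hZ' : D.Z t X hx' = X (e j) * (t j)⁻¹ := by
        rw [← D.Z_e hbr hsj]
        simp only [hxj]
      constructor
      · intro hd
        rw [hZ']
        have e1 := hX.reflect i (e j) hi (by rw [pr_e, h2])
        have e2 := hX.reflect j (e j + e i) hj (by rw [pr_add, pr_e, pr_e, D.diag, h1]; norm_num)
        have e3 := hX.comm i (e j + e i + e j) hi (by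
          rw [pr_add, pr_add, pr_e, pr_e, D.diag, h2]; norm_num)
        have := braid3_of_lattice_six (hbr.six hij (by rw [h1, h2]; norm_num)) (hX.add _ _) e1 e2 e3
        convert this using 1
        rw [← e1]
        group
      · intro hd
        omega
    · rcases D.lace j i hij.symm with h | h
      · rw [h1, h2] at h
        norm_num at h
      · rcases h.2.2 with h | h
        · exact absurd h hj
        · exact absurd h hi

/-- Since `d 0 = 1`, symmetry reads `a 0 j = d j * a j 0`; together with `mode`, which excludes `a 0
j = -3`, this leaves four kinds of edges at the affine node. -/
theorem a_zero_left {j : Fin (n + 1)} (hj : j ≠ 0) :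
    (D.a 0 j = 0 ∧ D.a j 0 = 0) ∨ (D.a 0 j = -1 ∧ D.a j 0 = -1 ∧ D.d j = 1) ∨
    (D.a 0 j = -2 ∧ D.a j 0 = -1 ∧ D.d j = 2) ∨ (D.a 0 j = -2 ∧ D.a j 0 = -2) := by
  have h1 := D.symm 0 j
  rw [D.d_zero, one_mul] at h1
  have h2 := D.a_cases 0 j hj.symm
  have h3 : D.a 0 j = 0 ∨ D.a 0 j = -1 ∨ D.a 0 j = -2 := by
    rcases D.mode with h | h <;> have := h j hj <;> omega
  have h4 := D.d_pos j
  have h5 := D.d_le j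
  have h6 : D.d j = 1 ∨ D.d j = 2 ∨ D.d j = 3 := by omega
  rcases h6 with h6 | h6 | h6 <;> rw [h6] at h1 <;> omega

/-- The element at the affine node may be replaced by any other one that satisfies the braid
relations with the finite part. -/
theorem Braids.update {D : AffineDatum n} (hbr : D.Braids t) {y : G}
    (h0 : ∀ j, j ≠ 0 → D.a 0 j = 0 → Commute y (t j))
    (h1 : ∀ j, j ≠ 0 → D.a 0 j = -1 → Braid3 y (t j))
    (h2 : ∀ j, j ≠ 0 → D.a 0 j = -2 → D.a j 0 = -1 → Braid4 y (t j)) :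
    D.Braids (Function.update t 0 y) := by
  have key : ∀ j, j ≠ 0 → altProd (D.len 0 j) y (t j) = altProd (D.len 0 j) (t j) y := by
    intro j hj
    rcases D.a_zero_left hj with ⟨h3, h4⟩ | ⟨h3, h4, hd⟩ | ⟨h3, h4, hd⟩ | ⟨h3, h4⟩
    · simpa [len, h3, altProd] using (h0 j hj h3).eq
    · simpa [len, h3, h4, altProd, Braid3, mul_assoc] using h1 j hj h3
    · simpa [len, h3, h4, altProd, Braid4, mul_assoc] using h2 j hj h3 h4
    · simp [len, h3, h4, altProd]
  have hlen : ∀ i j, D.len i j = D.len j i := by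
    intro i j
    simp only [len, mul_comm]
  intro i j hij
  by_cases hi : i = 0
  · subst hi
    rw [Function.update_self, Function.update_of_ne hij.symm]
    exact key j hij.symm
  · by_cases hj : j = 0
    · subst hj
      rw [Function.update_self, Function.update_of_ne hij, hlen]
      exact (key i hij).symm
    · rw [Function.update_of_ne hi, Function.update_of_ne hj]
      exact hbr i j hij

theorem a_right_of_single {j : Fin (n + 1)} (hj : j ≠ 0) (h : D.a 0 j = -1) :
    D.a j 0 = -1 ∧ D.d j = 1 := by
  rcases D.a_zero_left hj with h1 | h1 | h1 | h1 <;> omega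

theorem d_of_double {j : Fin (n + 1)} (hj : j ≠ 0) (h : D.a 0 j = -2) (h' : D.a j 0 = -1) :
    D.d j = 2 := by
  rcases D.a_zero_left hj with h1 | h1 | h1 | h1 <;> omega

theorem pr_th_of_neighbour {j : Fin (n + 1)} (h : D.a j 0 = -1) : D.pr j D.th = 1 := by
  rw [pr_th, h]; norm_num

theorem th_ne_e {j : Fin (n + 1)} (h : D.a j 0 = -1) : D.th ≠ e j := by
  intro h1
  have := D.pr_th_of_neighbour h
  rw [h1, pr_e, D.diag] at this
  norm_num at this

theorem short_th_sub {j : Fin (n + 1)} (hj : j ≠ 0) (h : D.a j 0 = -1) :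
    D.Short (D.th - e j) :=
  D.short_th.sub_e hj (D.th_ne_e h) (D.pr_th_of_neighbour h)

theorem braid3_Z_th (hbr : D.Braids t) (hX : D.LatRel t X) {j : Fin (n + 1)} (hj : j ≠ 0)
    (h : D.a 0 j = -1) : Braid3 (X D.th * (D.T t D.sth)⁻¹) (t j) := by
  obtain ⟨h2, hd⟩ := D.a_right_of_single hj h
  have hpr := D.pr_th_of_neighbour h2
  have hx' := D.short_th_sub hj h2
  have h3 := ((D.Z_braid hbr hX _ _ rfl hx' j hj (D.add_sub_e_cases hpr)).1 hd).conj (t j)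
  rwa [← D.short_th.Z_sub hbr hX hj hpr hx', mul_inv_cancel_right] at h3

theorem braid4_Z_th (hbr : D.Braids t) (hX : D.LatRel t X) {j : Fin (n + 1)} (hj : j ≠ 0)
    (h : D.a 0 j = -2) (h' : D.a j 0 = -1) : Braid4 (X D.th * (D.T t D.sth)⁻¹) (t j) := by
  have hpr := D.pr_th_of_neighbour h'
  have hx' := D.short_th_sub hj h'
  have h3 := ((D.Z_braid hbr hX _ _ rfl hx' j hj (D.add_sub_e_cases hpr)).2
    (D.d_of_double hj h h')).conj (t j)
  rwa [← D.short_th.Z_sub hbr hX hj hpr hx', mul_inv_cancel_right] at h3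

theorem commute_Z_th (hbr : D.Braids t) (hX : D.LatRel t X) {j : Fin (n + 1)} (hj : j ≠ 0)
    (h : D.a 0 j = 0) : Commute (X D.th * (D.T t D.sth)⁻¹) (t j) :=
  (D.short_th.commute_Z hbr hX hj (by rw [pr_th, (D.a_eq_zero_iff 0 j).1 h, neg_zero])).symm

end

end AffineDatum

/-! ### Conjugation by powers of the lift of `s_θ` -/

namespace AffineDatum

variable {n : ℕ} (D : AffineDatum n)

/-- The non-affine nodes that are not joined to the affine node. -/
def J : Set (Fin (n + 1)) := {j | j ≠ 0 ∧ D.a 0 j = 0}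

theorem pr_th_of_mem_J {j : Fin (n + 1)} (hj : j ∈ D.J) : D.pr j D.th = 0 := by
  rw [pr_th, (D.a_eq_zero_iff 0 j).1 hj.2, neg_zero]

theorem W_J_th {u : Lat n ≃ₗ[ℤ] Lat n} (hu : u ∈ D.W D.J) : u D.th = D.th := by
  refine D.W_induction_left (p := fun u => u D.th = D.th) rfl ?_ hu
  intro w i _ hi h
  rw [LinearEquiv.mul_apply, h, s_apply, D.pr_th_of_mem_J hi, zero_smul, sub_zero]

theorem W_apply_of_notMem {I : Set (Fin (n + 1))} {u : Lat n ≃ₗ[ℤ] Lat n} (hu : u ∈ D.W I)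
    {i : Fin (n + 1)} (hi : i ∉ I) (x : Lat n) : u x i = x i := by
  refine D.W_induction_left (p := fun u => u x i = x i) rfl ?_ hu
  intro w k _ hk h
  rw [LinearEquiv.mul_apply, s_apply_ne D (by rintro rfl; exact hi hk), h]

/-- If all neighbours of the affine node are joined to it by one lace, the short roots `β` with
`(β, θ^∨) = 1` are conjugate to such neighbours under the stabilizer of `θ`. -/
theorem exists_neighbour (hs : ∀ j, j ≠ 0 → D.a 0 j = 0 ∨ D.a 0 j = -1) :
    ∀ (N : ℕ) (x : Lat n), ht x = N → D.Short x → D.pr 0 x = -1 →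
    ∃ u ∈ D.W D.J, ∃ k, k ≠ 0 ∧ D.a 0 k = -1 ∧ x = u (e k) := by
  intro N
  induction N using Nat.strong_induction_on with
  | _ N ih =>
  intro x hN hx hp
  by_cases hex : ∃ j ∈ D.J, 0 < D.pr j x
  · obtain ⟨j, hj, hjx⟩ := hex
    have hne : x ≠ e j := by
      rintro rfl
      rw [pr_e, hj.2] at hp
      norm_num at hp
    have hpj : D.pr j x = 1 := by
      have := D.pr_le_one hx.B_eq hx.zero hj.1 hne
      omega
    have hx' := hx.sub_e hj.1 hne hpj
    have hht := ht_sub_e hx'.nonneg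
    obtain ⟨u, hu, k, hk, hk1, hxu⟩ := ih _ (by omega) _ rfl hx' (by
      rw [pr_sub, hp, pr_e, hj.2, sub_zero])
    refine ⟨D.s j * u, mul_mem (D.s_mem_W hj) hu, k, hk, hk1, ?_⟩
    rw [LinearEquiv.mul_apply, ← hxu, s_apply, D.add_sub_e_cases hpj]
    module
  -- Suppose that `x` pairs nonpositively with all coroots of `J`. The descent is then at a
  -- neighbour `i`, and `(x, α_0^∨) = -1` forces `x_i = 1` with zero coordinate at every other
  -- neighbour. If `x ≠ α_i`, the norm would be at most `x_i (x, α_i^∨) = 1` instead of `2`.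
  · push Not at hex
    obtain ⟨i, hi, hxi, hcase⟩ := hx.exists_descent
    have hpi0 : 0 < D.pr i x := by
      rcases hcase with h | ⟨h, -, -⟩
      · rw [h, pr_e, D.diag]; norm_num
      · omega
    have hai : D.a 0 i = -1 := (hs i hi).resolve_left fun h => by
      have := hex i ⟨hi, h⟩
      omega
    rcases hcase with h | ⟨hpi, -, -⟩
    · exact ⟨1, one_mem _, i, hi, hai, h⟩
    · exfalso
      have hterm : ∀ j, D.a 0 j * x j ≤ 0 := by
        intro j
        by_cases hj : j = 0
        · rw [hj, hx.zero, mul_zero]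
        · exact mul_nonpos_of_nonpos_of_nonneg (D.off 0 j (Ne.symm hj)) (hx.nonneg j)
      rw [pr_apply, ← Finset.add_sum_erase _ _ (Finset.mem_univ i), hai] at hp
      have hrest : ∑ j ∈ Finset.univ.erase i, D.a 0 j * x j ≤ 0 :=
        Finset.sum_nonpos fun j _ => hterm j
      have hxi1 : x i = 1 := by omega
      have hrest0 : ∑ j ∈ Finset.univ.erase i, D.a 0 j * x j = 0 := by omega
      rw [Finset.sum_eq_zero_iff_of_nonpos fun j _ => hterm j] at hrest0
      have hB := hx.B_eq
      rw [B_apply, ← Finset.add_sum_erase _ _ (Finset.mem_univ i), hxi1, hpi,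
        (D.a_right_of_single hi hai).2] at hB
      have hle : ∑ j ∈ Finset.univ.erase i, D.d j * (x j * D.pr j x) ≤ 0 := by
        refine Finset.sum_nonpos fun j hj => ?_
        by_cases hj0 : j = 0
        · rw [hj0, hx.zero, zero_mul, mul_zero]
        · rcases hs j hj0 with h | h
          · have h1 := hex j ⟨hj0, h⟩
            have h2 := D.d_pos j
            have h3 := mul_nonpos_of_nonneg_of_nonpos (hx.nonneg j) h1
            exact mul_nonpos_of_nonneg_of_nonpos (by omega) h3
          · have h1 := hrest0 j hj
            rw [h] at h1
            have h2 : x j = 0 := by omega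
            rw [h2, zero_mul, mul_zero]
      omega

section

variable {G : Type*} [Group G] {t : Fin (n + 1) → G}

/-- A positive root made negative by `u` has image supported on `J`, because `u` leaves the other
coordinates alone. Such an image is orthogonal to `θ` and fixed by `s_θ`. -/
theorem T_sth_mul (hbr : D.Braids t) {u : Lat n ≃ₗ[ℤ] Lat n} (hu : u ∈ D.W D.J) :
    D.T t (D.sth * u) = D.T t D.sth * D.T t u := by
  refine D.T_mul hbr D.sth_mem (D.W_mono (Set.subset_univ _) hu) ?_
  intro x hx h0 h1
  have h2 : ∀ i, i ∉ D.J → u x i = 0 := by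
    intro i hi
    have h3 := h1 i
    have h4 := h0 i
    have h5 := D.W_apply_of_notMem hu hi x
    simp only [Pi.zero_apply] at h3 h4
    omega
  have h3 : D.pr 0 (u x) = 0 := by
    rw [pr_apply]
    refine Finset.sum_eq_zero fun i _ => ?_
    by_cases hi : i ∈ D.J
    · rw [hi.2, zero_mul]
    · rw [h2 i hi, mul_zero]
  rw [sth_apply, B_th, h3, neg_zero, zero_smul, sub_zero]
  exact h1

theorem commute_T_sth (hbr : D.Braids t) {g : G} (hg : g ∈ Subgroup.closure (t '' D.J)) :
    Commute (D.T t D.sth) g := by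
  have : Subgroup.closure (t '' D.J) ≤ Subgroup.centralizer {D.T t D.sth} := by
    rw [Subgroup.closure_le]
    rintro _ ⟨j, hj, rfl⟩
    rw [SetLike.mem_coe, Subgroup.mem_centralizer_singleton_iff]
    exact (D.short_th.commute_T_refl hbr (D.pr_th_of_mem_J hj)).eq
  have h := this hg
  rw [Subgroup.mem_centralizer_singleton_iff] at h
  exact h.symm

/-- The element `v = s_θ u` sends `α_k` to `-α_i`, since `s_θ (θ - α_i) = -α_i`. Hence `s_i v = v
s_k`, and `v` is one step longer than this element; adding the step on the left by `t i` or on the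
right by `t k` gives the same lift. -/
theorem T_sth_conj_aux (hbr : D.Braids t) {i k : Fin (n + 1)} (hai : D.a 0 i = -1)
    {u : Lat n ≃ₗ[ℤ] Lat n} (hu : u ∈ D.W D.J) (h : D.th - e i = u (e k)) :
    t i * (D.T t D.sth * D.T t u) = D.T t D.sth * D.T t u * t k := by
  have hmem : D.sth * u ∈ D.W Set.univ :=
    mul_mem D.sth_mem (D.W_mono (Set.subset_univ _) hu)
  have h1 : (D.sth * u) (e k) = -e i := by
    rw [LinearEquiv.mul_apply, ← h, sth_apply, B_sub, B_th_th, B_th, pr_e, hai]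
    module
  have h2 : D.T t (D.sth * u * D.s k) = D.T t (D.sth * u) * (t k)⁻¹ :=
    D.T_mul_s_neg hbr hmem (by rw [h1]; exact neg_nonpos.2 (e_nonneg i))
  have hmem' := mul_mem hmem (D.s_mem_W (Set.mem_univ k))
  have h3 : (D.sth * u * D.s k)⁻¹ (e i) = e k := by
    have h4 : (D.sth * u * D.s k) (e k) = e i := by
      rw [mul_s_e_self, h1, neg_neg]
    rw [← h4, ← LinearEquiv.mul_apply, inv_mul_cancel]
    rfl
  have h4 : D.s i * (D.sth * u * D.s k) = D.sth * u := by
    have h5 : D.s i * (D.sth * u) = D.sth * u * D.s k := by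
      have hd : D.d k = D.d i := by
        have := D.B_W hmem (e k) (e k)
        rw [h1, map_neg, LinearMap.map_neg, LinearMap.neg_apply, neg_neg, B_e_self,
          B_e_self] at this
        omega
      ext1 x
      have h6 : D.pr i ((D.sth * u) x) = -D.pr k x := by
        have := D.B_W hmem x (e k)
        rw [h1, map_neg, B_e, B_e, hd] at this
        have h7 := D.d_ne i
        have h8 : D.d i * D.pr i ((D.sth * u) x) = D.d i * -D.pr k x := by
          rw [mul_neg, ← this, neg_neg]
        exact mul_left_cancel₀ h7 h8
      rw [LinearEquiv.mul_apply, s_apply, h6, LinearEquiv.mul_apply _ (D.s k), s_apply, map_sub,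
        map_smul, h1]
      module
    rw [← h5, ← mul_assoc, s_mul_s, one_mul]
  have h5 := D.T_s_mul hbr hmem' (i := i) (by rw [h3]; exact e_nonneg k)
  rw [h4, h2, ← mul_assoc, eq_mul_inv_iff_mul_eq, D.T_sth_mul hbr hu] at h5
  exact h5.symm

/-- Conjugation by powers of `T_{s_θ}` takes a neighbour of the affine node to a neighbour, up to
conjugation by elements of the parabolic subgroup fixing `θ`. -/
theorem conj_zpow_T_sth (hbr : D.Braids t) (hs : ∀ j, j ≠ 0 → D.a 0 j = 0 ∨ D.a 0 j = -1) (N : ℤ) :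
    ∀ i, i ≠ 0 → D.a 0 i = -1 → ∃ g ∈ Subgroup.closure (t '' D.J), ∃ k, k ≠ 0 ∧ D.a 0 k = -1 ∧
      D.T t D.sth ^ N * t i * D.T t D.sth ^ (-N) = g * t k * g⁻¹ := by
  have hback : ∀ i, i ≠ 0 → D.a 0 i = -1 → ∃ g ∈ Subgroup.closure (t '' D.J), ∃ k, k ≠ 0 ∧
      D.a 0 k = -1 ∧ (D.T t D.sth)⁻¹ * t i * D.T t D.sth = g * t k * g⁻¹ ∧
      ∃ g' ∈ Subgroup.closure (t '' D.J),
        D.T t D.sth * t i * (D.T t D.sth)⁻¹ = g' * t k * g'⁻¹ := by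
    intro i hi hai
    have hi0 := (D.a_right_of_single hi hai).1
    obtain ⟨u, hu, k, hk, hak, h⟩ := D.exists_neighbour hs _ _ rfl (D.short_th_sub hi hi0) (by
      rw [pr_sub, pr_th, D.diag, pr_e, hai]; norm_num)
    have h1 := D.T_sth_conj_aux hbr hai hu h
    -- The relation between `i` and `k` is symmetric because `u` fixes `θ`; this yields conjugation
    -- in the opposite direction.
    have h' : D.th - e k = u⁻¹ (e i) := by
      have h2 := D.W_J_th hu
      have h3 : e i = u (D.th - e k) := by rw [map_sub, h2, ← h, sub_sub_cancel]
      rw [h3, ← LinearEquiv.mul_apply, inv_mul_cancel]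
      rfl
    have h2 := D.T_sth_conj_aux hbr hak (inv_mem hu) h'
    refine ⟨_, D.T_mem_closure hbr hu, k, hk, hak, ?_, (D.T t u⁻¹)⁻¹,
      inv_mem (D.T_mem_closure hbr (inv_mem hu)), ?_⟩
    · rw [eq_mul_inv_iff_mul_eq, mul_assoc, mul_assoc, inv_mul_eq_iff_eq_mul, h1,
        mul_assoc]
    · have h3 := (D.commute_T_sth hbr (D.T_mem_closure hbr (inv_mem hu))).eq
      rw [h3] at h2
      have h4 : t k = D.T t u⁻¹ * D.T t D.sth * t i * (D.T t D.sth)⁻¹ * (D.T t u⁻¹)⁻¹ := by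
        rw [← h2]; group
      rw [h4]
      group
  have hcomm : ∀ (M : ℤ) g, g ∈ Subgroup.closure (t '' D.J) →
      Commute (D.T t D.sth ^ M) g := fun M g hg => (D.commute_T_sth hbr hg).zpow_left M
  set Θ := D.T t D.sth with hΘ
  induction N using Int.induction_on with
  | zero => intro i hi hai; exact ⟨1, one_mem _, i, hi, hai, by simp⟩
  | succ N ih =>
    intro i hi hai
    obtain ⟨_, -, k, hk, hak, -, g', hg', h⟩ := hback i hi hai
    obtain ⟨g, hg, l, hl, hal, h'⟩ := ih k hk hak
    refine ⟨g' * g, mul_mem hg' hg, l, hl, hal, ?_⟩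
    have h1 := (hcomm N g' hg').eq
    have h2 := ((hcomm (-N) g' hg').inv_right).eq
    calc Θ ^ ((N : ℤ) + 1) * t i * Θ ^ (-((N : ℤ) + 1))
        = Θ ^ (N : ℤ) * (Θ * t i * Θ⁻¹) * Θ ^ (-(N : ℤ)) := by group
      _ = (Θ ^ (N : ℤ) * g') * t k * (g'⁻¹ * Θ ^ (-(N : ℤ))) := by rw [h]; group
      _ = g' * (Θ ^ (N : ℤ) * t k * Θ ^ (-(N : ℤ))) * g'⁻¹ := by rw [h1, ← h2]; group
      _ = (g' * g) * t l * (g' * g)⁻¹ := by rw [h']; group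
  | pred N ih =>
    intro i hi hai
    obtain ⟨g', hg', k, hk, hak, h, -⟩ := hback i hi hai
    obtain ⟨g, hg, l, hl, hal, h'⟩ := ih k hk hak
    refine ⟨g' * g, mul_mem hg' hg, l, hl, hal, ?_⟩
    have h1 := (hcomm (-N) g' hg').eq
    have h2 := ((hcomm N g' hg').inv_right).eq
    calc Θ ^ (-(N : ℤ) - 1) * t i * Θ ^ (-(-(N : ℤ) - 1))
        = Θ ^ (-(N : ℤ)) * (Θ⁻¹ * t i * Θ) * Θ ^ (N : ℤ) := by group
      _ = (Θ ^ (-(N : ℤ)) * g') * t k * (g'⁻¹ * Θ ^ (N : ℤ)) := by rw [h]; group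
      _ = g' * (Θ ^ (-(N : ℤ)) * t k * Θ ^ (- -(N : ℤ))) * g'⁻¹ := by rw [h1, ← h2]; group
      _ = (g' * g) * t l * (g' * g)⁻¹ := by rw [h']; group

theorem commute_of_mem_closure {I : Set (Fin (n + 1))} {y : G} (hJ : ∀ j ∈ I, Commute y (t j))
    {g : G} (hg : g ∈ Subgroup.closure (t '' I)) : Commute y g := by
  have : Subgroup.closure (t '' I) ≤ Subgroup.centralizer {y} := by
    rw [Subgroup.closure_le]
    rintro _ ⟨j, hj, rfl⟩
    rw [SetLike.mem_coe, Subgroup.mem_centralizer_singleton_iff]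
    exact (hJ j hj).eq.symm
  have h := this hg
  rw [Subgroup.mem_centralizer_singleton_iff] at h
  exact h.symm

/-- The conjugated generator is `g t_k g⁻¹` with `k` a neighbour of the affine node and `g` in the
subgroup generated by `t '' J`. As `y` commutes with `g`, its braid relation with `t k` is simply
conjugated. -/
theorem braid3_conj_zpow (hbr : D.Braids t) (hs : ∀ j, j ≠ 0 → D.a 0 j = 0 ∨ D.a 0 j = -1) {y : G}
    (hJ : ∀ j ∈ D.J, Commute y (t j)) (hN : ∀ j, j ≠ 0 → D.a 0 j = -1 → Braid3 y (t j))
    {i : Fin (n + 1)} (hi : i ≠ 0) (hai : D.a 0 i = -1) (N : ℤ) :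
    Braid3 y (D.T t D.sth ^ N * t i * D.T t D.sth ^ (-N)) := by
  obtain ⟨g, hg, k, hk, hak, h⟩ := D.conj_zpow_T_sth hbr hs N i hi hai
  have h1 := (hN k hk hak).conj g
  rw [(commute_of_mem_closure hJ hg).symm.conj_left_eq] at h1
  rwa [h]

end

end AffineDatum

/-! ### The triple relations in the double affine Artin group -/

namespace AffineDatum

variable {n : ℕ} (D : AffineDatum n)

/-- Row `0` of the null equation reads `2 = 2 m_i + ⋯` with nonnegative remaining terms and `m_i ≥
1`; hence `m_i = 1` and there is no other neighbour. -/
theorem unique_of_double {i : Fin (n + 1)} (hi : i ≠ 0) (h : D.a 0 i = -2) :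
    D.m i = 1 ∧ ∀ j, j ≠ 0 → j ≠ i → D.a 0 j = 0 := by
  have h0 := D.null 0
  have hterm : ∀ j, j ≠ 0 → D.a 0 j * D.m j ≤ 0 := fun j hj => by
    have := D.m_pos j
    exact mul_nonpos_of_nonpos_of_nonneg (D.off 0 j (Ne.symm hj)) (by omega)
  rw [← Finset.add_sum_erase _ _ (Finset.mem_univ 0), D.diag, D.m_zero,
    ← Finset.add_sum_erase _ _ (Finset.mem_erase.2 ⟨hi, Finset.mem_univ i⟩), h] at h0
  have hrest : ∀ j ∈ (Finset.univ.erase (0 : Fin (n + 1))).erase i, D.a 0 j * D.m j ≤ 0 := by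
    intro j hj
    exact hterm j (Finset.ne_of_mem_erase (Finset.mem_of_mem_erase hj))
  have h1 := Finset.sum_nonpos hrest
  have h2 := D.m_pos i
  have h3 : D.m i = 1 := by omega
  refine ⟨h3, fun j hj hji => ?_⟩
  have h4 : ∑ j ∈ (Finset.univ.erase (0 : Fin (n + 1))).erase i, D.a 0 j * D.m j = 0 := by
    rw [h3] at h0; omega
  rw [Finset.sum_eq_zero_iff_of_nonpos hrest] at h4
  have h5 := h4 j (by simp [hj, hji])
  exact (mul_eq_zero.1 h5).resolve_right (D.m_ne j)

theorem single_of_neighbour {i : Fin (n + 1)} (hi : i ≠ 0) (h : D.a 0 i = -1) :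
    ∀ j, j ≠ 0 → D.a 0 j = 0 ∨ D.a 0 j = -1 := by
  rcases D.mode with h1 | h1
  · exact h1
  · have := h1 i hi
    omega

section

variable {G : Type*} [Group G] {t : Fin (n + 1) → G} {X : Lat n → G}

/-- The relations between the `T_i` and the lattice elements in the double affine Artin group. -/
structure DoubleLat (t : Fin (n + 1) → G) (X : Lat n → G) : Prop where
  add : ∀ x y, X (x + y) = X x * X y
  central : ∀ i, Commute (X D.m) (t i)
  comm : ∀ i x, D.pr i x = 0 → t i * X x = X x * t i
  reflect : ∀ i x, D.pr i x = -1 → t i * X x * t i = X (x + e i)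

theorem DoubleLat.latRel {D : AffineDatum n} (hX : D.DoubleLat t X) : D.LatRel t X :=
  ⟨hX.add, fun i x _ => hX.comm i x, fun i x _ => hX.reflect i x⟩

theorem DoubleLat.commute {D : AffineDatum n} (hX : D.DoubleLat t X) (x y : Lat n) :
    Commute (X x) (X y) := hX.latRel.commute x y

theorem DoubleLat.braids_two {D : AffineDatum n} (hbr : D.Braids t) (hX : D.DoubleLat t X) :
    D.Braids (Function.update t 0 ((t 0)⁻¹ * X (e 0))) := by
  refine hbr.update ?_ ?_ ?_
  · intro j hj h
    exact (hbr.commute hj.symm h).inv_left.mul_left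
      (show Commute (t j) _ from hX.comm j _ (by rw [pr_e, (D.a_eq_zero_iff 0 j).1 h])).symm
  · intro j hj h
    have h' := (D.a_right_of_single hj h).1
    exact braid3_of_lattice' (hbr.three hj.symm h h') (hX.add _ _)
      (by rw [hX.reflect j _ (by rw [pr_e, h']), add_comm]) (hX.reflect 0 _ (by rw [pr_e, h]))
  · intro j hj h h'
    exact braid4_of_lattice' (hbr.four hj.symm (by rw [h, h']; norm_num)) (hX.commute _ _)
      (hX.reflect j _ (by rw [pr_e, h']))
      (hX.comm 0 _ (by rw [pr_add, pr_e, pr_e, D.diag, h]; norm_num))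

theorem DoubleLat.braids_three {D : AffineDatum n} (hbr : D.Braids t) (hX : D.DoubleLat t X) :
    D.Braids (Function.update t 0 (X D.th * (D.T t D.sth)⁻¹)) :=
  hbr.update (fun _ hj h => D.commute_Z_th hbr hX.latRel hj h)
    (fun _ hj h => D.braid3_Z_th hbr hX.latRel hj h)
    (fun _ hj h h' => D.braid4_Z_th hbr hX.latRel hj h h')

theorem DoubleLat.prod_eq {D : AffineDatum n} (hX : D.DoubleLat t X) (g : G) :
    t 0 * ((t 0)⁻¹ * X (e 0)) * (X D.th * g) = X D.m * g := by
  rw [mul_inv_cancel_left, ← mul_assoc, ← hX.add, D.m_eq, add_comm]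

/-- Since `d = X_δ T_{s_θ}⁻¹` with `X_δ` commuting with everything involved, conjugation by `d ^ k`
is conjugation by `T_{s_θ} ^ (-k)`, and `braid3_conj_zpow` covers the first four choices of `y`, the
fourth being `X_{α_0} T_0⁻¹`. The fifth is its conjugate by `d⁻¹`, which only shifts `k`. -/
theorem DoubleLat.single {D : AffineDatum n} (hbr : D.Braids t) (hX : D.DoubleLat t X)
    {i : Fin (n + 1)} (hi : i ≠ 0) (hai : D.a 0 i = -1) (k : ℤ) (b c d y : G)
    (hb : b = (t 0)⁻¹ * X (e 0)) (hc : c = X D.th * (D.T t D.sth)⁻¹) (hd : d = t 0 * b * c)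
    (hy : y = t 0 ∨ y = b ∨ y = c ∨ y = t 0 * b * (t 0)⁻¹ ∨ y = c⁻¹ * b * c) :
    Braid3 y (d ^ k * t i * d ^ (-k)) := by
  have hs := D.single_of_neighbour hi hai
  have hcl : D.T t D.sth ∈ Subgroup.closure (t '' Set.univ) := D.T_mem_closure hbr D.sth_mem
  have hXT : Commute (X D.m) (D.T t D.sth) := commute_of_mem_closure (fun j _ => hX.central j) hcl
  have hd' : d = X D.m * (D.T t D.sth)⁻¹ := by rw [hd, hb, hc, hX.prod_eq]
  have hx : ∀ k : ℤ, d ^ k * t i * d ^ (-k) =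
      D.T t D.sth ^ (-k) * t i * D.T t D.sth ^ (- -k) := by
    intro k
    have h1 : ∀ k : ℤ, d ^ k = X D.m ^ k * D.T t D.sth ^ (-k) := by
      intro k
      rw [hd', hXT.inv_right.mul_zpow, inv_zpow, zpow_neg]
    have h2 : Commute (X D.m ^ (-k)) (D.T t D.sth ^ (- -k)) := (hXT.zpow_left _).zpow_right _
    have h3 : Commute (X D.m ^ k) (D.T t D.sth ^ (-k) * t i * D.T t D.sth ^ (- -k)) :=
      ((((hXT.zpow_right _).mul_right (hX.central i)).mul_right (hXT.zpow_right _))).zpow_left _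
    rw [h1, h1 (-k), h2.eq]
    calc X D.m ^ k * D.T t D.sth ^ (-k) * t i * (D.T t D.sth ^ (- -k) * X D.m ^ (-k))
        = X D.m ^ k * (D.T t D.sth ^ (-k) * t i * D.T t D.sth ^ (- -k)) * X D.m ^ (-k) := by
          simp only [mul_assoc]
      _ = _ := by rw [h3.eq, mul_assoc, ← zpow_add, add_neg_cancel, zpow_zero, mul_one]
  have hfour : ∀ k : ℤ, Braid3 (X (e 0) * (t 0)⁻¹) (d ^ k * t i * d ^ (-k)) := by
    intro k
    rw [hx]
    refine D.braid3_conj_zpow hbr hs ?_ ?_ hi hai _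
    · intro j hj
      exact (show Commute (t j) _ from
        hX.comm j _ (by rw [pr_e, (D.a_eq_zero_iff 0 j).1 hj.2])).symm.mul_left
        (hbr.commute hj.1.symm hj.2).inv_left
    · intro j hj h
      have h' := (D.a_right_of_single hj h).1
      exact braid3_of_lattice (hbr.three hj.symm h h') (hX.add _ _)
        (hX.reflect j _ (by rw [pr_e, h']))
        (by rw [hX.reflect 0 _ (by rw [pr_e, h]), add_comm])
  rcases hy with rfl | rfl | rfl | rfl | rfl
  · rw [hx]
    exact D.braid3_conj_zpow hbr hs (fun j hj => hbr.commute hj.1.symm hj.2)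
      (fun j hj h => hbr.three hj.symm h (D.a_right_of_single hj h).1) hi hai _
  · rw [hx, hb]
    have h2 := hX.braids_two hbr
    refine D.braid3_conj_zpow hbr hs (fun j hj => ?_) (fun j hj h => ?_) hi hai _
    · have := h2.commute hj.1.symm hj.2
      rwa [Function.update_self, Function.update_of_ne hj.1] at this
    · have := h2.three hj.symm h (D.a_right_of_single hj h).1
      rwa [Function.update_self, Function.update_of_ne hj] at this
  · rw [hx, hc]
    exact D.braid3_conj_zpow hbr hs (fun j hj => D.commute_Z_th hbr hX.latRel hj.1 hj.2)
      (fun j hj h => D.braid3_Z_th hbr hX.latRel hj h) hi hai _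
  · rw [hb, mul_inv_cancel_left]
    exact hfour k
  · have h1 := (hfour (k + 1)).conj d⁻¹
    have h2 : d⁻¹ * (X (e 0) * (t 0)⁻¹) * d⁻¹⁻¹ = c⁻¹ * b * c := by
      have : X (e 0) = t 0 * b := by rw [hb, mul_inv_cancel_left]
      rw [this, hd]; group
    have h3 : d⁻¹ * (d ^ (k + 1) * t i * d ^ (-(k + 1))) * d⁻¹⁻¹ = d ^ k * t i * d ^ (-k) := by
      group
    rwa [h2, h3] at h1

/-- The conjugate of `c` is `Z_{θ - α_i}`, where `θ - α_i` is supported on `J` because `m_i = 1`,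
and pairs to zero with `α_0^∨`. The conjugate of `b` is `(T_i T_0 T_i)⁻¹ X_{α_0 + α_i}`; here `T_0`
commutes with the first factor by the braid relation of length four and with the second because the
pairing is zero. -/
theorem DoubleLat.double {D : AffineDatum n} (hbr : D.Braids t) (hX : D.DoubleLat t X)
    {i : Fin (n + 1)} (hi : i ≠ 0) (h : D.a 0 i = -2) (h' : D.a i 0 = -1) (b c : G)
    (hb : b = (t 0)⁻¹ * X (e 0)) (hc : c = X D.th * (D.T t D.sth)⁻¹) :
    Commute (t 0) ((t i)⁻¹ * b * t i) ∧ Commute (t 0) ((t i)⁻¹ * c * t i) ∧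
      Commute b ((t i)⁻¹ * c * t i) := by
  obtain ⟨hm, hJ⟩ := D.unique_of_double hi h
  have hpr := D.pr_th_of_neighbour h'
  have hs := D.short_th_sub hi h'
  have hZ := D.short_th.Z_sub hbr hX.latRel hi hpr hs
  have hcZ : (t i)⁻¹ * c * t i = D.Z t X hs := by
    have : c = D.Z t X D.short_th := hc
    rw [this, hZ]; group
  have hsupp : D.T t (D.refl (D.th - e i) hs.B_eq) ∈ Subgroup.closure (t '' D.J) := by
    refine D.T_mem_closure hbr (hs.refl_mem fun j hj => ?_)
    have hj0 : j ≠ 0 := by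
      rintro rfl
      exact hj hs.zero
    refine ⟨hj0, hJ j hj0 ?_⟩
    rintro rfl
    rw [Pi.sub_apply, D.th_ne hj0, hm, e_self] at hj
    exact hj rfl
  have hfour := hbr.four hi.symm (by rw [h, h']; norm_num)
  have h0Z : Commute (t 0) (D.Z t X hs) := by
    refine Commute.mul_right (hX.comm 0 _ ?_) (Commute.inv_right ?_)
    · rw [pr_sub, pr_th, D.diag, pr_e, h]; norm_num
    · exact commute_of_mem_closure (fun j hj => hbr.commute hj.1.symm hj.2) hsupp
  have hXZ : Commute (X (e 0)) (D.Z t X hs) := by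
    refine (hX.commute _ _).mul_right (Commute.inv_right ?_)
    refine commute_of_mem_closure (fun j hj => ?_) hsupp
    exact (show Commute (t j) _ from
        hX.comm j _ (by rw [pr_e, (D.a_eq_zero_iff 0 j).1 hj.2])).symm
  refine ⟨?_, ?_, ?_⟩
  · have h1 : (t i)⁻¹ * b * t i = (t i * t 0 * t i)⁻¹ * X (e 0 + e i) := by
      rw [← hX.reflect i _ (by rw [pr_e, h']), hb]; group
    rw [h1]
    refine Commute.mul_right (Commute.inv_right ?_) (hX.comm 0 _ ?_)
    · change t 0 * (t i * t 0 * t i) = t i * t 0 * t i * t 0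
      rw [← hfour]
      simp only [mul_assoc]
    · rw [pr_add, pr_e, pr_e, D.diag, h]; norm_num
  · rw [hcZ]; exact h0Z
  · rw [hcZ, hb]; exact h0Z.inv_left.mul_left hXZ

end

end AffineDatum

/-! ### The double affine relations from the triple relations -/

namespace AffineDatum

variable {n : ℕ} (D : AffineDatum n)

/-- The vector `θ - α_i` has norm `2 + 2 - 4 = 0` and affine coordinate `0`, hence `θ = α_i`. -/
theorem eq_e_zero_add_of_four {i : Fin (n + 1)} (hi : i ≠ 0) (h : D.a 0 i = -2)
    (h' : D.a i 0 = -2) : e 0 + e i = D.m := by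
  have hd : D.d i = 1 := by
    have := D.symm 0 i
    rw [h, h', D.d_zero] at this
    omega
  have h1 : D.B (D.th - e i) (D.th - e i) = 0 := by
    rw [B_sub, B_sub_left, B_sub_left, B_th_th, B_e_self, B_e, B_e_left, pr_th, h', hd]
    norm_num
  have hc := D.eq_smul_of_B_eq_zero _ h1
  rw [Pi.sub_apply, th_zero, e_ne hi.symm, sub_zero, zero_smul, sub_eq_zero] at hc
  rw [← hc, D.m_eq, add_comm (e 0)]

section

variable {G : Type*} [Group G] {t : Fin (n + 1) → G} {X : Lat n → G}

/-- The lattice elements `β` for which `X_β` commutes with a given element. -/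
def commuting (hX : ∀ x y, X (x + y) = X x * X y) (y : G) : AddSubgroup (Lat n) where
  carrier := {x | Commute y (X x)}
  zero_mem' := by
    have : X 0 = 1 := by
      have := hX 0 0
      rwa [add_zero, left_eq_mul] at this
    change Commute y (X 0)
    rw [this]
    exact Commute.one_right y
  add_mem' := fun {u v} hu hv => by
    change Commute y (X (u + v))
    rw [hX]
    exact Commute.mul_right hu hv
  neg_mem' := fun {u} hu => by
    have h0 : X 0 = 1 := by
      have := hX 0 0
      rwa [add_zero, left_eq_mul] at this
    have h1 : X (-u) = (X u)⁻¹ := by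
      rw [eq_inv_iff_mul_eq_one, ← hX, neg_add_cancel, h0]
    change Commute y (X (-u))
    rw [h1]
    exact Commute.inv_right hu

theorem mem_commuting {hX : ∀ x y, X (x + y) = X x * X y} {y : G} {x : Lat n} :
    x ∈ commuting hX y ↔ Commute y (X x) := Iff.rfl

theorem LatRel.e_mem_commuting {D : AffineDatum n} (hX : D.LatRel t X) {y : G} {x : Lat n}
    {j : Fin (n + 1)} (hj : j ≠ 0) (hy : Commute y (t j)) (hx : x ∈ commuting hX.add y)
    (hp : D.pr j x = -1) : e j ∈ commuting hX.add y := by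
  have h1 : x + e j ∈ commuting hX.add y := by
    rw [mem_commuting, ← hX.reflect j x hj hp]
    exact (hy.mul_right hx).mul_right hy
  simpa using sub_mem h1 hx

/-- The relation `T_0 X_{α_j} T_0 = X_{α_j + α_0}` for a neighbour joined by one lace. -/
theorem LatRel.zero_reflect {D : AffineDatum n} (hbr : D.Braids t) (hX : D.LatRel t X) {b : G}
    (hb : D.Braids (Function.update t 0 b)) (h0 : X (e 0) = t 0 * b) {j : Fin (n + 1)}
    (hj : j ≠ 0) (h : D.a 0 j = -1) : t 0 * X (e j) * t 0 = X (e j + e 0) := by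
  have h' := (D.a_right_of_single hj h).1
  have h1 := hX.reflect j (e 0) hj (by rw [pr_e, h'])
  have h2 : t 0 * t j * t 0 = t j * t 0 * t j := hbr.three hj.symm h h'
  have h3 := hb.three hj.symm h h'
  rw [Function.update_self, Function.update_of_ne hj] at h3
  change b * t j * b = t j * b * t j at h3
  have h4 : X (e j) = X (e 0 + e j) * (X (e 0))⁻¹ := by
    rw [eq_mul_inv_iff_mul_eq, ← hX.add, add_comm]
  rw [add_comm (e j) (e 0), h4, ← h1, h0]
  calc t 0 * (t j * (t 0 * b) * t j * (t 0 * b)⁻¹) * t 0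
      = (t 0 * t j * t 0) * b * t j * b⁻¹ := by group
    _ = t j * t 0 * (t j * b * t j) * b⁻¹ := by rw [h2]; simp only [mul_assoc]
    _ = _ := by rw [← h3]; group

theorem LatRel.sub_mem_commuting {D : AffineDatum n} (hX : D.LatRel t X) {x y : Lat n}
    (hx : t 0 * X x * t 0 = X (x + e 0)) (hy : t 0 * X y * t 0 = X (y + e 0)) :
    x - y ∈ commuting hX.add (t 0) := by
  have h1 : X (x - y) = X x * (X y)⁻¹ := by
    rw [eq_mul_inv_iff_mul_eq, ← hX.add, sub_add_cancel]
  have h2 : X (x - y) = X (x + e 0) * (X (y + e 0))⁻¹ := by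
    rw [eq_mul_inv_iff_mul_eq, ← hX.add]
    congr 1; abel
  rw [mem_commuting]
  change t 0 * X (x - y) = X (x - y) * t 0
  nth_rw 2 [h2]
  rw [h1, ← hx, ← hy]
  group

/-- The map `x ↦ x + (x, α_0^∨) α_i` projects onto the kernel of `α_0^∨`. It is additive, so
commutation with `T_0` need only be checked on the vectors required by `mem_of_gen`. The image of
`α_0` is `α_0 + 2 α_i`, and `X_{α_0 + 2 α_i} = T_0 X_{α_i} T_0 X_{α_i}`. -/
theorem LatRel.single_mem {D : AffineDatum n} (hbr : D.Braids t) (hX : D.LatRel t X) {b : G}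
    (hb : D.Braids (Function.update t 0 b)) (h0 : X (e 0) = t 0 * b)
    (hc : Commute (t 0) (X D.m)) {i : Fin (n + 1)} (hi : i ≠ 0) (hai : D.a 0 i = -1)
    (x : Lat n) : x + D.pr 0 x • e i ∈ commuting hX.add (t 0) := by
  have hs := D.single_of_neighbour hi hai
  have hr := fun j hj h => hX.zero_reflect hbr hb h0 (j := j) hj h
  let S : AddSubgroup (Lat n) :=
    (commuting hX.add (t 0)).comap
      ({ toFun := fun x => x + D.pr 0 x • e i
         map_zero' := by rw [map_zero]; simp
         map_add' := fun x y => by rw [map_add]; module } : Lat n →+ Lat n)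
  have hS : ∀ x, x ∈ S ↔ x + D.pr 0 x • e i ∈ commuting hX.add (t 0) := fun _ => Iff.rfl
  refine (hS x).1 (D.mem_of_gen S ?_ ?_ ?_ x)
  · rw [hS, pr_m, zero_smul, add_zero]; exact hc
  · rw [hS, pr_e, D.diag, mem_commuting]
    have h1 : (e 0 + (2 : ℤ) • e i : Lat n) = (e i + e 0) + e i := by module
    rw [h1, hX.add, ← hr i hi hai]
    have h2 : t 0 * X (e i) * t 0 * X (e i) = X (e i) * (t 0 * X (e i) * t 0) := by
      rw [hr i hi hai, (hX.commute _ _).eq]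
    change t 0 * (t 0 * X (e i) * t 0 * X (e i)) = t 0 * X (e i) * t 0 * X (e i) * t 0
    nth_rw 1 [h2]
    simp only [mul_assoc]
  · intro k j hj hk hjk
    rw [hS, pr_e] at hk ⊢
    rcases hs j hj with h | h
    · have h' := (D.a_eq_zero_iff 0 j).1 h
      have hcj : Commute (t 0) (t j) := hbr.commute hj.symm h
      rw [h, zero_smul, add_zero]
      have hk0 : k ≠ 0 := by
        rintro rfl
        rw [h'] at hjk
        norm_num at hjk
      rcases hs k hk0 with h1 | h1
      · rw [h1, zero_smul, add_zero] at hk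
        exact hX.e_mem_commuting hj hcj hk (by rw [pr_e, hjk])
      -- Here `k` is a neighbour of the affine node and `j` is not. Both `α_k` and `α_k + α_j`
      -- satisfy the reflection relation, so their difference `α_j` gives an element commuting with
      -- `T_0`.
      · have h2 : t 0 * X (e k + e j) * t 0 = X (e k + e j + e 0) := by
          rw [← hX.reflect j (e k) hj (by rw [pr_e, hjk])]
          calc t 0 * (t j * X (e k) * t j) * t 0
              = (t 0 * t j) * X (e k) * (t j * t 0) := by simp only [mul_assoc]
            _ = t j * (t 0 * X (e k) * t 0) * t j := by
              rw [hcj.eq, ← hcj.eq]; nth_rw 1 [hcj.eq]; simp only [mul_assoc]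
            _ = _ := by
              rw [hr k hk0 h1, hX.reflect j _ hj (by rw [pr_add, pr_e, pr_e, hjk, h']; norm_num)]
              congr 1; abel
        simpa using hX.sub_mem_commuting h2 (hr k hk0 h1)
    · rw [h, neg_one_smul, ← sub_eq_add_neg]
      exact hX.sub_mem_commuting (hr j hj h) (hr i hi hai)

/-- Here `(x, α_0^∨) = 2 (x_0 - x_i)`, so the kernel is `x_0 = x_i` and the map in the statement
projects onto it. The image of `α_0` is `α_0 + α_i`, handled by the double-lace relation, or by
centrality of `X_δ` when there are four laces. -/
theorem LatRel.double_mem {D : AffineDatum n} (hbr : D.Braids t) (hX : D.LatRel t X) {b : G}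
    (h0 : X (e 0) = t 0 * b) (hc : Commute (t 0) (X D.m)) {i : Fin (n + 1)} (hi : i ≠ 0)
    (hai : D.a 0 i = -2) (hd : D.a i 0 = -1 → Commute (t 0) ((t i)⁻¹ * b * t i))
    (x : Lat n) : x + (x 0 - x i) • e i ∈ commuting hX.add (t 0) := by
  obtain ⟨hmi, hJ⟩ := D.unique_of_double hi hai
  have hγ : e 0 + e i ∈ commuting hX.add (t 0) := by
    rcases D.a_zero_left hi with h | h | h | h
    · omega
    · omega
    · rw [mem_commuting, ← hX.reflect i (e 0) hi (by rw [pr_e, h.2.1]), h0]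
      have h1 : t i * (t 0 * b) * t i = (t i * t 0 * t i) * ((t i)⁻¹ * b * t i) := by group
      rw [h1]
      refine Commute.mul_right ?_ (hd h.2.1)
      have h2 := hbr.four hi.symm (by rw [h.1, h.2.1]; norm_num)
      change t 0 * (t i * t 0 * t i) = t i * t 0 * t i * t 0
      rw [← h2]
      simp only [mul_assoc]
    · rw [D.eq_e_zero_add_of_four hi h.1 h.2]; exact hc
  let S : AddSubgroup (Lat n) :=
    (commuting hX.add (t 0)).comap
      ({ toFun := fun x => x + (x 0 - x i) • e i
         map_zero' := by simp
         map_add' := fun x y => by rw [Pi.add_apply, Pi.add_apply]; module } : Lat n →+ Lat n)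
  have hS : ∀ x, x ∈ S ↔ x + (x 0 - x i) • e i ∈ commuting hX.add (t 0) := fun _ => Iff.rfl
  refine (hS x).1 (D.mem_of_gen S ?_ ?_ ?_ x)
  · rw [hS, D.m_zero, hmi, sub_self, zero_smul, add_zero]; exact hc
  · rw [hS, e_self, e_ne hi, sub_zero, one_smul]; exact hγ
  · intro k j hj hk hjk
    rw [hS] at hk ⊢
    by_cases hji : j = i
    · subst hji
      rw [e_self, e_ne hj.symm, zero_sub, neg_one_smul, add_neg_cancel]
      exact zero_mem _
    · have h := hJ j hj hji
      have h' := (D.a_eq_zero_iff 0 j).1 h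
      rw [e_ne hj.symm, e_ne (Ne.symm hji), sub_zero, zero_smul, add_zero]
      have hcj : Commute (t 0) (t j) := hbr.commute hj.symm h
      have hk0 : k ≠ 0 := by
        rintro rfl
        rw [h'] at hjk
        norm_num at hjk
      by_cases hki : k = i
      · subst hki
        exact hX.e_mem_commuting hj hcj hγ (by rw [pr_add, pr_e, pr_e, hjk, h']; norm_num)
      · rw [e_ne hk0.symm, e_ne (Ne.symm hki), sub_zero, zero_smul, add_zero] at hk
        exact hX.e_mem_commuting hj hcj hk (by rw [pr_e, hjk])

theorem pr_zero_of_double {i : Fin (n + 1)} (hi : i ≠ 0) (hai : D.a 0 i = -2) (x : Lat n) :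
    D.pr 0 x = 2 * (x 0 - x i) := by
  obtain ⟨-, hJ⟩ := D.unique_of_double hi hai
  rw [pr_apply, ← Finset.add_sum_erase _ _ (Finset.mem_univ 0),
    ← Finset.add_sum_erase _ _ (Finset.mem_erase.2 ⟨hi, Finset.mem_univ i⟩), D.diag, hai,
    Finset.sum_eq_zero]
  · ring
  · intro j hj
    rw [hJ j (Finset.ne_of_mem_erase (Finset.mem_of_mem_erase hj)) (Finset.ne_of_mem_erase hj),
      zero_mul]

/-- The relations of the double affine Artin group at the affine node follow from the braid
relations for `T_0` and `T_0⁻¹ X_{α_0}`. -/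
theorem LatRel.doubleLat {D : AffineDatum n} (hbr : D.Braids t) (hX : D.LatRel t X) {b : G}
    (hb : D.Braids (Function.update t 0 b)) (h0 : X (e 0) = t 0 * b)
    (hc : ∀ j, Commute (X D.m) (t j)) {i : Fin (n + 1)} (hi : i ≠ 0) (hai : D.a 0 i ≠ 0)
    (hd : D.a 0 i = -2 → D.a i 0 = -1 → Commute (t 0) ((t i)⁻¹ * b * t i)) :
    D.DoubleLat t X := by
  have key : (∀ x, D.pr 0 x = 0 → t 0 * X x = X x * t 0) ∧
      ∀ x, D.pr 0 x = -1 → t 0 * X x * t 0 = X (x + e 0) := by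
    have hcases : D.a 0 i = -1 ∨ D.a 0 i = -2 := by
      rcases D.a_zero_left hi with h | h | h | h <;> omega
    rcases hcases with h | h
    · have hmem := hX.single_mem hbr hb h0 (hc 0).symm hi h
      refine ⟨fun x hx => ?_, fun x hx => ?_⟩
      · have h1 := hmem x
        rwa [hx, zero_smul, add_zero] at h1
      · have h1 := hmem x
        rw [hx, neg_one_smul, ← sub_eq_add_neg, mem_commuting] at h1
        have h2 : X x = X (e i) * X (x - e i) := by rw [← hX.add, add_sub_cancel]
        rw [h2, mul_assoc, mul_assoc, ← h1.eq, ← mul_assoc, ← mul_assoc,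
          hX.zero_reflect hbr hb h0 hi h, ← hX.add]
        congr 1; abel
    · have hmem := hX.double_mem hbr h0 (hc 0).symm hi h (hd h)
      have hp := D.pr_zero_of_double hi h
      refine ⟨fun x hx => ?_, fun x hx => ?_⟩
      · have h1 := hmem x
        have h2 : x 0 - x i = 0 := by have := hp x; omega
        rwa [h2, zero_smul, add_zero] at h1
      · have := hp x
        omega
  refine ⟨hX.add, hc, fun j x hj => ?_, fun j x hj => ?_⟩
  · by_cases h : j = 0
    · subst h; exact key.1 x hj
    · exact hX.comm j x h hj
  · by_cases h : j = 0
    · subst h; exact key.2 x hj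
    · exact hX.reflect j x h hj

/-- The double affine Artin relations in a group that satisfies the relations of the triple
group. -/
theorem exists_doubleLat (hbr : D.Braids t) {a b : G} (ha : D.Braids (Function.update t 0 a))
    (hb : D.Braids (Function.update t 0 b)) (hc : ∀ g, Commute (a * b * t 0 * D.T t D.sth) g)
    {i : Fin (n + 1)} (hi : i ≠ 0) (hai : D.a 0 i ≠ 0)
    (hd : D.a 0 i = -2 → D.a i 0 = -1 → Commute a ((t i)⁻¹ * b * t i)) :
    ∃ X : Lat n → G, D.DoubleLat (Function.update t 0 a) X ∧
      X D.m = a * b * t 0 * D.T t D.sth ∧ X D.th = t 0 * D.T t D.sth ∧ X (e 0) = a * b := by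
  obtain ⟨X, hadd, hXm, hXth, hcomm, hrefl⟩ := D.exists_bernstein hbr
  set C := a * b * t 0 * D.T t D.sth with hC
  -- The Bernstein elements satisfy `X_δ = 1`. The affine coordinate is `1` on `δ`, `0` on `θ`, and
  -- unchanged by reflections at the other nodes, so this twist moves `X_δ` to `C`, keeps `X_θ`, and
  -- respects the finite relations.
  let Y : Lat n → G := fun x => X x * C ^ (x 0)
  have hCz : ∀ (k : ℤ) g, Commute (C ^ k) g := fun k g => (hc g).zpow_left k
  have hYm : Y D.m = C := by
    change X D.m * C ^ (D.m 0) = C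
    rw [hXm, D.m_zero, zpow_one, one_mul]
  have hYth : Y D.th = t 0 * D.T t D.sth := by
    change X D.th * C ^ (D.th 0) = _
    rw [hXth, th_zero, zpow_zero, mul_one]
  have hY : D.LatRel (Function.update t 0 a) Y := by
    refine ⟨fun x y => ?_, fun j x hj hx => ?_, fun j x hj hx => ?_⟩
    · change X (x + y) * C ^ (x 0 + y 0) = X x * C ^ (x 0) * (X y * C ^ (y 0))
      rw [hadd, zpow_add, mul_assoc, mul_assoc, ← mul_assoc (C ^ _) (X y), (hCz _ (X y)).eq]
      simp only [mul_assoc]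
    · rw [Function.update_of_ne hj]
      change t j * (X x * C ^ (x 0)) = X x * C ^ (x 0) * t j
      rw [← mul_assoc, hcomm j x hj hx, mul_assoc, mul_assoc, (hCz _ _).eq]
    · rw [Function.update_of_ne hj]
      change t j * (X x * C ^ (x 0)) * t j = X (x + e j) * C ^ ((x + e j) 0)
      rw [Pi.add_apply, e_ne hj.symm, add_zero, ← hrefl j x hj hx]
      simp only [mul_assoc]
      rw [(hCz _ _).eq]
  have hY0 : Y (e 0) = a * b := by
    have h1 : Y (e 0) * Y D.th = Y D.m := by rw [← hY.add, add_comm, ← D.m_eq]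
    rw [hYm, hYth, hC, mul_assoc (a * b)] at h1
    exact mul_right_cancel h1
  refine ⟨Y, hY.doubleLat ha (b := b) ?_ ?_ ?_ hi hai ?_, hYm, hYth, hY0⟩
  · rwa [Function.update_idem]
  · rw [Function.update_self, hY0]
  · intro j; rw [hYm]; exact hc _
  · rw [Function.update_self, Function.update_of_ne hi]; exact hd

end

end AffineDatum

/-! ### The numerical data of each type -/

/-- An affine datum from functions on the natural numbers; `o i j` is `-a_{ij}` for `i ≠ j`. -/
def AffineDatum.ofNat (n : ℕ) (o : ℕ → ℕ → ℤ) (d m : ℕ → ℤ)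
    (off : ∀ i j, i ≤ n → j ≤ n → 0 ≤ o i j)
    (symm : ∀ i j, i ≤ n → j ≤ n → i ≠ j → d i * o i j = d j * o j i)
    (null : ∀ i, i ≤ n →
      ∑ k ∈ Finset.range (n + 1), (if i = k then 2 else -o i k) * m k = 0)
    (d_zero : d 0 = 1) (d_pos : ∀ i, i ≤ n → 1 ≤ d i ∧ d i ≤ 3) (m_zero : m 0 = 1)
    (m_pos : ∀ i, i ≤ n → 1 ≤ m i)
    (lace : ∀ i j, i ≤ n → j ≤ n → i ≠ j →
      o i j * o j i ≤ 3 ∨ (o i j = 2 ∧ o j i = 2 ∧ (i = 0 ∨ j = 0)))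
    (mode : (∀ j, 1 ≤ j → j ≤ n → o 0 j = 0 ∨ o 0 j = 1) ∨
      (∀ j, 1 ≤ j → j ≤ n → o 0 j = 0 ∨ o 0 j = 2))
    (gen : ∀ S : ℕ → Prop, S 0 →
      (∀ i j, i ≤ n → j ≤ n → i ≠ j → S i → o j i = 1 → S j) →
      (∀ j, j ≤ n → S j) ∨ ∃ z, 1 ≤ z ∧ z ≤ n ∧ m z = 1 ∧ (∀ j, j ≤ n → j ≠ z → S j) ∧
        ∀ j, 1 ≤ j → j ≤ n → o 0 j = 0 ∨ o 0 j = 2) : AffineDatum n where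
  a i j := if i = j then 2 else -o i j
  d i := d i
  m i := m i
  diag i := if_pos rfl
  off i j hij := by
    have := off i j (by omega) (by omega)
    rw [if_neg hij]; omega
  symm i j := by
    by_cases hij : i = j
    · rw [hij]
    · have := symm i j (by omega) (by omega) (by omega)
      rw [if_neg hij, if_neg (Ne.symm hij)]
      linarith
  null i := by
    have := null i (by omega)
    rw [← Fin.sum_univ_eq_sum_range (fun k : ℕ => (if (i : ℕ) = k then 2 else -o i k) * m k)
      (n + 1)] at this
    rw [← this]
    simp only [Fin.ext_iff]
  d_zero := d_zero
  d_pos i := (d_pos i (by omega)).1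
  d_le i := (d_pos i (by omega)).2
  m_zero := m_zero
  m_pos i := m_pos i (by omega)
  lace i j hij := by
    have := lace i j (by omega) (by omega) (by omega)
    rw [if_neg hij, if_neg (Ne.symm hij), neg_mul_neg, neg_inj, neg_inj]
    simp only [Fin.ext_iff]
    exact this
  mode := by
    refine mode.imp (fun h j hj => ?_) (fun h j hj => ?_)
    all_goals
      have := h j (Nat.one_le_iff_ne_zero.2 (fun h0 => hj (Fin.ext h0))) (by omega)
      rw [if_neg (Ne.symm hj)]
      change -o 0 j = 0 ∨ -o 0 j = _
      omega
  gen S h0 hS := by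
    have hg := gen (fun k => ∃ h : k < n + 1, (⟨k, h⟩ : Fin (n + 1)) ∈ S) ⟨by omega, h0⟩ (by
      rintro i j hi hj hij ⟨_, hiS⟩ ho
      refine ⟨by omega, hS _ _ hiS ?_⟩
      rw [if_neg (by rw [Fin.mk.injEq]; omega), ho])
    rcases hg with hg | ⟨z, hz, hzn, hmz, hg, h2⟩
    · exact Or.inl fun j => (hg j (by omega)).2
    · refine Or.inr ⟨⟨z, by omega⟩, ?_, hmz, fun j hj => ?_, fun j hj => ?_⟩
      · rw [Ne, Fin.ext_iff]; change ¬ z = 0; omega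
      · exact (hg j (by omega) (fun h => hj (Fin.ext h))).2
      · have := h2 j (Nat.one_le_iff_ne_zero.2 (fun h0 => hj (Fin.ext h0))) (by omega)
        rw [if_neg (Ne.symm hj)]
        change -o 0 j = 0 ∨ -o 0 j = _
        omega

namespace AffineType

/-- The numbers `-a_{ij}` for `i ≠ j`, after `α_n` is replaced by `α_n / 2` in type `A₂ₙ⁽²⁾`. -/
def redOffDiag : AffineType → ℕ → ℕ → ℤ
  | twistedAEven n _, i, j =>
      if i + 1 = j ∨ j + 1 = i then
        (if i = 0 then 2 else 1) * (if i = n then 2 else 1) else 0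
  | X, i, j => X.offDiag i j

/-- The coordinates of `a_0⁻¹ δ`, after `α_n` is replaced by `α_n / 2` in type `A₂ₙ⁽²⁾`. -/
def redLabel : AffineType → ℕ → ℤ
  | twistedAEven _ _, _ => 1
  | X, i => X.label i

/-- Half of the square lengths of the simple roots, after `α_n` is replaced by `α_n / 2` in type
`A₂ₙ⁽²⁾`, and normalized to `1` at the affine node. -/
def redLength : AffineType → ℕ → ℤ
  | twistedAOdd n _, i => if i = n then 2 else 1
  | twistedAEven n _, i => if i = 0 ∨ i = n then 1 else 2
  | twistedD n _, i => if i = 0 ∨ i = n then 1 else 2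
  | twistedESix, i => if 3 ≤ i then 2 else 1
  | twistedDFour, i => if 2 ≤ i then 3 else 1
  | _, _ => 1

theorem redOffDiag_nonneg (X : AffineType) (i j : ℕ) : 0 ≤ X.redOffDiag i j := by
  cases X <;> simp only [redOffDiag, offDiag, joined] <;> split_ifs <;> norm_num

theorem redLength_symm (X : AffineType) (i j : ℕ) (hi : i ≤ X.rank) (hj : j ≤ X.rank)
    (hij : i ≠ j) :
    X.redLength i * X.redOffDiag i j = X.redLength j * X.redOffDiag j i := by
  cases X <;> simp only [redLength, redOffDiag, offDiag, rank] at *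
  case untwistedESix => revert hij; revert j hj; revert i hi; decide
  case untwistedESeven => revert hij; revert j hj; revert i hi; decide
  case untwistedEEight => revert hij; revert j hj; revert i hi; decide
  all_goals split_ifs <;> omega

theorem redLength_bounds (X : AffineType) (i : ℕ) : 1 ≤ X.redLength i ∧ X.redLength i ≤ 3 := by
  cases X <;> simp only [redLength] <;> (try split_ifs) <;> norm_num

theorem redLength_zero (X : AffineType) : X.redLength 0 = 1 := by
  cases X <;> simp [redLength]
  omega

theorem redLabel_zero (X : AffineType) : X.redLabel 0 = 1 := by
  cases X <;> simp [redLabel, label]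

theorem redLabel_pos (X : AffineType) (i : ℕ) (hi : i ≤ X.rank) : 1 ≤ X.redLabel i := by
  cases X <;> simp only [redLabel, label, rank] at *
  case untwistedESix => revert i; decide
  case untwistedESeven => revert i; decide
  case untwistedEEight => revert i; decide
  case twistedESix => revert i; decide
  case twistedDFour => revert i; decide
  all_goals (try split_ifs) <;> norm_num

theorem redOffDiag_lace (X : AffineType) (i j : ℕ) (hi : i ≤ X.rank) (hj : j ≤ X.rank)
    (hij : i ≠ j) :
    X.redOffDiag i j * X.redOffDiag j i ≤ 3 ∨
      (X.redOffDiag i j = 2 ∧ X.redOffDiag j i = 2 ∧ (i = 0 ∨ j = 0)) := by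
  cases X <;> simp only [redOffDiag, offDiag, rank] at *
  case untwistedESix => revert hij; revert j hj; revert i hi; decide
  case untwistedESeven => revert hij; revert j hj; revert i hi; decide
  case untwistedEEight => revert hij; revert j hj; revert i hi; decide
  all_goals split_ifs <;> omega

theorem redOffDiag_mode (X : AffineType) :
    (∀ j, 1 ≤ j → j ≤ X.rank → X.redOffDiag 0 j = 0 ∨ X.redOffDiag 0 j = 1) ∨
      (∀ j, 1 ≤ j → j ≤ X.rank → X.redOffDiag 0 j = 0 ∨ X.redOffDiag 0 j = 2) := by
  cases X with
  | untwistedA n hn =>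
    by_cases h : n = 1
    · right; intro j _ _; simp [redOffDiag, offDiag, h]
    · left; intro j _ _; simp only [redOffDiag, offDiag]; grind
  | twistedAEven n hn =>
    right; intro j _ _; simp only [redOffDiag]; grind
  | twistedD n hn =>
    right; intro j _ _; simp only [redOffDiag, offDiag]; grind
  | _ =>
    left; intro j _ _; simp only [redOffDiag, offDiag, joined, rank] at *; grind

/-- Unit steps follow the diagram from the affine node. They fail only on entering the last node of
the chains with double edges at both ends, where the Cartan integer is `-2`, and across the edge of
`A₁⁽¹⁾`. -/
theorem redOffDiag_gen (X : AffineType) (S : ℕ → Prop) (h0 : S 0)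
    (hS : ∀ i j, i ≤ X.rank → j ≤ X.rank → i ≠ j → S i → X.redOffDiag j i = 1 → S j) :
    (∀ j, j ≤ X.rank → S j) ∨ ∃ z, 1 ≤ z ∧ z ≤ X.rank ∧ X.redLabel z = 1 ∧
      (∀ j, j ≤ X.rank → j ≠ z → S j) ∧
        ∀ j, 1 ≤ j → j ≤ X.rank → X.redOffDiag 0 j = 0 ∨ X.redOffDiag 0 j = 2 := by
  cases X with
  | untwistedA n hn =>
    by_cases h : n = 1
    · refine Or.inr ⟨1, le_rfl, hn, rfl, fun j hj h1 => ?_, fun j _ _ => ?_⟩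
      · have : j = 0 := by simp only [rank] at hj; omega
        rwa [this]
      · simp [redOffDiag, offDiag, h]
    · left
      intro j
      induction j with
      | zero => exact fun _ => h0
      | succ j ih =>
        intro hj
        refine hS j _ (by omega) hj (by omega) (ih (by omega)) ?_
        simp [redOffDiag, offDiag, h]
  | untwistedD n hn =>
    left
    simp only [rank] at *
    have h2 : S 2 := hS 0 2 (by omega) (by omega) (by omega) h0 (by
      simp [redOffDiag, offDiag])
    have key : ∀ j, 2 ≤ j → j < n → S j := by
      intro j hj
      induction j, hj using Nat.le_induction with
      | base => exact fun _ => h2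
      | succ j hj ih =>
        intro hjn
        refine hS j _ (by omega) (by omega) (by omega) (ih (by omega)) ?_
        simp only [redOffDiag, offDiag]; grind
    intro j hj
    by_cases h : j = 0
    · rwa [h]
    by_cases h : j = 1
    · rw [h]
      refine hS 2 1 (by omega) (by omega) (by omega) h2 ?_
      simp only [redOffDiag, offDiag]; grind
    by_cases h : j = n
    · rw [h]
      refine hS (n - 2) n (by omega) (by omega) (by omega) (key _ (by omega) (by omega)) ?_
      simp only [redOffDiag, offDiag]; grind
    exact key j (by omega) (by omega)
  | untwistedESix =>
    left
    have h6 := hS 0 6 (by decide) (by decide) (by decide) h0 (by decide)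
    have h3 := hS 6 3 (by decide) (by decide) (by decide) h6 (by decide)
    have h2 := hS 3 2 (by decide) (by decide) (by decide) h3 (by decide)
    have h1 := hS 2 1 (by decide) (by decide) (by decide) h2 (by decide)
    have h4 := hS 3 4 (by decide) (by decide) (by decide) h3 (by decide)
    have h5 := hS 4 5 (by decide) (by decide) (by decide) h4 (by decide)
    intro j hj
    simp only [rank] at hj
    interval_cases j <;> assumption
  | untwistedESeven =>
    left
    have h1 := hS 0 1 (by decide) (by decide) (by decide) h0 (by decide)
    have h2 := hS 1 2 (by decide) (by decide) (by decide) h1 (by decide)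
    have h3 := hS 2 3 (by decide) (by decide) (by decide) h2 (by decide)
    have h4 := hS 3 4 (by decide) (by decide) (by decide) h3 (by decide)
    have h5 := hS 4 5 (by decide) (by decide) (by decide) h4 (by decide)
    have h6 := hS 5 6 (by decide) (by decide) (by decide) h5 (by decide)
    have h7 := hS 3 7 (by decide) (by decide) (by decide) h3 (by decide)
    intro j hj
    simp only [rank] at hj
    interval_cases j <;> assumption
  | untwistedEEight =>
    left
    have h1 := hS 0 1 (by decide) (by decide) (by decide) h0 (by decide)
    have h2 := hS 1 2 (by decide) (by decide) (by decide) h1 (by decide)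
    have h3 := hS 2 3 (by decide) (by decide) (by decide) h2 (by decide)
    have h4 := hS 3 4 (by decide) (by decide) (by decide) h3 (by decide)
    have h5 := hS 4 5 (by decide) (by decide) (by decide) h4 (by decide)
    have h6 := hS 5 6 (by decide) (by decide) (by decide) h5 (by decide)
    have h7 := hS 6 7 (by decide) (by decide) (by decide) h6 (by decide)
    have h8 := hS 5 8 (by decide) (by decide) (by decide) h5 (by decide)
    intro j hj
    simp only [rank] at hj
    interval_cases j <;> assumption
  | twistedAOdd n hn =>
    left
    simp only [rank] at *
    have h2 : S 2 := hS 0 2 (by omega) (by omega) (by omega) h0 (by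
      simp only [redOffDiag, offDiag]; grind)
    intro j hj
    by_cases h : j = 0
    · rwa [h]
    by_cases h : j = 1
    · rw [h]
      refine hS 2 1 (by omega) (by omega) (by omega) h2 ?_
      simp only [redOffDiag, offDiag]; grind
    have h3 : 2 ≤ j := by omega
    clear h
    induction j, h3 using Nat.le_induction with
    | base => exact h2
    | succ j hj' ih =>
      refine hS j _ (by omega) (by omega) (by omega) (ih (by omega) (by omega)) ?_
      simp only [redOffDiag, offDiag]; grind
  | twistedAEven n hn =>
    simp only [rank] at *
    refine Or.inr ⟨n, hn, le_rfl, rfl, fun j hj h1 => ?_, fun j _ _ => ?_⟩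
    · induction j with
      | zero => exact h0
      | succ j ih =>
        refine hS j _ (by omega) hj (by omega) (ih (by omega) (by omega)) ?_
        simp only [redOffDiag]; grind
    · simp only [redOffDiag]; grind
  | twistedD n hn =>
    simp only [rank] at *
    refine Or.inr ⟨n, by omega, le_rfl, rfl, fun j hj h1 => ?_, fun j _ _ => ?_⟩
    · induction j with
      | zero => exact h0
      | succ j ih =>
        refine hS j _ (by omega) hj (by omega) (ih (by omega) (by omega)) ?_
        simp only [redOffDiag, offDiag]; grind
    · simp only [redOffDiag, offDiag]; grind
  | twistedESix =>
    left
    have h1 := hS 0 1 (by decide) (by decide) (by decide) h0 (by decide)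
    have h2 := hS 1 2 (by decide) (by decide) (by decide) h1 (by decide)
    have h3 := hS 2 3 (by decide) (by decide) (by decide) h2 (by decide)
    have h4 := hS 3 4 (by decide) (by decide) (by decide) h3 (by decide)
    intro j hj
    simp only [rank] at hj
    interval_cases j <;> assumption
  | twistedDFour =>
    left
    have h1 := hS 0 1 (by decide) (by decide) (by decide) h0 (by decide)
    have h2 := hS 1 2 (by decide) (by decide) (by decide) h1 (by decide)
    intro j hj
    simp only [rank] at hj
    interval_cases j <;> assumption

theorem redLabel_null (X : AffineType) (i : ℕ) (hi : i ≤ X.rank) :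
    ∑ k ∈ Finset.range (X.rank + 1), (if i = k then 2 else -X.redOffDiag i k) * X.redLabel k
      = 0 := by
  cases X with
  | untwistedA n hn =>
    simp only [rank] at *
    -- Each row is rewritten as a sum of terms supported at a single index (the node and its
    -- possible neighbours), which the sum over the range evaluates; the same device serves the
    -- other infinite families.
    have key : ∀ k ∈ Finset.range (n + 1),
        (if i = k then 2 else -(untwistedA n hn).redOffDiag i k) * (untwistedA n hn).redLabel k
        = (if k = i then 2 else 0) + (if k = (if i = n then 0 else i + 1) then -1 else 0) +
          (if k = (if i = 0 then n else i - 1) then -1 else 0) := by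
      intro k hk
      have hk' : k < n + 1 := Finset.mem_range.1 hk
      simp only [redOffDiag, offDiag, redLabel, label]
      split_ifs <;> omega
    rw [Finset.sum_congr rfl key, Finset.sum_add_distrib, Finset.sum_add_distrib,
      Finset.sum_ite_eq', Finset.sum_ite_eq', Finset.sum_ite_eq']
    simp only [Finset.mem_range]
    split_ifs <;> omega
  | untwistedD n hn =>
    simp only [rank] at *
    have key : ∀ k ∈ Finset.range (n + 1),
        (if i = k then 2 else -(untwistedD n hn).redOffDiag i k) * (untwistedD n hn).redLabel k
        = (if k = i then (if i ≤ 1 ∨ n ≤ i + 1 then 2 else 4) else 0) +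
          (if k = i + 1 then (if 1 ≤ i ∧ i + 1 < n then (if i + 2 = n then -1 else -2) else 0)
            else 0) +
          (if k = i - 1 then (if 2 ≤ i ∧ i < n then (if i = 2 then -1 else -2) else 0) else 0) +
          (if k = 0 then (if i = 2 then -1 else 0) else 0) +
          (if k = 2 then (if i = 0 then -2 else 0) else 0) +
          (if k = n then (if i + 2 = n then -1 else 0) else 0) +
          (if k = n - 2 then (if i = n then -2 else 0) else 0) := by
      intro k hk
      have hk' : k < n + 1 := Finset.mem_range.1 hk
      simp only [redOffDiag, offDiag, redLabel, label]
      grind (splits := 20)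
    rw [Finset.sum_congr rfl key]
    simp only [Finset.sum_add_distrib, Finset.sum_ite_eq', Finset.mem_range]
    grind
  | twistedAOdd n hn =>
    simp only [rank] at *
    have key : ∀ k ∈ Finset.range (n + 1),
        (if i = k then 2 else -(twistedAOdd n hn).redOffDiag i k) *
          (twistedAOdd n hn).redLabel k
        = (if k = i then (if i ≤ 1 ∨ i = n then 2 else 4) else 0) +
          (if k = i + 1 then (if 1 ≤ i then -2 else 0) else 0) +
          (if k = i - 1 then (if 2 ≤ i then (if i = 2 then -1 else -2) else 0) else 0) +
          (if k = 0 then (if i = 2 then -1 else 0) else 0) +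
          (if k = 2 then (if i = 0 then -2 else 0) else 0) := by
      intro k hk
      have hk' : k < n + 1 := Finset.mem_range.1 hk
      simp only [redOffDiag, offDiag, redLabel, label]
      grind
    rw [Finset.sum_congr rfl key]
    simp only [Finset.sum_add_distrib, Finset.sum_ite_eq', Finset.mem_range]
    grind
  | twistedAEven n hn =>
    simp only [rank] at *
    have key : ∀ k ∈ Finset.range (n + 1),
        (if i = k then 2 else -(twistedAEven n hn).redOffDiag i k) *
          (twistedAEven n hn).redLabel k
        = (if k = i then 2 else 0) + (if k = i + 1 then (if i = 0 then -2 else -1) else 0) +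
          (if k = i - 1 then (if i = 0 then 0 else if i = n then -2 else -1) else 0) := by
      intro k hk
      have hk' : k < n + 1 := Finset.mem_range.1 hk
      simp only [redOffDiag, redLabel]
      split_ifs <;> omega
    rw [Finset.sum_congr rfl key]
    simp only [Finset.sum_add_distrib, Finset.sum_ite_eq', Finset.mem_range]
    split_ifs <;> omega
  | twistedD n hn =>
    simp only [rank] at *
    have key : ∀ k ∈ Finset.range (n + 1),
        (if i = k then 2 else -(twistedD n hn).redOffDiag i k) *
          (twistedD n hn).redLabel k
        = (if k = i then 2 else 0) + (if k = i + 1 then (if i = 0 then -2 else -1) else 0) +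
          (if k = i - 1 then (if i = 0 then 0 else if i = n then -2 else -1) else 0) := by
      intro k hk
      have hk' : k < n + 1 := Finset.mem_range.1 hk
      simp only [redOffDiag, offDiag, redLabel, label]
      split_ifs <;> omega
    rw [Finset.sum_congr rfl key]
    simp only [Finset.sum_add_distrib, Finset.sum_ite_eq', Finset.mem_range]
    split_ifs <;> omega
  | untwistedESix => revert i; decide
  | untwistedESeven => revert i; decide
  | untwistedEEight => revert i; decide
  | twistedESix => revert i; decide
  | twistedDFour => revert i; decide

/-- The affine datum of an affine Cartan matrix; in type `A₂ₙ⁽²⁾` the simple root `α_n` is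
replaced by `α_n / 2`. -/
def datum (X : AffineType) : AffineDatum X.rank :=
  AffineDatum.ofNat X.rank X.redOffDiag X.redLength X.redLabel
    (fun i j _ _ => X.redOffDiag_nonneg i j) X.redLength_symm X.redLabel_null X.redLength_zero
    (fun i _ => X.redLength_bounds i)
    X.redLabel_zero X.redLabel_pos X.redOffDiag_lace X.redOffDiag_mode X.redOffDiag_gen

end AffineType

/-! ### Comparison of the given data with the datum -/

namespace AffineType

open AffineDatum (Lat e)

theorem datum_a (X : AffineType) (i j : X.Node) :
    X.datum.a i j = if i = j then 2 else -X.redOffDiag i j := rfl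

theorem datum_m (X : AffineType) (i : X.Node) : X.datum.m i = X.redLabel i := rfl

theorem datum_d (X : AffineType) (i : X.Node) : X.datum.d i = X.redLength i := rfl

/-- The simple roots of the datum are these multiples of the simple roots. -/
def scale (X : AffineType) (i : X.Node) : ℚ :=
  if X.isAEven = true ∧ i = Fin.last X.rank then 1 / 2 else 1

theorem scale_pos (X : AffineType) (i : X.Node) : 0 < X.scale i := by
  unfold scale; split_ifs <;> norm_num

theorem scale_ne (X : AffineType) (i : X.Node) : X.scale i ≠ 0 := (X.scale_pos i).ne'

theorem scale_of_not {X : AffineType} {i : X.Node}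
    (hi : ¬(X.isAEven = true ∧ i = Fin.last X.rank)) : X.scale i = 1 := if_neg hi

theorem scale_twistedAEven (n : ℕ) (hn : 1 ≤ n) (k : (twistedAEven n hn).Node) :
    (twistedAEven n hn).scale k = if (k : ℕ) = n then 1 / 2 else 1 := by
  by_cases h : (k : ℕ) = n
  · rw [if_pos h, scale, if_pos ⟨rfl, Fin.ext h⟩]
  · rw [if_neg h, scale, if_neg fun h' => h (congrArg Fin.val h'.2)]

theorem scale_zero (X : AffineType) : X.scale 0 = 1 := by
  refine scale_of_not ?_
  rintro ⟨h, h0⟩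
  cases X with
  | twistedAEven n hn =>
    have : (0 : ℕ) = n := congrArg Fin.val h0
    omega
  | _ => simp [isAEven] at h

/-- Scaling a simple root scales its coroot inversely, so the two Cartan matrices are conjugate by
the diagonal matrix of scales. -/
theorem scale_mul_datum_a (X : AffineType) (i j : X.Node) :
    X.scale i * X.datum.a i j = X.cartan i j * X.scale j := by
  by_cases h : X.isAEven = true
  · cases X with
    | twistedAEven n hn =>
      rw [datum_a, cartan]
      by_cases hij : i = j
      · rw [if_pos hij, if_pos hij, hij, mul_comm]
      · rw [if_neg hij, if_neg hij]
        have hij' : (i : ℕ) ≠ j := fun h => hij (Fin.ext h)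
        rw [scale_twistedAEven, scale_twistedAEven]
        simp only [redOffDiag, offDiag]
        split_ifs <;> first | omega | norm_num
    | _ => simp [isAEven] at h
  · rw [scale_of_not fun h' => h h'.1, scale_of_not fun h' => h h'.1, one_mul, mul_one, datum_a,
      cartan]
    congr 2
    cases X with
    | twistedAEven n hn => simp [isAEven] at h
    | _ => rfl

theorem deltaDiv_eq (X : AffineType) (i : X.Node) :
    X.deltaDiv i = X.datum.m i * X.scale i := by
  rw [datum_m]
  by_cases h : X.isAEven = true
  · cases X with
    | twistedAEven n hn =>
      have hn' : (0 : ℕ) ≠ n := by omega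
      rw [scale_twistedAEven]
      simp only [deltaDiv, delta, redLabel, label, Pi.smul_apply, smul_eq_mul, if_neg hn']
      split_ifs <;> norm_num
    | _ => simp [isAEven] at h
  · rw [scale_of_not fun h' => h h'.1, mul_one, deltaDiv, X.label_zero_eq (by simpa using h)]
    have : X.redLabel i = X.label i := by
      cases X with
      | twistedAEven n hn => simp [isAEven] at h
      | _ => rfl
    rw [this]
    simp [delta]

/-- The lattice of the datum inside the rational span of the simple roots. -/
def emb (X : AffineType) : Lat X.rank →+ X.Space where
  toFun x i := x i * X.scale i
  map_zero' := by ext i; simp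
  map_add' x y := by ext i; simp [add_mul]

theorem emb_apply (X : AffineType) (x : Lat X.rank) (i : X.Node) :
    X.emb x i = x i * X.scale i := rfl

theorem emb_injective (X : AffineType) : Function.Injective X.emb := by
  intro x y h
  ext i
  have := congrFun h i
  rw [emb_apply, emb_apply] at this
  exact_mod_cast mul_right_cancel₀ (X.scale_ne i) this

theorem emb_e (X : AffineType) (i : X.Node) : X.emb (e i) = X.scale i • X.simpleRoot i := by
  ext j
  rw [emb_apply, Pi.smul_apply, simpleRoot, e]
  by_cases h : j = i
  · subst h; simp
  · simp [h]

theorem emb_e_zero (X : AffineType) : X.emb (e 0) = X.simpleRoot 0 := by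
  rw [emb_e, scale_zero, one_smul]

theorem emb_m (X : AffineType) : X.emb X.datum.m = X.deltaDiv := by
  ext i
  rw [emb_apply, deltaDiv_eq]

theorem emb_th (X : AffineType) : X.emb X.datum.th = X.thetaDiv := by
  rw [AffineDatum.th, map_sub, emb_m, emb_e_zero, simpleRoot_zero_eq, sub_sub_cancel]

theorem pairing_emb (X : AffineType) (x : Lat X.rank) (i : X.Node) :
    X.pairing (X.emb x) i = X.scale i * X.datum.pr i x := by
  rw [pairing, AffineDatum.pr_apply, Int.cast_sum, Finset.mul_sum]
  refine Finset.sum_congr rfl fun k _ => ?_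
  rw [emb_apply, Int.cast_mul]
  linear_combination -(x k : ℚ) * X.scale_mul_datum_a i k

theorem emb_smul (X : AffineType) (k : ℤ) (x : Lat X.rank) :
    X.emb (k • x) = (k : ℚ) • X.emb x := by
  rw [map_zsmul, Int.cast_smul_eq_zsmul]

theorem simpleRefl_emb (X : AffineType) (x : Lat X.rank) (i : X.Node) :
    X.simpleRefl i (X.emb x) = X.emb (X.datum.s i x) := by
  rw [simpleRefl, AffineDatum.s_apply, map_sub, emb_smul, emb_e, pairing_emb, smul_smul, mul_comm]

theorem wordAct_emb (X : AffineType) (w : List (Fin X.rank)) (x : Lat X.rank) :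
    X.wordAct w (X.emb x) = X.emb (((w.map Fin.succ).map X.datum.s).prod x) := by
  induction w with
  | nil => rfl
  | cons j w ih =>
    change X.simpleRefl j.succ (X.wordAct w (X.emb x)) = _
    rw [ih, simpleRefl_emb, List.map_cons, List.map_cons, List.prod_cons]
    rfl

/-- The canonical form in the coordinates of the datum. -/
theorem exists_form_emb (X : AffineType) :
    ∃ κ : ℚ, κ ≠ 0 ∧ ∀ x y, X.form (X.emb x) (X.emb y) = κ * X.datum.B x y := by
  have key : ∃ κ : ℚ, κ ≠ 0 ∧ ∀ j : X.Node,
      X.scale j * X.scale j * ((X.label j : ℚ) / (X.colabel j : ℚ))⁻¹ = κ * X.datum.d j := by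
    simp only [datum_d]
    by_cases h : X.isAEven = true
    · cases X with
      | twistedAEven n hn =>
        -- The constant is `a_0^∨ / a_0 = 1 / 2`, read off at the affine node, where `d` and the
        -- scale are `1`.
        refine ⟨1 / 2, by norm_num, fun j => ?_⟩
        rw [scale_twistedAEven]
        simp only [label, colabel, redLength]
        split_ifs <;> first | omega | norm_num
      | _ => simp [isAEven] at h
    · refine ⟨1, one_ne_zero, fun j => ?_⟩
      rw [scale_of_not fun h' => h h'.1, one_mul, one_mul, one_mul]
      have hj : (j : ℕ) ≤ X.rank := by omega
      cases X with
      | twistedAEven n hn => simp [isAEven] at h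
      | twistedAOdd n hn =>
        simp only [label, colabel, redLength]
        split_ifs <;> first | omega | norm_num
      | twistedD n hn =>
        simp only [label, colabel, redLength]
        split_ifs <;> norm_num
      | untwistedA n hn => simp [label, colabel, redLength]
      | untwistedD n hn =>
        simp only [label, colabel, redLength]
        split_ifs <;> norm_num
      | _ =>
        fin_cases j <;> norm_num [label, colabel, redLength]
  obtain ⟨κ, hκ, h⟩ := key
  refine ⟨κ, hκ, fun x y => ?_⟩
  have h1 : X.form (X.emb x) (X.emb y) = ∑ j, X.emb x j *
      ((X.label j : ℚ) / (X.colabel j : ℚ))⁻¹ * X.pairing (X.emb y) j := by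
    rw [form]
    refine Finset.sum_congr rfl fun j _ => ?_
    rw [pairing, Finset.mul_sum]
    exact Finset.sum_congr rfl fun k _ => by ring
  rw [h1, AffineDatum.B_apply, Int.cast_sum, Finset.mul_sum]
  refine Finset.sum_congr rfl fun j _ => ?_
  rw [emb_apply, pairing_emb]
  push_cast
  linear_combination (x j * X.datum.pr j y : ℚ) * h j

theorem thetaRefl_emb (X : AffineType) (x : Lat X.rank) :
    X.thetaRefl (X.emb x) = X.emb (X.datum.sth x) := by
  obtain ⟨κ, hκ, h⟩ := X.exists_form_emb
  have hl := X.label_zero_ne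
  have hθ : X.theta = (X.label 0 : ℚ) • X.emb X.datum.th := by
    rw [emb_th, thetaDiv, smul_smul, mul_inv_cancel₀ hl, one_smul]
  have hr : ∀ (c : ℚ) (a b : X.Space), X.form a (c • b) = c * X.form a b := by
    intro c a b
    simp only [form, Finset.mul_sum, Pi.smul_apply, smul_eq_mul]
    exact Finset.sum_congr rfl fun j _ => Finset.sum_congr rfl fun k _ => by ring
  have hrl : ∀ (c : ℚ) (a b : X.Space), X.form (c • a) b = c * X.form a b := by
    intro c a b
    simp only [form, Finset.mul_sum, Pi.smul_apply, smul_eq_mul]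
    exact Finset.sum_congr rfl fun j _ => Finset.sum_congr rfl fun k _ => by ring
  rw [thetaRefl, hθ, hr, hr, hrl, h, h, AffineDatum.B_th_th, AffineDatum.sth_apply, map_sub,
    emb_smul, smul_smul]
  congr 2
  rw [AffineDatum.B_symm]
  push_cast
  field_simp

theorem isLinearMap_simpleRefl (X : AffineType) (i : X.Node) :
    IsLinearMap ℚ (X.simpleRefl i) := by
  constructor
  · intro x y
    rw [simpleRefl, simpleRefl, simpleRefl, pairing_add]
    module
  · intro c x
    rw [simpleRefl, simpleRefl, pairing_smul]
    module

theorem isLinearMap_wordAct (X : AffineType) (w : List (Fin X.rank)) :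
    IsLinearMap ℚ (X.wordAct w) := by
  induction w with
  | nil => exact ⟨fun _ _ => rfl, fun _ _ => rfl⟩
  | cons j w ih =>
    constructor
    · intro x y
      change X.simpleRefl j.succ (X.wordAct w (x + y)) = _
      rw [ih.map_add, (X.isLinearMap_simpleRefl _).map_add]
      rfl
    · intro c x
      change X.simpleRefl j.succ (X.wordAct w (c • x)) = _
      rw [ih.map_smul, (X.isLinearMap_simpleRefl _).map_smul]
      rfl

theorem isLinearMap_thetaRefl (X : AffineType) : IsLinearMap ℚ X.thetaRefl := by
  have ha : ∀ a b c : X.Space, X.form (a + b) c = X.form a c + X.form b c := by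
    intro a b c
    simp only [form, ← Finset.sum_add_distrib, Pi.add_apply]
    exact Finset.sum_congr rfl fun j _ => Finset.sum_congr rfl fun k _ => by ring
  have hs : ∀ (c : ℚ) (a b : X.Space), X.form (c • a) b = c * X.form a b := by
    intro c a b
    simp only [form, Finset.mul_sum, Pi.smul_apply, smul_eq_mul]
    exact Finset.sum_congr rfl fun j _ => Finset.sum_congr rfl fun k _ => by ring
  constructor
  · intro x y
    rw [thetaRefl, thetaRefl, thetaRefl, ha, mul_add, add_div, add_smul]
    abel
  · intro c x
    rw [thetaRefl, thetaRefl, hs, smul_sub, smul_smul]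
    congr 2
    ring

theorem eq_of_emb {X : AffineType} {f g : X.Space → X.Space} (hf : IsLinearMap ℚ f)
    (hg : IsLinearMap ℚ g) (h : ∀ x, f (X.emb x) = g (X.emb x)) : f = g := by
  have h1 : hf.mk' f = hg.mk' g := by
    refine LinearMap.pi_ext fun i c => ?_
    have h2 : (Pi.single i c : X.Space) = (c / X.scale i) • X.emb (e i) := by
      rw [emb_e, smul_smul, div_mul_cancel₀ _ (X.scale_ne i), simpleRoot, ← Pi.single_smul',
        smul_eq_mul, mul_one]
    rw [h2, map_smul, map_smul]
    congr 1
    exact h _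
  exact congrArg (fun l : X.Space →ₗ[ℚ] X.Space => (l : X.Space → X.Space)) h1

/-- Equality of rational linear maps can be tested on the embedded lattice, which spans, and the
embedding is injective. -/
theorem wordAct_eq_thetaRefl_iff (X : AffineType) (w : List (Fin X.rank)) :
    X.wordAct w = X.thetaRefl ↔ ((w.map Fin.succ).map X.datum.s).prod = X.datum.sth := by
  constructor
  · intro h
    ext1 x
    refine X.emb_injective ?_
    rw [← wordAct_emb, h, thetaRefl_emb]
  · intro h
    refine eq_of_emb (X.isLinearMap_wordAct w) X.isLinearMap_thetaRefl fun x => ?_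
    rw [wordAct_emb, h, thetaRefl_emb]

theorem exists_map_succ {n : ℕ} (L : List (Fin (n + 1))) (hL : ∀ i ∈ L, i ∈ ({0} : Set _)ᶜ) :
    ∃ w : List (Fin n), w.map Fin.succ = L := by
  induction L with
  | nil => exact ⟨[], rfl⟩
  | cons i L ih =>
    obtain ⟨w, hw⟩ := ih fun j hj => hL j (List.mem_cons_of_mem _ hj)
    obtain ⟨j, hj⟩ := Fin.exists_succ_eq.2 (hL i List.mem_cons_self)
    exact ⟨j :: w, by rw [List.map_cons, hw, hj]⟩

theorem exists_isReducedTheta (X : AffineType) : ∃ w : List (Fin X.rank), X.IsReducedTheta w := by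
  have h1 : ∀ {u}, u ∈ X.datum.W {0}ᶜ →
      ∃ w : List (Fin X.rank), ((w.map Fin.succ).map X.datum.s).prod = u := by
    intro u hu
    refine X.datum.W_induction_left
      (p := fun u => ∃ w : List (Fin X.rank), ((w.map Fin.succ).map X.datum.s).prod = u)
      ⟨[], rfl⟩ ?_ hu
    rintro u i _ hi ⟨w, hw⟩
    obtain ⟨j, rfl⟩ := Fin.exists_succ_eq.2 hi
    exact ⟨j :: w, by rw [List.map_cons, List.map_cons, List.prod_cons, hw]⟩
  have h2 : ∃ N, ∃ w : List (Fin X.rank), w.length = N ∧ X.wordAct w = X.thetaRefl := by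
    obtain ⟨w, hw⟩ := h1 X.datum.sth_mem_fin
    exact ⟨_, w, rfl, (X.wordAct_eq_thetaRefl_iff w).2 hw⟩
  classical
  obtain ⟨w, hw, hw'⟩ := Nat.find_spec h2
  refine ⟨w, hw', fun v hv => ?_⟩
  rw [hw]
  exact Nat.find_min' h2 ⟨v, rfl, hv⟩

/-- A reduced word is shortest among words in the non-affine letters, which is the minimality that
`T_word` asks for. Thus every reduced decomposition computes the same lift. -/
theorem T_sth_eq (X : AffineType) {G : Type*} [Group G] {t : X.Node → G} (hbr : X.datum.Braids t)
    {w : List (Fin X.rank)} (hw : X.IsReducedTheta w) :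
    X.datum.T t X.datum.sth = (w.map fun j => t j.succ).prod := by
  have h1 := (X.wordAct_eq_thetaRefl_iff w).1 hw.1
  rw [← h1, X.datum.T_word hbr (I := {0}ᶜ) (w.map Fin.succ), List.map_map]
  · rfl
  · intro i hi
    obtain ⟨j, -, rfl⟩ := List.mem_map.1 hi
    exact Fin.succ_ne_zero j
  · intro L' hL' hprod
    obtain ⟨v, rfl⟩ := exists_map_succ L' hL'
    rw [List.length_map, List.length_map]
    exact hw.2 v ((X.wordAct_eq_thetaRefl_iff v).2 (hprod.trans h1))

theorem laces_eq (X : AffineType) (i j : X.Node) :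
    X.laces i j = X.datum.a i j * X.datum.a j i := by
  have h1 := X.scale_mul_datum_a i j
  have h2 := X.scale_mul_datum_a j i
  have h3 : (X.laces i j : ℚ) = X.datum.a i j * X.datum.a j i := by
    rw [laces]
    push_cast
    have : (X.cartan i j : ℚ) * X.cartan j i * (X.scale i * X.scale j) =
        X.datum.a i j * X.datum.a j i * (X.scale i * X.scale j) := by
      linear_combination
        -(X.cartan j i * X.scale i : ℚ) * h1 - (X.scale i * X.datum.a i j : ℚ) * h2
    exact mul_right_cancel₀ (mul_ne_zero (X.scale_ne i) (X.scale_ne j)) this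
  exact_mod_cast h3

theorem braidLength_eq (X : AffineType) (i j : X.Node) : X.braidLength i j = X.datum.len i j := by
  rw [braidLength, AffineDatum.len, laces_eq]

theorem datum_a_ne_zero (X : AffineType) {i j : X.Node} (h : X.cartan i j ≠ 0) :
    X.datum.a i j ≠ 0 := by
  intro h0
  have h1 := X.scale_mul_datum_a i j
  rw [h0, Int.cast_zero, mul_zero, eq_comm] at h1
  exact h (by exact_mod_cast (mul_eq_zero.1 h1).resolve_right (X.scale_ne j))

/-- In the modified type `A₂ₙ⁽²⁾` the last row has even entries, so the coroot of `α_n / 2` never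
takes the value `-1`; this matches the reflection relation omitted there. -/
theorem pr_last_even (X : AffineType) (h : X.isAEven = true) (x : Lat X.rank) :
    2 ∣ X.datum.pr (Fin.last X.rank) x := by
  rw [AffineDatum.pr_apply]
  refine Finset.dvd_sum fun k _ => Dvd.dvd.mul_right ?_ _
  rw [datum_a]
  cases X with
  | twistedAEven n hn =>
    have h1 : ((Fin.last (twistedAEven n hn).rank : (twistedAEven n hn).Node) : ℕ) = n := rfl
    simp only [redOffDiag, h1]
    split_ifs <;> norm_num
  | _ => simp [isAEven] at h

end AffineType

/-! ### The lattice and the double affine Artin group in coordinates -/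

namespace AffineType

open AffineDatum (Lat e)

/-- Sum twice: integrality of first differences descends from the last one, and then values ascend
from `g 0 = 0`. -/
theorem exists_int_of_second_differences {n : ℕ} {g : ℕ → ℚ} (h0 : g 0 = 0)
    (hn : ∃ z : ℤ, g (n + 1) - g n = z)
    (h : ∀ i, i < n → ∃ z : ℤ, 2 * g (i + 1) - g i - g (i + 2) = z) (j : ℕ) (hj : j ≤ n + 1) :
    ∃ z : ℤ, g j = z := by
  have hd : ∀ i, i ≤ n → ∃ z : ℤ, g (i + 1) - g i = z := by
    intro i hi
    induction hi using Nat.decreasingInduction with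
    | self => exact hn
    | of_succ i hi ih =>
      obtain ⟨y, hy⟩ := ih
      obtain ⟨z, hz⟩ := h i hi
      exact ⟨y + z, by push_cast; rw [← hy, ← hz]; ring⟩
  induction j with
  | zero => exact ⟨0, by simpa using h0⟩
  | succ j ih =>
    obtain ⟨y, hy⟩ := ih (by omega)
    obtain ⟨z, hz⟩ := hd j (by omega)
    exact ⟨y + z, by push_cast; rw [← hy, ← hz]; ring⟩

theorem sum_cartan_twistedAEven (n : ℕ) (hn : 1 ≤ n) (b : ℕ → ℚ) (i : ℕ) (hi : i < n) :
    ∑ k ∈ Finset.range (n + 1),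
      (if i + 1 = k then 2 else -((twistedAEven n hn).offDiag (i + 1) k : ℚ)) * b k =
    2 * b (i + 1) - b i - if i + 1 < n then (if i + 2 = n then 2 else 1) * b (i + 2) else 0 := by
  have key : ∀ k ∈ Finset.range (n + 1),
      (if i + 1 = k then 2 else -((twistedAEven n hn).offDiag (i + 1) k : ℚ)) * b k =
      (if k = i + 1 then 2 * b (i + 1) else 0) + (if k = i then -b i else 0) +
        (if k = i + 2 then -((if i + 2 = n then 2 else 1) * b (i + 2)) else 0) := by
    intro k hk
    have hk' : k < n + 1 := Finset.mem_range.1 hk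
    by_cases h1 : k = i + 1
    · subst h1; simp
    by_cases h2 : k = i
    · subst h2
      have : k ≠ n := by omega
      simp [offDiag, this]
    by_cases h3 : k = i + 2
    · subst h3
      simp [offDiag]
    have h4 : ¬(i + 1 + 1 = k ∨ k + 1 = i + 1) := by omega
    rw [if_neg (Ne.symm h1), if_neg h1, if_neg h2, if_neg h3]
    simp only [offDiag, if_neg h4]
    simp
  rw [Finset.sum_congr rfl key]
  simp only [Finset.sum_add_distrib, Finset.sum_ite_eq', Finset.mem_range]
  rw [if_pos (by omega), if_pos (by omega)]
  by_cases h : i + 1 < n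
  · rw [if_pos h, if_pos (by omega)]; ring
  · rw [if_neg h, if_neg (by omega)]; ring

theorem finWeightLattice_twistedAEven_le (n : ℕ) (hn : 1 ≤ n) :
    (twistedAEven n hn).finWeightLattice ≤ (twistedAEven n hn).emb.range := by
  rintro β ⟨h0, hβ⟩
  obtain ⟨N, rfl⟩ : ∃ N, n = N + 1 := ⟨n - 1, by omega⟩
  let b : ℕ → ℚ := fun k => if h : k < N + 1 + 1 then β ⟨k, h⟩ else 0
  -- Doubling the last coordinate, as dictated by `α_n / 2`, turns the pairings of a weight into
  -- second differences, except the last pairing, which becomes a first difference.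
  let g : ℕ → ℚ := fun k => (if k = N + 1 then 2 else 1) * b k
  have hb : ∀ i (hi : i < N + 1), (twistedAEven (N + 1) hn).pairing β ⟨i + 1, by
      change i + 1 < N + 1 + 1; omega⟩ =
      2 * b (i + 1) - b i -
        if i + 1 < N + 1 then (if i + 2 = N + 1 then 2 else 1) * b (i + 2) else 0 := by
    intro i hi
    rw [← sum_cartan_twistedAEven _ hn b i hi, ← Fin.sum_univ_eq_sum_range (fun k =>
      (if i + 1 = k then 2 else -((twistedAEven (N + 1) hn).offDiag (i + 1) k : ℚ)) * b k)]
    refine Finset.sum_congr rfl fun k _ => ?_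
    have h1 : b k = β k := dif_pos k.2
    rw [h1, cartan]
    congr 1
    simp only [Fin.ext_iff]
    split_ifs <;> push_cast <;> rfl
  have hg : ∀ j, j ≤ N + 1 → ∃ z : ℤ, g j = z := by
    refine fun j => exists_int_of_second_differences (n := N) ?_ ?_ ?_ j
    · have h1 : b 0 = 0 := (dif_pos (by omega)).trans h0
      change _ * b 0 = 0
      rw [h1, mul_zero]
    · obtain ⟨z, hz⟩ := hβ ⟨N + 1, by change N + 1 < N + 1 + 1; omega⟩ (by
        intro h; exact absurd (congrArg Fin.val h) (Nat.succ_ne_zero N))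
      refine ⟨z, ?_⟩
      rw [← hz, hb N (by omega), if_neg (by omega)]
      change (if N + 1 = N + 1 then (2 : ℚ) else 1) * b (N + 1) -
        (if N = N + 1 then (2 : ℚ) else 1) * b N = _
      rw [if_pos rfl, if_neg (by omega)]
      ring
    · intro i hi
      obtain ⟨z, hz⟩ := hβ ⟨i + 1, by change i + 1 < N + 1 + 1; omega⟩ (by
        intro h; exact absurd (congrArg Fin.val h) (Nat.succ_ne_zero i))
      refine ⟨z, ?_⟩
      rw [← hz, hb i (by omega), if_pos (by omega)]
      change 2 * ((if i + 1 = N + 1 then (2 : ℚ) else 1) * b (i + 1)) -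
        (if i = N + 1 then (2 : ℚ) else 1) * b i -
        (if i + 2 = N + 1 then (2 : ℚ) else 1) * b (i + 2) = _
      rw [if_neg (by omega : i + 1 ≠ N + 1), if_neg (by omega : i ≠ N + 1)]
      ring
  choose z hz using hg
  refine ⟨fun j => z j (Nat.lt_succ_iff.1 j.2), ?_⟩
  ext j
  rw [emb_apply, ← hz, scale_twistedAEven]
  have h1 : b j = β j := dif_pos j.2
  change (if (j : ℕ) = N + 1 then (2 : ℚ) else 1) * b j * _ = _
  rw [h1]
  split_ifs <;> ring

theorem fullLattice_le (X : AffineType) : X.fullLattice ≤ X.emb.range := by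
  refine sup_le ?_ (AddSubgroup.zmultiples_le_of_mem ⟨X.datum.m, X.emb_m⟩)
  rw [finLattice]
  split_ifs with h
  · cases X with
    | twistedAEven n hn => exact finWeightLattice_twistedAEven_le n hn
    | _ => simp [isAEven] at h
  · rintro β ⟨-, hβ⟩
    choose z hz using hβ
    refine ⟨z, ?_⟩
    ext j
    rw [emb_apply, scale_of_not fun h' => h h'.1, mul_one, hz]

/-- Unit steps never enter the rescaled node, whose row is even, so they involve only genuine simple
roots; the half root is supplied through `a_0⁻¹ δ`. -/
theorem emb_mem (X : AffineType) (x : Lat X.rank) : X.emb x ∈ X.fullLattice := by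
  have hm : X.datum.m ∈ X.fullLattice.comap X.emb := by
    rw [AddSubgroup.mem_comap, emb_m]; exact X.deltaDiv_mem
  have he : ∀ i, X.scale i = 1 → e i ∈ X.fullLattice.comap X.emb := by
    intro i hi
    rw [AddSubgroup.mem_comap, emb_e, hi, one_smul]
    exact X.simpleRoot_mem i
  refine X.datum.mem_of_gen _ hm (he 0 X.scale_zero) (fun i j _ _ hij => he j ?_) x
  refine scale_of_not ?_
  rintro ⟨h, rfl⟩
  have := X.pr_last_even h (e i)
  rw [AffineDatum.pr_e, hij] at this
  norm_num at this

/-- The coordinates of an element of the lattice with respect to the simple roots of the datum. -/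
noncomputable def coord (X : AffineType) (β : X.fullLattice) : Lat X.rank :=
  (X.fullLattice_le β.2).choose

theorem emb_coord (X : AffineType) (β : X.fullLattice) : X.emb (X.coord β) = β :=
  (X.fullLattice_le β.2).choose_spec

theorem coord_eq {X : AffineType} {β : X.fullLattice} {x : Lat X.rank}
    (h : (β : X.Space) = X.emb x) :
    X.coord β = x := X.emb_injective ((X.emb_coord β).trans h)

theorem coord_add (X : AffineType) (β γ : X.fullLattice) :
    X.coord (β + γ) = X.coord β + X.coord γ :=
  coord_eq (by rw [map_add, emb_coord, emb_coord]; rfl)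

theorem map_altProd {M N : Type*} [Monoid M] [Monoid N] (f : M →* N) (k : ℕ) (x y : M) :
    f (altProd k x y) = altProd k (f x) (f y) := by
  induction k generalizing x y with
  | zero => exact map_one f
  | succ k ih => rw [altProd, altProd, map_mul, ih]

theorem mk_eq_mk_of_rel {S : Type} {R : FreeGroup S → FreeGroup S → Prop}
    {u v : FreeGroup S} (h : R u v) :
    PresentedGroup.mk {r : FreeGroup S | ∃ u v, R u v ∧ r = u * v⁻¹} u =
      PresentedGroup.mk {r : FreeGroup S | ∃ u v, R u v ∧ r = u * v⁻¹} v :=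
  PresentedGroup.mk_eq_mk_of_mul_inv_mem ⟨u, v, h, rfl⟩

section DoubleArtin

variable (X : AffineType)

theorem braids_dT : X.datum.Braids X.dT := by
  intro i j hij
  have h := mk_eq_mk_of_rel (DoubleRel.braid (X := X) i j hij)
  rw [map_altProd, map_altProd, braidLength_eq] at h
  exact h

/-- The elements `X_β` of the double affine Artin group in the coordinates of the datum. -/
def dXEmb (x : Lat X.rank) : X.DoubleArtin := X.dX (X.emb x) (X.emb_mem x)

theorem dX_eq {β γ : X.Space} (h : β = γ) (hβ : β ∈ X.fullLattice) :
    X.dX β hβ = X.dX γ (h ▸ hβ) := by subst h; rfl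

theorem doubleLat_dX : X.datum.DoubleLat X.dT X.dXEmb := by
  refine ⟨fun x y => ?_, fun i => ?_, fun i x hx => ?_, fun i x hx => ?_⟩
  · have h := mk_eq_mk_of_rel
      (DoubleRel.add ⟨X.emb x, X.emb_mem x⟩ ⟨X.emb y, X.emb_mem y⟩)
    rw [dXEmb, dX_eq X (map_add X.emb x y)]
    exact h
  · have h := mk_eq_mk_of_rel (DoubleRel.central (X := X) (DoubleGen.T i))
    rw [dXEmb, dX_eq X X.emb_m]
    exact h
  · exact mk_eq_mk_of_rel (DoubleRel.commute i ⟨X.emb x, X.emb_mem x⟩ (by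
      rw [pairing_emb, hx, Int.cast_zero, mul_zero]))
  · have hi : ¬(X.isAEven = true ∧ i = Fin.last X.rank) := by
      rintro ⟨h, rfl⟩
      have := X.pr_last_even h x
      rw [hx] at this
      norm_num at this
    have hp : X.pairing (X.emb x) i = -1 := by
      rw [pairing_emb, hx, scale_of_not hi]; norm_num
    have h := mk_eq_mk_of_rel (DoubleRel.reflect i hi ⟨X.emb x, X.emb_mem x⟩ hp)
    have h1 : X.emb (x + e i) = X.simpleRefl i (X.emb x) := by
      rw [simpleRefl, hp, map_add, emb_e, scale_of_not hi]; module
    rw [dXEmb, dXEmb, dX_eq X h1]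
    exact h

theorem central_dX (g : X.DoubleArtin) : Commute (X.dX X.deltaDiv X.deltaDiv_mem) g := by
  have h : (⊤ : Subgroup X.DoubleArtin) ≤
      Subgroup.centralizer {X.dX X.deltaDiv X.deltaDiv_mem} := by
    rw [← PresentedGroup.closure_range_of, Subgroup.closure_le]
    rintro _ ⟨s, rfl⟩
    rw [SetLike.mem_coe, Subgroup.mem_centralizer_singleton_iff]
    exact (mk_eq_mk_of_rel (DoubleRel.central (X := X) s)).symm
  have h1 := h (Subgroup.mem_top g)
  rw [Subgroup.mem_centralizer_singleton_iff] at h1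
  exact h1.symm

end DoubleArtin

end AffineType

/-! ### The two morphisms -/

namespace AffineType

open AffineDatum (Lat e)

/-- The morphism out of a group given by generators and relations. -/
def liftGroupOf {S : Type} {R : FreeGroup S → FreeGroup S → Prop} {G : Type*} [Group G]
    (f : S → G) (h : ∀ u v, R u v → FreeGroup.lift f u = FreeGroup.lift f v) : GroupOf R →* G :=
  PresentedGroup.toGroup (f := f) (by
    rintro _ ⟨u, v, huv, rfl⟩
    rw [map_mul, map_inv, h u v huv, mul_inv_cancel])

theorem liftGroupOf_of {S : Type} {R : FreeGroup S → FreeGroup S → Prop} {G : Type*} [Group G]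
    (f : S → G) (h : ∀ u v, R u v → FreeGroup.lift f u = FreeGroup.lift f v) (s : S) :
    liftGroupOf f h (PresentedGroup.of s) = f s := PresentedGroup.toGroup.of _

section

variable (X : AffineType) (α : Fin X.rank) (w : List (Fin X.rank))

/-- The images of the generators of the triple group in the double affine Artin group. -/
def phiGen : X.TripleGen → X.DoubleArtin
  | .T j => X.dT j.succ
  | .T01 => X.dT 0
  | .T02 => (X.dT 0)⁻¹ * X.dX (X.simpleRoot 0) (X.simpleRoot_mem 0)
  | .T03 => X.dX X.thetaDiv X.thetaDiv_mem_full * (X.dTheta w)⁻¹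

variable {X w}

theorem single_of_laces (h : X.laces 0 α.succ = 1) : X.datum.a 0 α.succ = -1 := by
  rw [laces_eq] at h
  rcases X.datum.a_zero_left (Fin.succ_ne_zero α) with h1 | h1 | h1 | h1
  · rw [h1.1] at h; norm_num at h
  · exact h1.1
  · rw [h1.1, h1.2.1] at h; norm_num at h
  · rw [h1.1, h1.2] at h; norm_num at h

theorem double_of_laces (h : X.laces 0 α.succ = 2) :
    X.datum.a 0 α.succ = -2 ∧ X.datum.a α.succ 0 = -1 := by
  rw [laces_eq] at h
  rcases X.datum.a_zero_left (Fin.succ_ne_zero α) with h1 | h1 | h1 | h1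
  · rw [h1.1] at h; norm_num at h
  · rw [h1.1, h1.2.1] at h; norm_num at h
  · exact ⟨h1.1, h1.2.1⟩
  · rw [h1.1, h1.2] at h; norm_num at h

theorem TripleGen.exists_of_node_ne_zero {g : X.TripleGen} (h : g.node ≠ 0) :
    ∃ j, g = TripleGen.T j := by
  cases g with
  | T j => exact ⟨j, rfl⟩
  | _ => exact absurd rfl h

theorem dTheta_eq (hw : X.IsReducedTheta w) :
    X.dTheta w = X.datum.T X.dT X.datum.sth := (X.T_sth_eq X.braids_dT hw).symm

theorem phiGen_two : X.phiGen w .T02 = (X.dT 0)⁻¹ * X.dXEmb (e 0) := by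
  rw [dXEmb, dX_eq X X.emb_e_zero]; rfl

theorem phiGen_three (hw : X.IsReducedTheta w) :
    X.phiGen w .T03 = X.dXEmb X.datum.th * (X.datum.T X.dT X.datum.sth)⁻¹ := by
  rw [dXEmb, dX_eq X X.emb_th, ← dTheta_eq hw]; rfl

theorem phiGen_update (hw : X.IsReducedTheta w) (g : X.TripleGen) (hg : g.node = 0) :
    X.datum.Braids (Function.update X.dT 0 (X.phiGen w g)) := by
  cases g with
  | T j => exact absurd hg (Fin.succ_ne_zero j)
  | T01 =>
    change X.datum.Braids (Function.update X.dT 0 (X.dT 0))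
    rw [Function.update_eq_self]
    exact X.braids_dT
  | T02 =>
    rw [phiGen_two]
    exact X.doubleLat_dX.braids_two X.braids_dT
  | T03 =>
    rw [phiGen_three hw]
    exact X.doubleLat_dX.braids_three X.braids_dT

theorem phiGen_braid (hw : X.IsReducedTheta w) (g h : X.TripleGen) (hgh : g.node ≠ h.node) :
    altProd (X.braidLength g.node h.node) (X.phiGen w g) (X.phiGen w h) =
      altProd (X.braidLength g.node h.node) (X.phiGen w h) (X.phiGen w g) := by
  rw [braidLength_eq]
  by_cases hg : g.node = 0
  · obtain ⟨j, rfl⟩ := TripleGen.exists_of_node_ne_zero fun h0 => hgh (hg.trans h0.symm)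
    have := phiGen_update hw g hg 0 j.succ (Fin.succ_ne_zero j).symm
    rw [Function.update_self, Function.update_of_ne (Fin.succ_ne_zero j)] at this
    rw [hg]
    exact this
  · obtain ⟨i, rfl⟩ := TripleGen.exists_of_node_ne_zero hg
    by_cases hh : h.node = 0
    · have := phiGen_update hw h hh i.succ 0 (Fin.succ_ne_zero i)
      rw [Function.update_self, Function.update_of_ne (Fin.succ_ne_zero i)] at this
      rw [hh]
      exact this
    · obtain ⟨j, rfl⟩ := TripleGen.exists_of_node_ne_zero hh
      exact X.braids_dT i.succ j.succ hgh

theorem phiGen_rel (hw : X.IsReducedTheta w) (u v : FreeGroup X.TripleGen)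
    (h : X.TripleRel α u v) : FreeGroup.lift (X.phiGen w) u = FreeGroup.lift (X.phiGen w) v := by
  have h2 := phiGen_two (X := X) (w := w)
  have h3 := phiGen_three hw
  cases h with
  | braid g h hgh =>
    rw [map_altProd, map_altProd, FreeGroup.lift_apply_of, FreeGroup.lift_apply_of]
    exact phiGen_braid hw g h hgh
  | single hl k d x y hd hx hy =>
    have h := X.doubleLat_dX.single X.braids_dT (Fin.succ_ne_zero α) (single_of_laces α hl) k
      _ _ (FreeGroup.lift (X.phiGen w) d) (FreeGroup.lift (X.phiGen w) y) h2 h3 (by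
        rw [hd]; simp only [map_mul, FreeGroup.lift_apply_of]; rfl) (by
        rcases hy with rfl | rfl | rfl | rfl | rfl
        · exact Or.inl (FreeGroup.lift_apply_of)
        · exact Or.inr (Or.inl (FreeGroup.lift_apply_of))
        · exact Or.inr (Or.inr (Or.inl (FreeGroup.lift_apply_of)))
        · refine Or.inr (Or.inr (Or.inr (Or.inl ?_)))
          simp only [map_mul, map_inv, FreeGroup.lift_apply_of]
          rfl
        · refine Or.inr (Or.inr (Or.inr (Or.inr ?_)))
          simp only [map_mul, map_inv, FreeGroup.lift_apply_of])
    have hx' : FreeGroup.lift (X.phiGen w) x = FreeGroup.lift (X.phiGen w) d ^ k * X.dT α.succ *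
        FreeGroup.lift (X.phiGen w) d ^ (-k) := by
      rw [hx]
      simp only [map_mul, map_zpow, FreeGroup.lift_apply_of]
      rfl
    rw [← hx'] at h
    simp only [map_mul]
    exact h
  | double hl g h hgh =>
    obtain ⟨ha, ha'⟩ := double_of_laces α hl
    obtain ⟨r1, r2, r3⟩ :=
      X.doubleLat_dX.double X.braids_dT (Fin.succ_ne_zero α) ha ha' _ _ h2 h3
    simp only [map_mul, map_inv, FreeGroup.lift_apply_of]
    have key : ∀ y z : X.DoubleArtin, Commute y ((X.dT α.succ)⁻¹ * z * X.dT α.succ) →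
        y * (X.dT α.succ)⁻¹ * z * X.dT α.succ = (X.dT α.succ)⁻¹ * z * X.dT α.succ * y := by
      intro y z hyz
      rw [← hyz.eq]
      simp only [mul_assoc]
    rcases hgh with ⟨rfl, rfl⟩ | ⟨rfl, rfl⟩ | ⟨rfl, rfl⟩
    · exact key _ _ r1
    · exact key _ _ r2
    · exact key _ _ r3

/-- The morphism from the triple group to the double affine Artin group. -/
def phiTriple (hw : X.IsReducedTheta w) : X.TripleGroup α →* X.DoubleArtin :=
  liftGroupOf (X.phiGen w) (phiGen_rel α hw)

theorem phiTriple_gen (hw : X.IsReducedTheta w) (g : X.TripleGen) :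
    phiTriple α hw (X.tripleGen α g) = X.phiGen w g := liftGroupOf_of _ _ g

theorem phiTriple_theta (hw : X.IsReducedTheta w) :
    phiTriple α hw (X.tripleTheta α w) = X.dTheta w := by
  rw [tripleTheta, map_list_prod, List.map_map, dTheta]
  congr 1

theorem phiTriple_C (hw : X.IsReducedTheta w) :
    phiTriple α hw (X.tripleC α w) = X.dX X.deltaDiv X.deltaDiv_mem := by
  rw [tripleC, map_mul, map_mul, map_mul, phiTriple_gen, phiTriple_gen, phiTriple_gen,
    phiTriple_theta, phiGen_two, phiGen_three hw, dTheta_eq hw]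
  change X.dT 0 * _ * _ * _ = _
  rw [X.doubleLat_dX.prod_eq, inv_mul_cancel_right, dXEmb, dX_eq X X.emb_m]

/-- The morphism `φ`. -/
def phi (hw : X.IsReducedTheta w) : X.TripleQuotient α w →* X.DoubleArtin :=
  QuotientGroup.lift _ (phiTriple α hw) (by
    intro x hx
    have h : Subgroup.normalClosure (Set.range fun g : X.TripleGroup α =>
        X.tripleC α w * g * (X.tripleC α w)⁻¹ * g⁻¹) ≤ (phiTriple α hw).ker := by
      refine Subgroup.normalClosure_le_normal ?_
      rintro _ ⟨g, rfl⟩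
      rw [SetLike.mem_coe, MonoidHom.mem_ker, map_mul, map_mul, map_mul, map_inv, map_inv,
        phiTriple_C, (X.central_dX _).eq, mul_inv_cancel_right, mul_inv_cancel]
    exact h hx)

theorem phi_toQuotient (hw : X.IsReducedTheta w) (g : X.TripleGroup α) :
    phi α hw (X.toQuotient α w g) = phiTriple α hw g := rfl

theorem phi_gen (hw : X.IsReducedTheta w) (g : X.TripleGen) :
    phi α hw (X.toQuotient α w (X.tripleGen α g)) = X.phiGen w g := phiTriple_gen α hw g

variable (X w)

/-- The generators of the quotient of the triple group. -/
def qGen (g : X.TripleGen) : X.TripleQuotient α w := X.toQuotient α w (X.tripleGen α g)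

/-- The elements `T_0, T_1, …, T_n` of the quotient of the triple group, where `T_0` is the given
generator. -/
def qNode (g : X.TripleGen) : X.Node → X.TripleQuotient α w :=
  Fin.cases (X.qGen α w g) fun j => X.qGen α w (.T j)

theorem update_qNode (g h : X.TripleGen) :
    Function.update (X.qNode α w g) 0 (X.qGen α w h) = X.qNode α w h := by
  ext i
  refine Fin.cases ?_ (fun j => ?_) i
  · rw [Function.update_self]; rfl
  · rw [Function.update_of_ne (Fin.succ_ne_zero j)]; rfl

theorem qGen_rel {u v : FreeGroup X.TripleGen} (h : X.TripleRel α u v) :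
    FreeGroup.lift (X.qGen α w) u = FreeGroup.lift (X.qGen α w) v := by
  have h1 : FreeGroup.lift (X.qGen α w) = (X.toQuotient α w).comp (PresentedGroup.mk _) := by
    ext g
    rw [FreeGroup.lift_apply_of]
    rfl
  rw [h1, MonoidHom.comp_apply, MonoidHom.comp_apply, mk_eq_mk_of_rel h]

theorem braids_qNode (g : X.TripleGen) (hg : g.node = 0) : X.datum.Braids (X.qNode α w g) := by
  have key : ∀ g h : X.TripleGen, g.node ≠ h.node →
      altProd (X.datum.len g.node h.node) (X.qGen α w g) (X.qGen α w h) =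
        altProd (X.datum.len g.node h.node) (X.qGen α w h) (X.qGen α w g) := by
    intro g h hgh
    have := X.qGen_rel α w (TripleRel.braid g h hgh)
    rwa [map_altProd, map_altProd, FreeGroup.lift_apply_of, FreeGroup.lift_apply_of,
      braidLength_eq] at this
  have hnode : ∀ i : X.Node, ∃ h : X.TripleGen, h.node = i ∧ X.qNode α w g i = X.qGen α w h := by
    intro i
    refine Fin.cases ⟨g, hg, rfl⟩ (fun j => ⟨.T j, rfl, rfl⟩) i
  intro i j hij
  obtain ⟨h1, rfl, e1⟩ := hnode i
  obtain ⟨h2, rfl, e2⟩ := hnode j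
  rw [e1, e2]
  exact key h1 h2 hij

theorem central_C (g : X.TripleQuotient α w) : Commute (X.toQuotient α w (X.tripleC α w)) g := by
  obtain ⟨g, rfl⟩ := QuotientGroup.mk'_surjective _ g
  change X.toQuotient α w (X.tripleC α w) * X.toQuotient α w g =
    X.toQuotient α w g * X.toQuotient α w (X.tripleC α w)
  rw [← mul_inv_eq_one, mul_inv_rev, ← mul_assoc, ← map_mul, ← map_inv, ← map_inv, ← map_mul,
    ← map_mul]
  exact (QuotientGroup.eq_one_iff _).2 (Subgroup.subset_normalClosure ⟨g, rfl⟩)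

theorem toQuotient_theta :
    X.toQuotient α w (X.tripleTheta α w) = (w.map fun j => X.qGen α w (.T j)).prod := by
  rw [tripleTheta, map_list_prod, List.map_map]
  rfl

variable {X w}

/-- The Bernstein elements are built with `T03` at the affine node, while the resulting double
affine structure has `T01` there. -/
theorem exists_doubleLat (hα : X.cartan 0 α.succ ≠ 0) (hw : X.IsReducedTheta w) :
    ∃ Y : Lat X.rank → X.TripleQuotient α w, X.datum.DoubleLat (X.qNode α w .T01) Y ∧
      Y X.datum.m = X.toQuotient α w (X.tripleC α w) ∧
      Y X.datum.th = X.toQuotient α w (X.tripleGen α .T03 * X.tripleTheta α w) ∧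
      Y (e 0) = X.qGen α w .T01 * X.qGen α w .T02 := by
  have hbr := X.braids_qNode α w .T03 rfl
  have hT : X.datum.T (X.qNode α w .T03) X.datum.sth = X.toQuotient α w (X.tripleTheta α w) := by
    rw [X.T_sth_eq hbr hw, toQuotient_theta]
    rfl
  have hC : X.qGen α w .T01 * X.qGen α w .T02 * X.qNode α w .T03 0 *
      X.datum.T (X.qNode α w .T03) X.datum.sth = X.toQuotient α w (X.tripleC α w) := by
    rw [hT]
    rfl
  obtain ⟨Y, h1, h2, h3, h4⟩ := X.datum.exists_doubleLat hbr (a := X.qGen α w .T01)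
    (b := X.qGen α w .T02) (by rw [update_qNode]; exact X.braids_qNode α w .T01 rfl)
    (by rw [update_qNode]; exact X.braids_qNode α w .T02 rfl)
    (fun g => by rw [hC]; exact X.central_C α w g) (Fin.succ_ne_zero α) (X.datum_a_ne_zero hα)
    (by
      intro ha ha'
      have hl : X.laces 0 α.succ = 2 := by rw [laces_eq, ha, ha']; norm_num
      have h := X.qGen_rel α w (TripleRel.double hl .T01 .T02 (Or.inl ⟨rfl, rfl⟩))
      simp only [map_mul, map_inv, FreeGroup.lift_apply_of] at h
      change X.qGen α w .T01 * ((X.qGen α w (.T α))⁻¹ * X.qGen α w .T02 * X.qGen α w (.T α)) =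
        (X.qGen α w (.T α))⁻¹ * X.qGen α w .T02 * X.qGen α w (.T α) * X.qGen α w .T01
      rw [← h]
      simp only [mul_assoc])
  rw [update_qNode] at h1
  refine ⟨Y, h1, h2.trans hC, ?_, h4⟩
  rw [h3, hT, map_mul]
  rfl

/-- The images of the generators of the double affine Artin group, for given images of the lattice
elements. -/
noncomputable def psiGen (Y : Lat X.rank → X.TripleQuotient α w) :
    X.DoubleGen → X.TripleQuotient α w
  | .T i => X.qNode α w .T01 i
  | .X β => Y (X.coord β)

theorem psiGen_rel {Y : Lat X.rank → X.TripleQuotient α w}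
    (hY : X.datum.DoubleLat (X.qNode α w .T01) Y)
    (hc : ∀ g, Commute (Y X.datum.m) g) (u v : FreeGroup X.DoubleGen) (h : X.DoubleRel u v) :
    FreeGroup.lift (psiGen α Y) u = FreeGroup.lift (psiGen α Y) v := by
  have hpr : ∀ (i : X.Node) (β : X.fullLattice),
      X.pairing (β : X.Space) i = X.scale i * X.datum.pr i (X.coord β) := by
    intro i β
    rw [← pairing_emb, emb_coord]
  cases h with
  | braid i j hij =>
    rw [map_altProd, map_altProd, FreeGroup.lift_apply_of, FreeGroup.lift_apply_of, braidLength_eq]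
    exact X.braids_qNode α w .T01 rfl i j hij
  | add β γ =>
    simp only [map_mul, FreeGroup.lift_apply_of]
    change Y (X.coord (β + γ)) = _
    rw [coord_add, hY.add]
    rfl
  | central g =>
    simp only [map_mul, FreeGroup.lift_apply_of]
    have : psiGen α Y (.X ⟨X.deltaDiv, X.deltaDiv_mem⟩) = Y X.datum.m :=
      congrArg Y (coord_eq X.emb_m.symm)
    rw [this]
    exact hc _
  | commute i β h =>
    simp only [map_mul, FreeGroup.lift_apply_of]
    rw [hpr] at h
    exact hY.comm i _ (by exact_mod_cast (mul_eq_zero.1 h).resolve_left (X.scale_ne i))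
  | reflect i hi β h =>
    simp only [map_mul, FreeGroup.lift_apply_of]
    have h1 : X.coord ⟨X.simpleRefl i β, X.simpleRefl_mem i β β.2 h⟩ = X.coord β + e i := by
      refine coord_eq ?_
      rw [map_add, emb_coord, emb_e, scale_of_not hi]
      change X.simpleRefl i β = _
      rw [simpleRefl, h]
      module
    rw [hpr, scale_of_not hi, one_mul] at h
    change _ = Y (X.coord _)
    rw [h1]
    exact hY.reflect i _ (by exact_mod_cast h)

theorem exists_isomorphism (hα : X.cartan 0 α.succ ≠ 0) (hw : X.IsReducedTheta w) :
    ∃ ψ : X.DoubleArtin →* X.TripleQuotient α w,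
      (∀ j : Fin X.rank, ψ (X.dT j.succ) = X.qGen α w (.T j)) ∧
      ψ (X.dT 0) = X.qGen α w .T01 ∧
      ψ (X.dX X.thetaDiv X.thetaDiv_mem_full) =
        X.toQuotient α w (X.tripleGen α .T03 * X.tripleTheta α w) ∧
      ψ (X.dX X.deltaDiv X.deltaDiv_mem) = X.toQuotient α w (X.tripleC α w) ∧
      (phi α hw).comp ψ = MonoidHom.id X.DoubleArtin ∧
      ψ.comp (phi α hw) = MonoidHom.id (X.TripleQuotient α w) := by
  obtain ⟨Y, hY, hm, hth, h0⟩ := exists_doubleLat α hα hw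
  let ψ : X.DoubleArtin →* X.TripleQuotient α w :=
    liftGroupOf (psiGen α Y) (psiGen_rel α hY fun g => by rw [hm]; exact X.central_C α w g)
  have hψT : ∀ i, ψ (X.dT i) = X.qNode α w .T01 i := fun i => liftGroupOf_of _ _ _
  have hψX : ∀ x, ψ (X.dXEmb x) = Y x := fun x =>
    (liftGroupOf_of _ _ _).trans (congrArg Y (coord_eq rfl))
  have hψδ : ψ (X.dX X.deltaDiv X.deltaDiv_mem) = X.toQuotient α w (X.tripleC α w) := by
    rw [← dX_eq X X.emb_m (X.emb_mem _), ← hm]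
    exact hψX _
  have hψθ : ψ (X.dX X.thetaDiv X.thetaDiv_mem_full) =
      X.toQuotient α w (X.tripleGen α .T03 * X.tripleTheta α w) := by
    rw [← dX_eq X X.emb_th (X.emb_mem _), ← hth]
    exact hψX _
  have hψ0 : ψ (X.dX (X.simpleRoot 0) (X.simpleRoot_mem 0)) =
      X.qGen α w .T01 * X.qGen α w .T02 := by
    rw [← dX_eq X X.emb_e_zero (X.emb_mem _), ← h0]
    exact hψX _
  have hφT : ∀ i, phi α hw (X.qNode α w .T01 i) = X.dT i := by
    refine Fin.cases ?_ fun j => ?_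
    · exact phi_gen α hw .T01
    · exact phi_gen α hw (.T j)
  have hφY : ∀ x, phi α hw (Y x) = X.dXEmb x := by
    let p : Multiplicative (Lat X.rank) →* X.DoubleArtin :=
      MonoidHom.mk' (fun x => phi α hw (Y x.toAdd)) fun x y => by
        rw [toAdd_mul, hY.add, map_mul]
    let q : Multiplicative (Lat X.rank) →* X.DoubleArtin :=
      MonoidHom.mk' (fun x => X.dXEmb x.toAdd) fun x y => by
        rw [toAdd_mul, X.doubleLat_dX.add]
    let S : AddSubgroup (Lat X.rank) := Subgroup.toAddSubgroup' (p.eqLocus q)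
    have hS : ∀ x, x ∈ S ↔ phi α hw (Y x) = X.dXEmb x := fun _ => Iff.rfl
    -- The comparison holds for `δ` and `α_0` by the values of `φ`, and it passes along unit steps
    -- because both sides satisfy the reflection relation; no explicit formula for `Y` is needed.
    refine fun x => (hS x).1 (X.datum.mem_of_gen S ?_ ?_ ?_ x)
    · rw [hS, hm, phi_toQuotient, phiTriple_C, dXEmb, dX_eq X X.emb_m]
    · rw [hS, h0, map_mul]
      change phi α hw (X.toQuotient α w (X.tripleGen α .T01)) *
        phi α hw (X.toQuotient α w (X.tripleGen α .T02)) = _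
      rw [phi_gen, phi_gen, phiGen_two]
      exact mul_inv_cancel_left _ _
    · intro i j _ hi hij
      have h1 : e i + e j ∈ S := by
        rw [hS] at hi ⊢
        have hp : X.datum.pr j (e i) = -1 := by rw [AffineDatum.pr_e, hij]
        rw [← hY.reflect j _ hp, ← X.doubleLat_dX.reflect j _ hp, map_mul, map_mul, hi, hφT]
      simpa using sub_mem h1 hi
  refine ⟨ψ, fun j => hψT _, hψT 0, hψθ, hψδ, ?_, ?_⟩
  · refine PresentedGroup.ext fun g => ?_
    cases g with
    | T i =>
      change phi α hw (ψ (X.dT i)) = X.dT i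
      rw [hψT, hφT]
    | X β =>
      change phi α hw (ψ (X.dX β β.2)) = X.dX β β.2
      rw [← dX_eq X (X.emb_coord β) (X.emb_mem _)]
      change phi α hw (ψ (X.dXEmb _)) = X.dXEmb _
      rw [hψX, hφY]
  · have hψθ' : ψ (X.dTheta w) = X.toQuotient α w (X.tripleTheta α w) := by
      rw [dTheta, map_list_prod, List.map_map, toQuotient_theta]
      congr 1
    refine QuotientGroup.monoidHom_ext _ (PresentedGroup.ext fun g => ?_)
    change ψ (phi α hw (X.toQuotient α w (X.tripleGen α g))) = X.qGen α w g
    rw [phi_gen]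
    cases g with
    | T j => exact hψT _
    | T01 => exact hψT _
    | T02 =>
      rw [phiGen, map_mul, map_inv, hψ0, hψT]
      exact inv_mul_cancel_left _ _
    | T03 =>
      rw [phiGen, map_mul, map_inv, hψθ, hψθ', map_mul, mul_inv_cancel_right]
      rfl

end

end AffineType

theorem theorem3 (X : AffineType) (α : Fin X.rank) (hα : X.cartan 0 α.succ ≠ 0) :
    (∃ w : List (Fin X.rank), X.IsReducedTheta w) ∧
    ∀ w : List (Fin X.rank), X.IsReducedTheta w →
      ∃ (φ : X.TripleQuotient α w →* X.DoubleArtin) (ψ : X.DoubleArtin →* X.TripleQuotient α w),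
        ((∀ j : Fin X.rank,
            φ (X.toQuotient α w (X.tripleGen α (AffineType.TripleGen.T j))) = X.dT j.succ) ∧
          φ (X.toQuotient α w (X.tripleGen α AffineType.TripleGen.T01)) = X.dT 0 ∧
          φ (X.toQuotient α w (X.tripleGen α AffineType.TripleGen.T02)) =
            (X.dT 0)⁻¹ * X.dX (X.simpleRoot 0) (X.simpleRoot_mem 0) ∧
          φ (X.toQuotient α w (X.tripleGen α AffineType.TripleGen.T03)) =
            X.dX X.thetaDiv X.thetaDiv_mem_full * (X.dTheta w)⁻¹) ∧
        ((∀ j : Fin X.rank,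
            ψ (X.dT j.succ) = X.toQuotient α w (X.tripleGen α (AffineType.TripleGen.T j))) ∧
          ψ (X.dT 0) = X.toQuotient α w (X.tripleGen α AffineType.TripleGen.T01) ∧
          ψ (X.dX X.thetaDiv X.thetaDiv_mem_full) =
            X.toQuotient α w
              (X.tripleGen α AffineType.TripleGen.T03 * X.tripleTheta α w) ∧
          ψ (X.dX X.deltaDiv X.deltaDiv_mem) = X.toQuotient α w (X.tripleC α w)) ∧
        φ.comp ψ = MonoidHom.id X.DoubleArtin ∧
        ψ.comp φ = MonoidHom.id (X.TripleQuotient α w) := by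
  refine ⟨X.exists_isReducedTheta, fun w hw => ?_⟩
  obtain ⟨ψ, h1, h2, h3, h4, h5, h6⟩ := AffineType.exists_isomorphism α hα hw
  exact ⟨AffineType.phi α hw, ψ,
    ⟨fun j => AffineType.phi_gen α hw _, AffineType.phi_gen α hw _, AffineType.phi_gen α hw _,
      AffineType.phi_gen α hw _⟩, ⟨h1, h2, h3, h4⟩, h5, h6⟩
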